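/- Let $\phi_j$ ($j\in\frac12+\mathbb Z$) be free bosons, $[\phi_i,\phi_j]=(-1)^{j-1/2}\delta_{i,-j}$, acting on the Fock space with vacuum $|0\rangle$, where $\phi_{-j}|0\rangle=0$ and $\langle0|\phi_j=0$ for $j>0$; put $\phi(z)=\sum_{k\in\mathbb Z}\phi_{k+1/2}z^k$ and $:\!ab\!:\,=ab-\langle0|ab|0\rangle$. Define $H_n$ ($n$ odd) by $\sum_{n\ \mathrm{odd}}H_nz^{-n-1}=-\frac12:\!\phi(-z)\phi(z)\!:$, and $H_j$ ($j\in\frac12+\mathbb Z$) by $2\sum_jH_jz^{-j-1/2}=V_-(z)^{-1}\phi(z)V_+(z)^{-1}$ with $V_\pm(z)=\exp\sum_{\pm k>0,\ k\ \mathrm{odd}}\frac2kH_kz^{-k}$; let $\langle1|=\langle0|H_{1/2}$. Let $t=(t_1=x,t_3,t_5,\dots)$, $H(t)=\sum_{n>0\ \mathrm{odd}}t_nH_n$, $\xi(t,z)=\sum_{n>0\ \mathrm{odd}}t_nz^n$, $\partial=\partial_x$. Let $\bar c_\infty$ be the Lie algebra of complex matrices $(a_{ij})_{i,j\in\mathbb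 Z}$ with finitely many non-zero diagonals and $a_{ij}=(-1)^{i+j+1}a_{1-j,1-i}$, $c_\infty=\bar c_\infty\oplus\mathbb Cc$, represented by $\hat\pi(E_{ij}-(-1)^{i+j}E_{1-j,1-i})=(-1)^{j-1}:\!\phi_{i-1/2}\phi_{1/2-j}\!:$ and $\hat\pi(c)=-\frac12$. Let $Sp_\infty$ be the set of products $g=e^{\hat\pi(a_1)}\cdots e^{\hat\pi(a_k)}$, $a_i\in c_\infty$; these operators act on the completion of the Fock space in the energy grading, each exponential being defined on the vectors for which its series converges unconditionally in every coefficient. Let $g\in Sp_\infty$ be such that $g|0\rangle$ is defined, and let $\beta\in V=\bigoplus_{l\in\frac12+\mathbb Z}\mathbb C\phi_l$ be such that the formal power series $\langle1|e^{H(t)}\beta g|0\rangle$ in $t$ is non-zero. Put $$\phi(t,z)=\frac{\langle1|e^{H(t)}\phi(z)g|0\rangle}{\langle1|e^{H(t)}\beta g|0\rangle},\qquad q(t)=\frac{2\langle1|e^{H(t)}\beta g|0\rangle}{\langle0|e^{H(t)}g|0\rangle}.$$ All functions of $t$ below are quotients of formal power series. Then there is a unique pseudo-differential operator $Z=z_0+z_1\partial^{-1}+z_2\partial^{-2}+\cdots$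 with $\phi(t,z)=Z(e^{\xi(t,z)})$. It has $z_0=q^{-1}\neq0$, it is invertible, and the following hold. 1. The bilinear equation $$\mathrm{Res}_z\,\phi(t,z)\,\partial_{x'}^{-1}\big(z_0(t')^{-2}\phi(t',-z)\big)=-1,$$ where $\phi(t',-z)=Z(e^{\xi(t',-z)})$, $\partial_{x'}^{-1}$ is applied as a pseudo-differential operator to a formal series in $z$ times $e^{\xi(t',-z)}$, and functions of $t$ are expanded as formal power series in $t-t'$ around $t'$. 2. $Z^*=Z^{-1}z_0^2$, and $Z_{t_n}=-(Z\partial^nZ^{-1})_{\le0}\,Z$ for every odd $n>0$. 3. $\mathcal L=Z\partial Z^{-1}$ has the form $\partial+v_0+v_1\partial^{-1}+v_2\partial^{-2}+\cdots$; there is a non-zero function $E=e^{2\int v_0\,dx}$, i.e. a solution of $E_x=2v_0E$; for every such $E$, $$\mathcal L^*=-e^{2\int v_0dx}\,\mathcal L\,e^{-2\int v_0dx};$$ and $\mathcal L_{t_n}=[(\mathcal L^n)_{\ge1},\mathcal L]$ for every odd $n>0$. -/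

import Mathlib

open scoped Nat

noncomputable section

namespace CKP

/-! ### The Fock space of the free bosons `φ_j`, `j ∈ ℤ + 1/2` -/

/-- The bosonic Fock space, completed with respect to the energy grading.  The Fock space itself is
the polynomial space in the creation operators `X n = φ_{n+1/2}`, `n ≥ 0`, applied to the vacuum;
there are finitely many monomials in each energy, so the completion is the space of all formal
power series in the `X n`. -/
abbrev Fock : Type := MvPowerSeries ℕ ℂ

/-- The vacuum vector `|0⟩`. -/
def vac : Fock := 1

/-- The free boson `φ_{k+1/2}`.  For `k ≥ 0` it is multiplication by `X k`; for `k = -1-n < 0` it is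
`(-1)^n ∂/∂(X n)`.  Thus `[φ_i, φ_j] = (-1)^(j-1/2) δ_{i,-j}`, and `φ_{-j}|0⟩ = 0`, `⟨0|φ_j = 0` for
`j > 0`. -/
def phi (k : ℤ) (f : Fock) : Fock :=
  if 0 ≤ k then MvPowerSeries.X k.toNat * f
  else ((-1 : ℂ) ^ (-1 - k)) • MvPowerSeries.pderiv ℂ (-1 - k).toNat f

/-- The functional `⟨0|`. -/
def bra0 (f : Fock) : ℂ := MvPowerSeries.coeff 0 f

/-- The normally ordered product `:φ_{k+1/2} φ_{l+1/2}: = φ_{k+1/2} φ_{l+1/2} -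
⟨0|φ_{k+1/2} φ_{l+1/2}|0⟩`. -/
def normalProd (k l : ℤ) (f : Fock) : Fock :=
  phi k (phi l f) - bra0 (phi k (phi l vac)) • f

/-- The Lie algebra `c_∞ = c̄_∞ ⊕ ℂ c` (as a set): matrices with finitely many non-zero diagonals
with `a_{ij} = (-1)^(i+j+1) a_{-j+1,-i+1}`, together with the coefficient of `c`. -/
structure CInf where
  mat : ℤ → ℤ → ℂ
  symm : ∀ i j, mat i j = (-1 : ℂ) ^ (i + j + 1) * mat (-j + 1) (-i + 1)
  band : ∃ N : ℤ, ∀ i j, N < |i - j| → mat i j = 0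
  central : ℂ

/-- The representation `π̂` of `c_∞`, with `π̂(Z_{ij}) = (-1)^(j-1) :φ_{i-1/2} φ_{1/2-j}:` for
`Z_{ij} = E_{ij} - (-1)^(i+j) E_{-j+1,-i+1}`, and `π̂(c) = -1/2`.  An element of `c̄_∞` is
`∑ a_{ij} E_{ij} = (1/2) ∑ a_{ij} Z_{ij}`.  For each coefficient of the result only finitely many
`(i, j)` contribute. -/
def piHat (a : CInf) (f : Fock) : Fock := fun m =>
  (∑ᶠ p : ℤ × ℤ, (1 / 2 : ℂ) * a.mat p.1 p.2 * (-1 : ℂ) ^ (p.2 - 1) *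
    MvPowerSeries.coeff m (normalProd (p.1 - 1) (-p.2) f))
  + a.central * (-1 / 2 : ℂ) * MvPowerSeries.coeff m f

/-- The operator `e^{π̂(a)}`: it is defined on those vectors on which the exponential series converges
(unconditionally, coefficient by coefficient). -/
def expPi (a : CInf) : Fock →. Fock := fun f =>
  { Dom := ∀ m, Summable fun n : ℕ => ((n ! : ℂ))⁻¹ * MvPowerSeries.coeff m ((piHat a)^[n] f)
    get := fun _ m => ∑' n : ℕ, ((n ! : ℂ))⁻¹ * MvPowerSeries.coeff m ((piHat a)^[n] f) }

/-- `Sp_∞`: the products `e^{π̂(a_1)} e^{π̂(a_2)} ⋯ e^{π̂(a_k)}` with `a_i ∈ c_∞`. -/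
def SpInf : Set (Fock →. Fock) :=
  { g | ∃ l : List CInf, g = l.foldr (fun a h => (expPi a).comp h) (PFun.id Fock) }

/-- The action of `β = ∑_k b_k φ_{k+1/2} ∈ V = ∑_{l ∈ ℤ+1/2} ℂ φ_l`. -/
def betaAct (b : ℤ →₀ ℂ) (f : Fock) : Fock := b.sum fun k c => c • phi k f

/-! ### The operators `H_j` and the matrix elements `⟨v|e^{H(t)}|u⟩` -/

/-- `H_n` for odd integers `n`, given by `∑ H_n z^(-n-1) = -(1/2) :φ(-z) φ(z):` with
`φ(z) = ∑_k φ_{k+1/2} z^k`.  For each coefficient only finitely many `k` contribute. -/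
def heis (n : ℤ) (f : Fock) : Fock := fun m =>
  -(1 / 2 : ℂ) * ∑ᶠ k : ℤ, (-1 : ℂ) ^ k * MvPowerSeries.coeff m (normalProd k (-n - 1 - k) f)

/-- The coefficient of `ζ^n` in `exp(∑_{k ≥ 1} A_k ζ^k) u`. -/
def expCoeff (A : ℕ → Fock → Fock) (n : ℕ) (u : Fock) : Fock :=
  ∑ N ∈ Finset.range (n + 1), ((N ! : ℂ))⁻¹ •
    ((fun (f : ℕ → Fock) (r : ℕ) => ∑ k ∈ Finset.Icc 1 r, A k (f (r - k)))^[N]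
      (fun r => if r = 0 then u else 0)) n

/-- The coefficient of `z^(-n)` in `V_+(z)⁻¹ = exp(-∑_{k > 0 odd} (2/k) H_k z^(-k))`. -/
def vPlusInv (n : ℕ) (u : Fock) : Fock :=
  expCoeff (fun k f => if Odd k then (-(2 / (k : ℂ))) • heis k f else 0) n u

/-- The coefficient of `z^n` in `V_-(z)⁻¹ = exp(-∑_{k < 0 odd} (2/k) H_k z^(-k))`. -/
def vMinusInv (n : ℕ) (u : Fock) : Fock :=
  expCoeff (fun k f => if Odd k then (2 / (k : ℂ)) • heis (-(k : ℤ)) f else 0) n u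

/-- `H_{j+1/2}`, given by `2 ∑_j H_{j+1/2} z^(-j-1) = V_-(z)⁻¹ φ(z) V_+(z)⁻¹`.  For each coefficient
only finitely many terms contribute. -/
def halfHeis (j : ℤ) (f : Fock) : Fock := fun m =>
  (1 / 2 : ℂ) * ∑ᶠ p : ℕ × ℕ, MvPowerSeries.coeff m
    (vMinusInv p.1 (phi ((p.2 : ℤ) - p.1 - j - 1) (vPlusInv p.2 f)))

/-- The functional `⟨1| = ⟨0|H_{1/2}`. -/
def bra1 (f : Fock) : ℂ := bra0 (halfHeis 0 f)

/-- The coefficients (at all monomials `s^m`) of `exp(∑_n s_n A_n) u`. -/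
def timeExp {M : Type*} [AddCommGroup M] [Module ℂ M] (A : ℕ → M → M) (u : M) :
    (ℕ →₀ ℕ) → M := fun m =>
  ∑ N ∈ Finset.range (m.degree + 1), ((N ! : ℂ))⁻¹ •
    ((fun (f : (ℕ →₀ ℕ) → M) (r : ℕ →₀ ℕ) =>
        ∑ n ∈ r.support, A n (f (r - Finsupp.single n 1)))^[N]
      (fun r => if r = 0 then u else 0)) m

/-- Formal power series in the times `t = (t_1, t_3, t_5, …)`; the variable with index `n : ℕ` is
`t_{2n+1}`, and `x = t_1`. -/
abbrev TimeSeries : Type := MvPowerSeries ℕ ℂ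

/-- `⟨v|e^{H(t)}|u⟩` with `H(t) = ∑_n t_{2n+1} H_{2n+1}`. -/
def matEl (v : Fock → ℂ) (u : Fock) : TimeSeries := fun m =>
  v (timeExp (fun n => heis (2 * n + 1)) u m)

/-! ### The differential field of functions of the times -/

/-- Quotients of formal power series in the times. -/
abbrev TimeField : Type := FractionRing TimeSeries

/-- The derivative `∂/∂t_{2n+1}` of quotients of power series. -/
def dt (n : ℕ) (f : TimeField) : TimeField :=
  let s := IsLocalization.sec (nonZeroDivisors TimeSeries) f
  (algebraMap TimeSeries TimeField (MvPowerSeries.pderiv ℂ n s.1) *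
      algebraMap TimeSeries TimeField s.2 -
    algebraMap TimeSeries TimeField s.1 *
      algebraMap TimeSeries TimeField (MvPowerSeries.pderiv ℂ n s.2)) /
    algebraMap TimeSeries TimeField s.2 ^ 2

theorem dt_div (n : ℕ) (a b : TimeSeries) (hb : b ≠ 0) :
    dt n (algebraMap TimeSeries TimeField a / algebraMap TimeSeries TimeField b) =
      (algebraMap TimeSeries TimeField (MvPowerSeries.pderiv ℂ n a) *
          algebraMap TimeSeries TimeField b -
        algebraMap TimeSeries TimeField a *
          algebraMap TimeSeries TimeField (MvPowerSeries.pderiv ℂ n b)) /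
        algebraMap TimeSeries TimeField b ^ 2 := by
  have inj := IsFractionRing.injective TimeSeries TimeField
  unfold dt
  dsimp only
  set f := algebraMap TimeSeries TimeField a / algebraMap TimeSeries TimeField b with hf
  have hs := IsLocalization.sec_spec (nonZeroDivisors TimeSeries) f
  have hd := nonZeroDivisors.ne_zero (IsLocalization.sec (nonZeroDivisors TimeSeries) f).2.2
  generalize (IsLocalization.sec (nonZeroDivisors TimeSeries) f).1 = c at hs ⊢
  generalize ((IsLocalization.sec (nonZeroDivisors TimeSeries) f).2 : TimeSeries) = d at hs hd ⊢
  have hb' : algebraMap TimeSeries TimeField b ≠ 0 := by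
    simpa using hb
  have hd' : algebraMap TimeSeries TimeField d ≠ 0 := by
    simpa using hd
  have h1 : a * d = c * b := by
    apply inj
    rw [map_mul, map_mul, ← hs, hf]
    field_simp
  have h2 := congrArg (MvPowerSeries.pderiv ℂ n) h1
  rw [Derivation.leibniz, Derivation.leibniz] at h2
  simp only [smul_eq_mul] at h2
  have h1' := congrArg (algebraMap TimeSeries TimeField) h1
  have h2' := congrArg (algebraMap TimeSeries TimeField) h2
  simp only [map_mul, map_add] at h1' h2'
  rw [div_eq_div_iff (pow_ne_zero 2 hd') (pow_ne_zero 2 hb')]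
  linear_combination
    (-(algebraMap TimeSeries TimeField b * algebraMap TimeSeries TimeField d)) * h2' +
      (algebraMap TimeSeries TimeField b *
          algebraMap TimeSeries TimeField (MvPowerSeries.pderiv ℂ n d) +
        algebraMap TimeSeries TimeField d *
          algebraMap TimeSeries TimeField (MvPowerSeries.pderiv ℂ n b)) * h1'

theorem dt_zero (n : ℕ) : dt n 0 = 0 := by
  have h := dt_div n 0 1 one_ne_zero
  simpa using h

theorem dt_iterate_zero (n k : ℕ) : (dt n)^[k] 0 = 0 :=
  Function.iterate_fixed (dt_zero n) k

/-! ### Pseudo-differential operators in `∂ = ∂/∂x`, `x = t_1` -/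

/-- Pseudo-differential operators `∑_{i ≤ N} a_i ∂^i`. -/
@[ext]
structure PDO where
  coeff : ℤ → TimeField
  bdd : ∃ N : ℤ, ∀ i, N < i → coeff i = 0

namespace PDO

/-- Composition, determined by `∂^i f = ∑_{k ≥ 0} C(i,k) f^{(k)} ∂^(i-k)`. -/
instance : Mul PDO where
  mul A B :=
    { coeff := fun m => ∑ᶠ p : ℤ × ℕ, ((Ring.choose p.1 p.2 : ℤ) : TimeField) * A.coeff p.1 *
        (dt 0)^[p.2] (B.coeff (m - p.1 + p.2))
      bdd := by
        obtain ⟨M, hM⟩ := A.bdd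
        obtain ⟨N, hN⟩ := B.bdd
        refine ⟨M + N, fun m hm => ?_⟩
        rw [← finsum_zero (M := TimeField) (α := ℤ × ℕ)]
        refine finsum_congr fun p => ?_
        by_cases h : M < p.1
        · rw [hM _ h, mul_zero, zero_mul]
        · rw [hN _ (by omega), dt_iterate_zero, mul_zero] }

/-- The operator of multiplication by a function. -/
def ofFun (f : TimeField) : PDO where
  coeff i := if i = 0 then f else 0
  bdd := ⟨0, fun i hi => if_neg (by omega)⟩

/-- `∂^n`, `n ∈ ℤ`. -/
def dPow (n : ℤ) : PDO where
  coeff i := if i = n then 1 else 0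
  bdd := ⟨n, fun i hi => if_neg (by omega)⟩

instance : One PDO := ⟨ofFun 1⟩

instance : Neg PDO where
  neg A :=
    { coeff := fun i => -A.coeff i
      bdd := by
        obtain ⟨N, hN⟩ := A.bdd
        exact ⟨N, fun i hi => by rw [hN i hi, neg_zero]⟩ }

instance : Sub PDO where
  sub A B :=
    { coeff := fun i => A.coeff i - B.coeff i
      bdd := by
        obtain ⟨M, hM⟩ := A.bdd
        obtain ⟨N, hN⟩ := B.bdd
        exact ⟨max M N, fun i hi => by
          rw [hM i (lt_of_le_of_lt (le_max_left _ _) hi),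
            hN i (lt_of_le_of_lt (le_max_right _ _) hi), sub_zero]⟩ }

instance : Pow PDO ℕ := ⟨fun A n => npowRec n A⟩

/-- The formal adjoint `(∑ a_i ∂^i)^* = ∑ (-∂)^i a_i`. -/
def adjoint (A : PDO) : PDO where
  coeff m := ∑ᶠ k : ℕ, (-1 : TimeField) ^ (m + k) * ((Ring.choose (m + k) k : ℤ) : TimeField) *
    (dt 0)^[k] (A.coeff (m + k))
  bdd := by
    obtain ⟨N, hN⟩ := A.bdd
    refine ⟨N, fun m hm => ?_⟩
    rw [← finsum_zero (M := TimeField) (α := ℕ)]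
    refine finsum_congr fun k => ?_
    rw [hN _ (by omega), dt_iterate_zero, mul_zero]

/-- `A_{≥ n}`: the terms `a_i ∂^i` with `i ≥ n`. -/
def ge (A : PDO) (n : ℤ) : PDO where
  coeff i := if n ≤ i then A.coeff i else 0
  bdd := by
    obtain ⟨N, hN⟩ := A.bdd
    exact ⟨N, fun i hi => by rw [hN i hi, ite_self]⟩

/-- `A_{≤ n}`: the terms `a_i ∂^i` with `i ≤ n`. -/
def le (A : PDO) (n : ℤ) : PDO where
  coeff i := if i ≤ n then A.coeff i else 0
  bdd := by
    obtain ⟨N, hN⟩ := A.bdd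
    exact ⟨N, fun i hi => by rw [hN i hi, ite_self]⟩

/-- `A_{t_{2n+1}}`: the coefficients are differentiated with respect to `t_{2n+1}`. -/
def timeDeriv (n : ℕ) (A : PDO) : PDO where
  coeff i := dt n (A.coeff i)
  bdd := by
    obtain ⟨N, hN⟩ := A.bdd
    exact ⟨N, fun i hi => by rw [hN i hi, dt_zero]⟩

/-- `A(e^{ξ(t,εz)}) = (∑_j a_j (εz)^j) e^{ξ(t,εz)}` for `ε = ±1`; the function returned is the family
of coefficients of the powers of `z` in front of `e^{ξ(t,εz)}`. -/
def actExp (A : PDO) (ε : ℤ) : ℤ → TimeField := fun j => (ε : TimeField) ^ j * A.coeff j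

end PDO

/-! ### Wave functions -/

/-- Multiplication of a formal series `∑_j F_j(s) z^j` by `e^{ε ξ(s,z)}`, where
`ξ(s,z) = ∑_n s_n z^(2n+1)`, so that
`e^{ε ξ(s,z)} = ∑_p ε^{|p|} / p! · s^p z^{∑_n (2n+1) p_n}`. -/
def mulExpXi {R : Type*} [Field R] (ε : ℤ) (F : ℤ → MvPowerSeries ℕ R) :
    ℤ → MvPowerSeries ℕ R := fun j m =>
  ∑ p ∈ Finset.HasAntidiagonal.antidiagonal m, (ε : R) ^ p.1.degree / (p.1.prod fun _ e => (e ! : R)) *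
    MvPowerSeries.coeff p.2 (F (j - ((p.1.sum fun n e => (2 * n + 1) * e : ℕ) : ℤ)))

/-- The wave function `φ(t,z) = ⟨1|e^{H(t)} φ(z) g|0⟩ / ⟨1|e^{H(t)} β g|0⟩` with `τ = g|0⟩`, written
as `φ(t,z) = (∑_j f_j(t) z^j) e^{ξ(t,z)}`; the function returned is `j ↦ f_j`. -/
def wave (b : ℤ →₀ ℂ) (τ : Fock) : ℤ → TimeField := fun j =>
  algebraMap TimeSeries TimeField (mulExpXi (-1) (fun k => matEl bra1 (phi k τ)) j) /
    algebraMap TimeSeries TimeField (matEl bra1 (betaAct b τ))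

/-- `q(t) = 2⟨1|e^{H(t)} β g|0⟩ / ⟨0|e^{H(t)} g|0⟩` with `τ = g|0⟩`. -/
def eigenfun (b : ℤ →₀ ℂ) (τ : Fock) : TimeField :=
  2 * algebraMap TimeSeries TimeField (matEl bra1 (betaAct b τ)) /
    algebraMap TimeSeries TimeField (matEl bra0 τ)

/-- `Z = z_0 + z_1 ∂⁻¹ + z_2 ∂⁻² + ⋯` is a dressing operator: `φ(t,z) = Z(e^{ξ(t,z)})`. -/
def IsDressing (b : ℤ →₀ ℂ) (τ : Fock) (Z : PDO) : Prop :=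
  (∀ i, 0 < i → Z.coeff i = 0) ∧ Z.actExp 1 = wave b τ

/-- `Res_z F(t,z) G(t',z)` for `F(t,z) = (∑_i f_i(t) z^i) e^{ξ(t,z)}` and
`G(t',z) = (∑_i h_i(t') z^i) e^{ξ(t',-z)}`, where the `f_i` and the `h_i` vanish for large `i`.  Two
independent sets of times are used in the form `t'` and `t = t' + y`: the result is a formal power
series in `y` over the functions of `t'`, a function `f(t)` is expanded as
`f(t' + y) = exp(∑_n y_n ∂/∂t'_{2n+1}) f(t')`, and `e^{ξ(t,z)} e^{ξ(t',-z)} = e^{ξ(y,z)}`. -/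
def bilinearRes (f h : ℤ → TimeField) : MvPowerSeries ℕ TimeField :=
  mulExpXi 1 (fun j m => ∑ᶠ i : ℤ, timeExp dt (f i) m * h (j - i)) (-1)

end CKP

end

/-! Write Ω = ∑_k (-1)^k φ_{k+1/2} ⊗ φ_{-k-1/2}. It kills |0⟩ ⊗ |0⟩ and commutes with π̂(a) ⊗ 1 + 1
⊗ π̂(a) (`bil_piPol`). Coefficientwise convergence of the exponentials is absolute, so Cauchy
products carry Ω(τ ⊗ τ) = 0 over to every τ = g|0⟩ (`IsIsotropic.of_mem_spInf`). Moving β through Ω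
gives a companion identity, Ω(βτ ⊗ τ) = -τ ⊗ βτ (`bil_betaAct`). All of this is tested against
polynomials in the restricted dual, on which the transposed operators are locally finite sums.

Both identities persist under e^{H(t)}: the family of all their matrix elements is closed under
∂/∂t_n up to integral combinations and vanishes at t = 0, so it is zero
(`eq_zero_of_pderiv_mem_closure`). Tested against a linear polynomial they become Wick's formula, so
the evolved vector is Gaussian: its moments are determined by ⟨0|e^{H(t)}τ⟩ and the symmetric
two-point functions G_{ij} (`affineCoord`). Division by ⟨0|e^{H(t)}τ⟩ is legitimate because an
isotropic non-zero vector has non-zero vacuum coefficient (`IsIsotropic.pair_one_ne_zero`). The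
transpose of H_{2n+1} shifts X_i to X_{i+2n+1} and adds a quadratic polynomial; Wick's formula then
turns the time evolution into a Riccati system for G (`dt_affineCoord`) and a linear system for q_i
= ⟨0|∂_i e^{H(t)}βτ⟩ / ⟨0|e^{H(t)}τ⟩, where q_0 = q (`dt_betaCoord`). The vertex operator relation
`mulExpXi_evolve_phi` identifies the wave function as q⁻¹(1 + ∑ (-1)^n G_{0n} z^{-1-n}) e^ξ, which
yields existence and uniqueness of Z (`isDressing_iff`).

The rest is algebra of pseudo-differential operators. Put W_i = ∂^i + ∑ (-1)^n G_{in} ∂^{-1-n} and W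
= W_0, so Z = q⁻¹W. By the Riccati system, W_i = P_i W with differential operators P_i, and W_{t_n}
+ W∂^n = B_n W with B_n differential. By the symmetry of G, Res W_i W^* = 0 for all i, hence WW^* =
1 (`IsRiccati.waveOp_mul_adjoint`); this gives Z^* = Z⁻¹z_0². The linear system says B_n(q) =
q_{t_n}, so C_n = q⁻¹(B_n q - q_{t_n}) has no term of order zero. Since Z_{t_n} + Z∂^n = C_n Z,
comparison of orders gives C_n = (Z∂^nZ⁻¹)_{≥1} and the Sato and Lax equations
(`IsRiccati.exists_isDressingPair` and the lemmas on `IsDressingPair`).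

For the bilinear equation, ∂/∂y_n at t = t' + y replaces Z by C_n Z, and at y = 0 the residue with
PZ in place of Z is minus the order-zero coefficient of P. It is therefore -1 for P = 1, and every
derivative of it vanishes (`IsDressingPair.bilinearRes_eq_neg_one`). -/

noncomputable section

namespace CKP

/-! ### Formal power series determined by their derivatives -/

/-- A group of power series which is stable under all partial derivatives and whose members have
zero constant coefficient is trivial. -/
theorem eq_zero_of_pderiv_mem {R : Type*} [Field R] [CharZero R]
    (W : Set (MvPowerSeries ℕ R)) (hd : ∀ f ∈ W, ∀ n, MvPowerSeries.pderiv R n f ∈ W)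
    (h0 : ∀ f ∈ W, MvPowerSeries.coeff 0 f = 0) {f : MvPowerSeries ℕ R} (hf : f ∈ W) : f = 0 := by
  have key : ∀ d : ℕ, ∀ m : ℕ →₀ ℕ, m.degree = d → ∀ f ∈ W, MvPowerSeries.coeff m f = 0 := by
    intro d
    induction d with
    | zero =>
      intro m hm f hf
      rw [Finsupp.degree_eq_zero_iff] at hm
      rw [hm, h0 f hf]
    | succ d ih =>
      intro m hm f hf
      have hne : m ≠ 0 := by
        rintro rfl
        simp at hm
      obtain ⟨n, hn⟩ := Finsupp.support_nonempty_iff.mpr hne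
      have hle : Finsupp.single n 1 ≤ m := by
        rw [Finsupp.single_le_iff]
        exact Nat.one_le_iff_ne_zero.mpr (Finsupp.mem_support_iff.mp hn)
      obtain ⟨m', rfl⟩ := exists_add_of_le hle
      rw [add_comm] at hm ⊢
      have h1 := ih m' (by rw [map_add, Finsupp.degree_single] at hm; omega) _ (hd f hf n)
      rw [MvPowerSeries.coeff_pderiv] at h1
      exact (mul_eq_zero.mp h1).resolve_right (by exact_mod_cast Nat.succ_ne_zero (m' n))
  ext m
  simpa using key _ m rfl f hf

/-- If all partial derivatives of the members of a set of power series with zero constant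
coefficient are integral combinations of members of the set, then the members are zero. -/
theorem eq_zero_of_pderiv_mem_closure {R : Type*} [Field R] [CharZero R]
    (S : Set (MvPowerSeries ℕ R))
    (hd : ∀ f ∈ S, ∀ n, MvPowerSeries.pderiv R n f ∈ AddSubgroup.closure S)
    (h0 : ∀ f ∈ S, MvPowerSeries.coeff 0 f = 0) {f : MvPowerSeries ℕ R} (hf : f ∈ S) : f = 0 := by
  refine eq_zero_of_pderiv_mem (AddSubgroup.closure S) (fun f hf n => ?_) (fun f hf => ?_)
    (AddSubgroup.subset_closure hf)
  · induction hf using AddSubgroup.closure_induction with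
    | mem f hf => exact hd f hf n
    | zero => rw [map_zero]; exact zero_mem _
    | add f g _ _ h1 h2 => rw [map_add]; exact add_mem h1 h2
    | neg f _ h => rw [map_neg]; exact neg_mem h
  · induction hf using AddSubgroup.closure_induction with
    | mem f hf => exact h0 f hf
    | zero => exact map_zero _
    | add f g _ _ h1 h2 => rw [map_add, h1, h2, add_zero]
    | neg f _ h => rw [map_neg, h, neg_zero]

/-! ### The exponential of commuting operators -/

section TimeExp

variable {M : Type*} [AddCommGroup M] [Module ℂ M]

/-- One application of `∑_n s_n A_n` to a power series in `s` with coefficients in `M`. -/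
def timeStep (A : ℕ → M → M) (f : (ℕ →₀ ℕ) → M) (r : ℕ →₀ ℕ) : M :=
  ∑ n ∈ r.support, A n (f (r - Finsupp.single n 1))

theorem timeExp_eq (A : ℕ → M → M) (u : M) (m : ℕ →₀ ℕ) :
    timeExp A u m = ∑ N ∈ Finset.range (m.degree + 1), ((N ! : ℂ))⁻¹ •
      (timeStep A)^[N] (fun r => if r = 0 then u else 0) m := rfl

theorem timeExp_zero (A : ℕ → M → M) (u : M) : timeExp A u 0 = u := by
  simp [timeExp_eq]

/-- For commuting A_k this is ∂/∂s_n (∑ s_k A_k)^{N+1} = (N+1) A_n (∑ s_k A_k)^N, read off at s^m.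
-/
theorem timeStep_iterate_add_single (A : ℕ → M →ₗ[ℂ] M)
    (hA : ∀ k l x, A k (A l x) = A l (A k x)) (u : M) (n N : ℕ) (m : ℕ →₀ ℕ) :
    ((m n + 1 : ℕ) : ℂ) •
        (timeStep fun n => A n)^[N + 1] (fun r => if r = 0 then u else 0) (m + Finsupp.single n 1) =
      ((N + 1 : ℕ) : ℂ) • A n ((timeStep fun n => A n)^[N] (fun r => if r = 0 then u else 0) m) := by
  induction N generalizing m with
  | zero =>
    simp only [zero_add, Function.iterate_one, Function.iterate_zero, id]
    rw [timeStep]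
    by_cases hm : m = 0
    · subst hm
      simp
    · rw [if_neg hm, map_zero, smul_zero, Finset.sum_eq_zero, smul_zero]
      intro l hl
      rw [if_neg, map_zero]
      intro h0
      have hl' : Finsupp.single l 1 ≤ m + Finsupp.single n 1 := by
        rw [Finsupp.single_le_iff]
        exact Nat.one_le_iff_ne_zero.mpr (Finsupp.mem_support_iff.mp hl)
      have h1 : m + Finsupp.single n 1 = Finsupp.single l 1 :=
        le_antisymm (tsub_eq_zero_iff_le.mp h0) hl'
      have h2 := congrArg Finsupp.degree h1
      rw [map_add, Finsupp.degree_single, Finsupp.degree_single] at h2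
      exact hm (by rw [← Finsupp.degree_eq_zero_iff]; omega)
  | succ N ih =>
    rw [Function.iterate_succ_apply', timeStep]
    have hg := fun m : ℕ →₀ ℕ => congrFun (Function.iterate_succ_apply' (timeStep fun n => A n) N
      (fun r => if r = 0 then u else 0)) m
    generalize (timeStep fun n => A n)^[N + 1] (fun r => if r = 0 then u else 0) = g' at ih hg ⊢
    generalize (timeStep fun n => A n)^[N] (fun r => if r = 0 then u else 0) = g at ih hg ⊢
    have hsupp : (m + Finsupp.single n 1).support = insert n m.support := by
      ext l
      by_cases hl : l = n
      · simp [hl]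
      · simp [hl]
    -- Leibniz rule with the outermost factor split off: the derivative falls on the inner power
    -- (induction hypothesis) or, when l = n, on the outer factor.
    have hterm : ∀ l ∈ insert n m.support,
        ((m n + 1 : ℕ) : ℂ) • A l (g' (m + Finsupp.single n 1 - Finsupp.single l 1)) =
          ((N + 1 : ℕ) : ℂ) • (if l ∈ m.support then A n (A l (g (m - Finsupp.single l 1))) else 0)
            + (if l = n then A n (g' m) else 0) := by
      intro l hl
      by_cases hln : l = n
      · subst hln
        rw [add_tsub_cancel_right, if_pos rfl]
        by_cases hm : l ∈ m.support
        · rw [if_pos hm]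
          have hle : Finsupp.single l 1 ≤ m := by
            rw [Finsupp.single_le_iff]
            exact Nat.one_le_iff_ne_zero.mpr (Finsupp.mem_support_iff.mp hm)
          obtain ⟨m', rfl⟩ := exists_add_of_le hle
          rw [add_comm (Finsupp.single l 1) m', add_tsub_cancel_right]
          have h1 := congrArg (A l) (ih m')
          rw [map_smul, map_smul] at h1
          rw [← h1]
          simp only [Finsupp.coe_add, Pi.add_apply, Finsupp.single_eq_same]
          push_cast
          module
        · rw [if_neg hm, smul_zero, zero_add, Finsupp.notMem_support_iff.mp hm]
          simp
      · have hm : l ∈ m.support := (Finset.mem_insert.mp hl).resolve_left hln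
        rw [if_pos hm, if_neg hln, add_zero]
        have hle : Finsupp.single l 1 ≤ m := by
          rw [Finsupp.single_le_iff]
          exact Nat.one_le_iff_ne_zero.mpr (Finsupp.mem_support_iff.mp hm)
        obtain ⟨m', rfl⟩ := exists_add_of_le hle
        have h1 := congrArg (A l) (ih m')
        rw [map_smul, map_smul] at h1
        rw [add_assoc, add_tsub_cancel_left, add_tsub_cancel_left, hA n l, ← h1]
        simp [hln]
    rw [hsupp, Finset.smul_sum, Finset.sum_congr rfl hterm, Finset.sum_add_distrib,
      ← Finset.smul_sum, Finset.sum_ite_mem, Finset.sum_ite_eq',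
      if_pos (Finset.mem_insert_self _ _),
      Finset.inter_eq_right.mpr (Finset.subset_insert _ _), ← map_sum,
      show ∑ l ∈ m.support, A l (g (m - Finsupp.single l 1)) = g' m by rw [hg m]; rfl]
    push_cast
    module

/-- The differential equation ∂/∂s_n e^{∑ s_k A_k} u = A_n e^{∑ s_k A_k} u, coefficient by
coefficient. -/
theorem timeExp_add_single (A : ℕ → M →ₗ[ℂ] M)
    (hA : ∀ k l x, A k (A l x) = A l (A k x)) (u : M) (n : ℕ) (m : ℕ →₀ ℕ) :
    ((m n + 1 : ℕ) : ℂ) • timeExp (fun n => A n) u (m + Finsupp.single n 1) =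
      A n (timeExp (fun n => A n) u m) := by
  -- The truncation order rises by exactly one, and the N = 0 term has no component at m + e_n, so
  -- the two sums match after N ↦ N + 1.
  rw [timeExp_eq, timeExp_eq, map_add, Finsupp.degree_single, Finset.sum_range_succ']
  have h0 : m + Finsupp.single n 1 ≠ 0 := by
    intro h
    have := DFunLike.congr_fun h n
    simp at this
  simp only [Function.iterate_zero, id, if_neg h0, smul_zero, add_zero, map_sum, Finset.smul_sum,
    map_smul]
  refine Finset.sum_congr rfl fun N _ => ?_
  rw [smul_comm, timeStep_iterate_add_single A hA, smul_smul, Nat.factorial_succ]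
  congr 1
  have h1 : ((N + 1 : ℕ) : ℂ) ≠ 0 := by exact_mod_cast Nat.succ_ne_zero N
  have h2 : ((N ! : ℕ) : ℂ) ≠ 0 := by exact_mod_cast Nat.factorial_ne_zero N
  push_cast at h1 ⊢
  field_simp

theorem timeStep_iterate_add (A : ℕ → M →ₗ[ℂ] M) (f g : (ℕ →₀ ℕ) → M) (N : ℕ) :
    (timeStep fun n => A n)^[N] (f + g) =
      (timeStep fun n => A n)^[N] f + (timeStep fun n => A n)^[N] g := by
  induction N generalizing f g with
  | zero => rfl
  | succ N ih =>
    rw [Function.iterate_succ_apply, Function.iterate_succ_apply, Function.iterate_succ_apply, ← ih]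
    congr 1
    funext r
    simp [timeStep, Finset.sum_add_distrib]

theorem timeStep_iterate_map {M' : Type*} [AddCommGroup M'] [Module ℂ M'] (B : M →ₗ[ℂ] M')
    (A : ℕ → M →ₗ[ℂ] M) (A' : ℕ → M' →ₗ[ℂ] M') (h : ∀ n x, B (A n x) = A' n (B x))
    (f : (ℕ →₀ ℕ) → M) (N : ℕ) (m : ℕ →₀ ℕ) :
    B ((timeStep fun n => A n)^[N] f m) = (timeStep fun n => A' n)^[N] (fun r => B (f r)) m := by
  induction N generalizing m with
  | zero => rfl
  | succ N ih =>
    rw [Function.iterate_succ_apply', Function.iterate_succ_apply', timeStep, timeStep, map_sum]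
    exact Finset.sum_congr rfl fun n _ => by rw [h, ih]

theorem timeExp_map {M' : Type*} [AddCommGroup M'] [Module ℂ M'] (B : M →ₗ[ℂ] M')
    (A : ℕ → M →ₗ[ℂ] M) (A' : ℕ → M' →ₗ[ℂ] M') (h : ∀ n x, B (A n x) = A' n (B x))
    (u : M) (m : ℕ →₀ ℕ) :
    B (timeExp (fun n => A n) u m) = timeExp (fun n => A' n) (B u) m := by
  simp only [timeExp_eq, map_sum, map_smul]
  refine Finset.sum_congr rfl fun N _ => ?_
  rw [timeStep_iterate_map B A A' h]
  refine congrArg _ (congrFun (congrArg _ (funext fun r => ?_)) m)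
  split_ifs <;> simp

theorem timeExp_add (A : ℕ → M →ₗ[ℂ] M) (u v : M) (m : ℕ →₀ ℕ) :
    timeExp (fun n => A n) (u + v) m =
      timeExp (fun n => A n) u m + timeExp (fun n => A n) v m := by
  simp only [timeExp_eq]
  rw [← Finset.sum_add_distrib]
  refine Finset.sum_congr rfl fun N _ => ?_
  rw [← smul_add, ← Pi.add_apply, ← timeStep_iterate_add]
  refine congrArg _ (congrFun (congrArg _ (funext fun r => ?_)) m)
  simp only [Pi.add_apply]
  split_ifs <;> simp

end TimeExp

/-! ### Multiplication by `e^{ε ξ(s,z)}` -/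

/-- One half of the Leibniz rule for a product of power series: the factor from differentiation
kills the terms whose first exponent does not contain n. -/
theorem sum_antidiagonal_add_single_fst {R : Type*} [CommRing R] (m : ℕ →₀ ℕ) (n : ℕ)
    (f : (ℕ →₀ ℕ) × (ℕ →₀ ℕ) → R) :
    ∑ x ∈ Finset.HasAntidiagonal.antidiagonal (m + Finsupp.single n 1), ((x.1 : ℕ →₀ ℕ) n : R) * f x =
      ∑ x ∈ Finset.HasAntidiagonal.antidiagonal m,
        ((x.1 : ℕ →₀ ℕ) n + 1 : R) * f (x.1 + Finsupp.single n 1, x.2) := by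
  symm
  refine Finset.sum_of_injOn (fun x => (x.1 + Finsupp.single n 1, x.2)) ?_ ?_ ?_ ?_
  · rintro ⟨a, b⟩ _ ⟨c, d⟩ _ h
    simpa using h
  · rintro ⟨a, b⟩ h
    simp only [Finset.mem_coe, Finset.HasAntidiagonal.mem_antidiagonal] at h ⊢
    rw [← h, add_right_comm]
  · rintro ⟨a, b⟩ h hn
    simp only [Finset.HasAntidiagonal.mem_antidiagonal] at h
    by_cases ha : a n = 0
    · simp [ha]
    · exfalso
      apply hn
      have hle : Finsupp.single n 1 ≤ a := by
        rw [Finsupp.single_le_iff]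
        exact Nat.one_le_iff_ne_zero.mpr ha
      obtain ⟨a', rfl⟩ := exists_add_of_le hle
      refine ⟨(a', b), ?_, ?_⟩
      · simp only [Finset.mem_coe, Finset.HasAntidiagonal.mem_antidiagonal]
        rw [add_assoc, add_comm] at h
        exact add_right_cancel h
      · simp [add_comm]
  · rintro ⟨a, b⟩ _
    simp

theorem sum_antidiagonal_add_single_snd {R : Type*} [CommRing R] (m : ℕ →₀ ℕ) (n : ℕ)
    (f : (ℕ →₀ ℕ) × (ℕ →₀ ℕ) → R) :
    ∑ x ∈ Finset.HasAntidiagonal.antidiagonal (m + Finsupp.single n 1), ((x.2 : ℕ →₀ ℕ) n : R) * f x =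
      ∑ x ∈ Finset.HasAntidiagonal.antidiagonal m,
        ((x.2 : ℕ →₀ ℕ) n + 1 : R) * f (x.1, x.2 + Finsupp.single n 1) := by
  refine (Finsupp.sum_antidiagonal_swap (m + Finsupp.single n 1)
    fun a b => (b n : R) * f (a, b)).trans (Eq.trans ?_ (Finsupp.sum_antidiagonal_swap m
    fun a b => (b n + 1 : R) * f (a, b + Finsupp.single n 1)).symm)
  exact sum_antidiagonal_add_single_fst m n fun x => f x.swap

section MulExpXi

variable {R : Type*} [Field R]

/-- The coefficient of `s^p` in `e^{ε ξ(s,z)}`, without its power of `z`. -/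
def expXiCoeff (R : Type*) [Field R] (ε : ℤ) (p : ℕ →₀ ℕ) : R :=
  (ε : R) ^ p.degree / (p.prod fun _ e => (e ! : R))

/-- The weight `∑_n (2n+1) p_n`. -/
def oddWeight (p : ℕ →₀ ℕ) : ℕ := p.sum fun n e => (2 * n + 1) * e

theorem coeff_mulExpXi (ε : ℤ) (F : ℤ → MvPowerSeries ℕ R) (j : ℤ) (m : ℕ →₀ ℕ) :
    MvPowerSeries.coeff m (mulExpXi ε F j) =
      ∑ p ∈ Finset.HasAntidiagonal.antidiagonal m, expXiCoeff R ε p.1 *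
        MvPowerSeries.coeff p.2 (F (j - (oddWeight p.1 : ℤ))) := rfl

theorem oddWeight_add_single (p : ℕ →₀ ℕ) (n : ℕ) :
    oddWeight (p + Finsupp.single n 1) = oddWeight p + (2 * n + 1) := by
  unfold oddWeight
  rw [Finsupp.sum_add_index' (fun _ => mul_zero _) (fun _ _ _ => mul_add _ _ _),
    Finsupp.sum_single_index (mul_zero _), mul_one]

theorem prod_factorial_add_single (p : ℕ →₀ ℕ) (n : ℕ) :
    ((p + Finsupp.single n 1).prod fun _ e => (e ! : R)) =
      ((p n : R) + 1) * p.prod fun _ e => (e ! : R) := by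
  have hs : (p + Finsupp.single n 1).support ⊆ insert n p.support := by
    intro l hl
    by_cases hln : l = n
    · simp [hln]
    · simpa [hln, Finsupp.single_apply, Ne.symm hln] using hl
  rw [Finsupp.prod_of_support_subset _ hs _ (by simp),
    Finsupp.prod_of_support_subset p (Finset.subset_insert n p.support) _ (by simp),
    ← Finset.mul_prod_erase _ _ (Finset.mem_insert_self n p.support),
    ← Finset.mul_prod_erase _ (fun i => ((p i) ! : R)) (Finset.mem_insert_self n p.support),
    ← mul_assoc]
  congr 1
  · simp [Nat.factorial_succ]
  · refine Finset.prod_congr rfl fun l hl => ?_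
    simp [Ne.symm (Finset.ne_of_mem_erase hl)]

/-- Together with `oddWeight_add_single` this encodes ∂/∂s_n e^{εξ} = ε z^{2n+1} e^{εξ}. -/
theorem expXiCoeff_add_single [CharZero R] (ε : ℤ) (p : ℕ →₀ ℕ) (n : ℕ) :
    ((p n : R) + 1) * expXiCoeff R ε (p + Finsupp.single n 1) = ε * expXiCoeff R ε p := by
  have h1 : (p n : R) + 1 ≠ 0 := by exact_mod_cast Nat.succ_ne_zero (p n)
  have h2 : (p.prod fun _ e => (e ! : R)) ≠ 0 :=
    Finset.prod_ne_zero_iff.mpr fun _ _ => Nat.cast_ne_zero.mpr (Nat.factorial_ne_zero _)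
  rw [expXiCoeff, expXiCoeff, prod_factorial_add_single, map_add, Finsupp.degree_single, pow_succ]
  field_simp

theorem pderiv_mulExpXi [CharZero R] (ε : ℤ) (F : ℤ → MvPowerSeries ℕ R) (j : ℤ) (n : ℕ) :
    MvPowerSeries.pderiv R n (mulExpXi ε F j) =
      mulExpXi ε (fun k => MvPowerSeries.pderiv R n (F k)) j +
        (ε : R) • mulExpXi ε F (j - (2 * n + 1)) := by
  ext m
  rw [MvPowerSeries.coeff_pderiv, map_add, MvPowerSeries.coeff_smul]
  simp only [coeff_mulExpXi]
  -- The factor produced by differentiation splits according to which of the two series is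
  -- differentiated.
  have hm : ∀ x ∈ Finset.HasAntidiagonal.antidiagonal (m + Finsupp.single n 1),
      (m n : R) + 1 = (x.1 : ℕ →₀ ℕ) n + (x.2 : ℕ →₀ ℕ) n := by
    intro x hx
    rw [Finset.HasAntidiagonal.mem_antidiagonal] at hx
    have := DFunLike.congr_fun hx n
    simp only [Finsupp.coe_add, Pi.add_apply, Finsupp.single_eq_same] at this
    exact_mod_cast this.symm
  rw [Finset.sum_mul, Finset.sum_congr rfl fun x hx => by
    rw [hm x hx, mul_add, mul_comm _ ((x.1 : ℕ →₀ ℕ) n : R), mul_comm _ ((x.2 : ℕ →₀ ℕ) n : R)],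
    Finset.sum_add_distrib, sum_antidiagonal_add_single_fst, sum_antidiagonal_add_single_snd,
    add_comm, Finset.mul_sum]
  congr 1
  · refine Finset.sum_congr rfl fun x _ => ?_
    rw [MvPowerSeries.coeff_pderiv]
    ring
  · refine Finset.sum_congr rfl fun x _ => ?_
    rw [← mul_assoc, expXiCoeff_add_single, oddWeight_add_single, mul_assoc]
    rw [show j - ((oddWeight x.1 + (2 * n + 1) : ℕ) : ℤ) = j - (2 * n + 1) - oddWeight x.1 by
      push_cast; ring]

theorem coeff_zero_mulExpXi (ε : ℤ) (F : ℤ → MvPowerSeries ℕ R) (j : ℤ) :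
    MvPowerSeries.coeff 0 (mulExpXi ε F j) = MvPowerSeries.coeff 0 (F j) := by
  rw [coeff_mulExpXi]
  simp [expXiCoeff, oddWeight]

end MulExpXi

/-! ### The restricted dual of the Fock space -/

/-- The restricted dual of the Fock space: the polynomial `p` in the variables `X n` stands for the
functional `f ↦ ⟨0|p(∂/∂X_0, ∂/∂X_1, …) f`. -/
abbrev Pol : Type := MvPolynomial ℕ ℂ

/-- The pairing of `Pol` with the Fock space. -/
def pair : Pol →ₗ[ℂ] Fock →ₗ[ℂ] ℂ :=
  (MvPolynomial.basisMonomials ℕ ℂ).constr ℂ fun m =>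
    (m.prod fun _ e => (e ! : ℂ)) • MvPowerSeries.coeff m

theorem pair_monomial (m : ℕ →₀ ℕ) (f : Fock) :
    pair (MvPolynomial.monomial m 1) f =
      (m.prod fun _ e => (e ! : ℂ)) * MvPowerSeries.coeff m f := by
  have h := (MvPolynomial.basisMonomials ℕ ℂ).constr_basis ℂ
    (fun m => (m.prod fun _ e => (e ! : ℂ)) • (MvPowerSeries.coeff m : Fock →ₗ[ℂ] ℂ)) m
  rw [MvPolynomial.coe_basisMonomials] at h
  rw [pair, h]
  rfl

theorem prod_factorial_ne_zero (m : ℕ →₀ ℕ) : (m.prod fun _ e => (e ! : ℂ)) ≠ 0 :=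
  Finset.prod_ne_zero_iff.mpr fun _ _ => Nat.cast_ne_zero.mpr (Nat.factorial_ne_zero _)

theorem pol_linearMap_ext {M : Type*} [AddCommGroup M] [Module ℂ M] {A B : Pol →ₗ[ℂ] M}
    (h : ∀ m, A (MvPolynomial.monomial m 1) = B (MvPolynomial.monomial m 1)) : A = B :=
  (MvPolynomial.basisMonomials ℕ ℂ).ext fun m => by
    rw [MvPolynomial.coe_basisMonomials]
    exact h m

theorem pair_one (f : Fock) : pair 1 f = MvPowerSeries.coeff 0 f := by
  have := pair_monomial 0 f
  rwa [Finsupp.prod_zero_index, one_mul] at this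

theorem eq_of_pair_eq {f g : Fock} (h : ∀ p, pair p f = pair p g) : f = g := by
  ext m
  have := h (MvPolynomial.monomial m 1)
  rw [pair_monomial, pair_monomial] at this
  exact mul_left_cancel₀ (prod_factorial_ne_zero m) this

/-- The transpose of `φ_{k+1/2}`. -/
def psi (k : ℤ) : Pol →ₗ[ℂ] Pol :=
  if 0 ≤ k then (MvPolynomial.pderiv k.toNat).toLinearMap
  else ((-1 : ℂ) ^ (-1 - k)) • LinearMap.mulLeft ℂ (MvPolynomial.X (-1 - k).toNat)

theorem psi_natCast (n : ℕ) (p : Pol) : psi n p = MvPolynomial.pderiv n p := by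
  simp [psi]

theorem psi_neg (n : ℕ) (p : Pol) :
    psi (-1 - n) p = ((-1 : ℂ) ^ n) • (MvPolynomial.X n * p) := by
  have h : ¬ (0 : ℤ) ≤ -1 - n := by omega
  rw [psi, if_neg h]
  simp

theorem X_mul_eq_psi (n : ℕ) (p : Pol) :
    MvPolynomial.X n * p = ((-1 : ℂ) ^ n) • psi (-1 - n) p := by
  rw [psi_neg, smul_smul, ← mul_pow]
  simp

theorem int_cases (k : ℤ) : (∃ n : ℕ, k = n) ∨ ∃ n : ℕ, k = -1 - n := by
  rcases le_or_gt 0 k with h | h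
  · exact Or.inl ⟨k.toNat, by omega⟩
  · exact Or.inr ⟨(-1 - k).toNat, by omega⟩

theorem phi_natCast (n : ℕ) (f : Fock) : phi n f = MvPowerSeries.X n * f := by
  simp [phi]

theorem phi_neg (n : ℕ) (f : Fock) :
    phi (-1 - n) f = ((-1 : ℂ) ^ n) • MvPowerSeries.pderiv ℂ n f := by
  have h : ¬ (0 : ℤ) ≤ -1 - n := by omega
  rw [phi, if_neg h]
  simp

theorem pair_psi (k : ℤ) (p : Pol) (f : Fock) : pair (psi k p) f = pair p (phi k f) := by
  suffices h : pair.flip f ∘ₗ psi k = pair.flip (phi k f) from LinearMap.congr_fun h p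
  refine pol_linearMap_ext fun m => ?_
  simp only [LinearMap.comp_apply, LinearMap.flip_apply]
  rcases int_cases k with ⟨n, rfl⟩ | ⟨n, rfl⟩
  · rw [psi_natCast, phi_natCast, MvPolynomial.pderiv_monomial, one_mul, pair_monomial,
      MvPowerSeries.X, MvPowerSeries.coeff_monomial_mul, one_mul]
    by_cases hle : Finsupp.single n 1 ≤ m
    · rw [if_pos hle]
      obtain ⟨m', rfl⟩ := exists_add_of_le hle
      rw [add_comm, add_tsub_cancel_right, prod_factorial_add_single,
        ← mul_one (((m' + Finsupp.single n 1 : ℕ →₀ ℕ) n : ℕ) : ℂ), ← smul_eq_mul (_ : ℂ) 1,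
        ← MvPolynomial.smul_monomial, map_smul, LinearMap.smul_apply, pair_monomial]
      simp [mul_assoc]
    · rw [if_neg hle]
      rw [Finsupp.single_le_iff, not_le, Nat.lt_one_iff] at hle
      simp [hle]
  · rw [psi_neg, phi_neg, map_smul, map_smul, LinearMap.smul_apply, MvPolynomial.X,
      MvPolynomial.monomial_mul, one_mul, add_comm, pair_monomial, pair_monomial,
      prod_factorial_add_single, MvPowerSeries.coeff_pderiv]
    congr 1
    ring

/-- Transposition reverses products, so `psi l ∘ psi k` corresponds to φ_{k+1/2} φ_{l+1/2} and the
right side is the commutator of the bosons. -/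
theorem psi_comm (k l : ℤ) (p : Pol) :
    psi l (psi k p) - psi k (psi l p) = if k + l = -1 then ((-1 : ℂ) ^ l) • p else 0 := by
  rcases int_cases k with ⟨m, rfl⟩ | ⟨m, rfl⟩ <;> rcases int_cases l with ⟨n, rfl⟩ | ⟨n, rfl⟩
  · rw [if_neg (by omega)]
    simp only [psi_natCast]
    rw [sub_eq_zero]
    suffices h : ⁅(MvPolynomial.pderiv n : Derivation ℂ Pol Pol), MvPolynomial.pderiv m⁆ = 0 by
      have := DFunLike.congr_fun h p
      rwa [Derivation.commutator_apply, Derivation.zero_apply, sub_eq_zero] at this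
    refine MvPolynomial.derivation_ext fun i => ?_
    simp [Derivation.commutator_apply, MvPolynomial.pderiv_X, Pi.single_apply, apply_ite]
  · simp only [psi_natCast, psi_neg, map_smul]
    by_cases h : m = n
    · subst h
      rw [if_pos (by omega), Derivation.leibniz, MvPolynomial.pderiv_X_self]
      simp only [smul_eq_mul, mul_one]
      have h1 : (-1 : ℂ) ^ (-1 - m : ℤ) = -(-1) ^ m := by
        rw [zpow_sub₀ (by norm_num), zpow_natCast]
        rcases neg_one_pow_eq_or ℂ m with h | h <;> simp [h]
      rw [h1]
      module
    · rw [if_neg (by omega), Derivation.leibniz, MvPolynomial.pderiv_X_of_ne (Ne.symm h)]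
      simp
  · simp only [psi_natCast, psi_neg, map_smul]
    by_cases h : m = n
    · subst h
      rw [if_pos (by omega), Derivation.leibniz, MvPolynomial.pderiv_X_self]
      simp
    · rw [if_neg (by omega), Derivation.leibniz, MvPolynomial.pderiv_X_of_ne h]
      simp
  · rw [if_neg (by omega)]
    simp only [psi_neg, map_smul]
    rw [smul_comm, mul_left_comm]
    simp

theorem psi_of_nonneg_one {k : ℤ} (hk : 0 ≤ k) : psi k 1 = 0 := by
  obtain ⟨n, rfl⟩ := Int.eq_ofNat_of_zero_le hk
  rw [psi_natCast, MvPolynomial.pderiv_one]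

/-- A polynomial contains finitely many variables. This makes every infinite sum of operators below
finite on the dual side. -/
theorem exists_psi_eq_zero (p : Pol) : ∃ N : ℤ, 0 ≤ N ∧ ∀ k, N ≤ k → psi k p = 0 := by
  refine ⟨p.vars.sup id + 1, by positivity, fun k hk => ?_⟩
  obtain ⟨n, rfl⟩ := Int.eq_ofNat_of_zero_le (by omega : 0 ≤ k)
  rw [psi_natCast]
  refine MvPolynomial.pderiv_eq_zero_of_notMem_vars fun h => ?_
  have := Finset.le_sup (f := id) h
  simp only [id] at this
  omega

theorem pair_one_vac_psi_neg {k : ℤ} (hk : k < 0) (p : Pol) : pair (psi k p) vac = 0 := by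
  obtain ⟨n, rfl⟩ : ∃ n : ℕ, k = -1 - n := ⟨(-1 - k).toNat, by omega⟩
  rw [pair_psi, phi_neg, vac, ← map_one (MvPowerSeries.C (σ := ℕ) (R := ℂ)),
    MvPowerSeries.pderiv_C]
  simp

/-! ### Transposes of quadratic operators -/

/-- The contraction `⟨0|φ_{k+1/2} φ_{l+1/2}|0⟩`. -/
theorem bra0_phi_phi_vac (k l : ℤ) :
    bra0 (phi k (phi l vac)) = if k < 0 ∧ k + l = -1 then (-1 : ℂ) ^ l else 0 := by
  rw [bra0, ← pair_one, ← pair_psi, ← pair_psi]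
  by_cases hk : 0 ≤ k
  · rw [psi_of_nonneg_one hk, if_neg (by omega)]
    simp
  · by_cases hl : 0 ≤ l
    · have h := psi_comm k l 1
      rw [psi_of_nonneg_one hl, map_zero, sub_zero] at h
      rw [h]
      by_cases hkl : k + l = -1
      · rw [if_pos hkl, if_pos ⟨by omega, hkl⟩, map_smul, LinearMap.smul_apply, pair_one]
        simp [vac]
      · rw [if_neg hkl, if_neg (by omega)]
        simp
    · rw [if_neg (by omega), pair_one_vac_psi_neg (by omega)]

/-- The transpose of `:φ_{k+1/2} φ_{l+1/2}:`. -/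
def normalPsi (k l : ℤ) : Pol →ₗ[ℂ] Pol :=
  psi l ∘ₗ psi k - bra0 (phi k (phi l vac)) • LinearMap.id

theorem normalPsi_apply (k l : ℤ) (p : Pol) :
    normalPsi k l p = psi l (psi k p) - bra0 (phi k (phi l vac)) • p := rfl

theorem pair_normalPsi (k l : ℤ) (p : Pol) (f : Fock) :
    pair (normalPsi k l p) f = pair p (normalProd k l f) := by
  rw [normalPsi_apply, normalProd, map_sub, map_sub, LinearMap.sub_apply, pair_psi, pair_psi,
    map_smul, map_smul, LinearMap.smul_apply]

/-- If the index that annihilates stands on the wrong side, commuting it produces a scalar, which is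
exactly the contraction removed by normal ordering. The bound 0 ≤ N forces the other index to be
negative when that scalar is non-zero. -/
theorem normalPsi_eq_zero {p : Pol} {N : ℤ} (hN : 0 ≤ N) (h : ∀ k, N ≤ k → psi k p = 0)
    {k l : ℤ} (hkl : N ≤ k ∨ N ≤ l) : normalPsi k l p = 0 := by
  rw [normalPsi_apply, bra0_phi_phi_vac]
  by_cases hk : N ≤ k
  · rw [h k hk, if_neg (by omega)]
    simp
  · have hl : N ≤ l := hkl.resolve_left hk
    have hc := psi_comm k l p
    rw [h l hl, map_zero, sub_zero] at hc
    rw [hc]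
    by_cases hs : k + l = -1
    · rw [if_pos hs, if_pos ⟨by omega, hs⟩, sub_self]
    · rw [if_neg hs, if_neg (by omega), zero_smul, sub_zero]

/-- The coefficient of `:φ_{i-1/2} φ_{1/2-j}:` in `π̂(a)`. -/
def CInf.quadCoeff (a : CInf) (q : ℤ × ℤ) : ℂ := (1 / 2 : ℂ) * a.mat q.1 q.2 * (-1 : ℂ) ^ (q.2 - 1)

theorem CInf.exists_band (a : CInf) : ∃ B : ℤ, 0 ≤ B ∧ ∀ i j, B < |i - j| → a.mat i j = 0 := by
  obtain ⟨B, hB⟩ := a.band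
  exact ⟨max B 0, le_max_right _ _, fun i j h => hB i j (lt_of_le_of_lt (le_max_left _ _) h)⟩

theorem finite_of_band {S : Set (ℤ × ℤ)} (B M : ℤ)
    (h : ∀ q ∈ S, |q.1 - q.2| ≤ B ∧ q.1 ≤ M ∧ -M ≤ q.2) : S.Finite := by
  refine ((Set.finite_Icc (-M - B) M).prod (Set.finite_Icc (-M) (M + B))).subset fun q hq => ?_
  obtain ⟨h1, h2, h3⟩ := h q hq
  rw [abs_le] at h1
  simp only [Set.mem_prod, Set.mem_Icc]
  omega

/-- The band condition bounds |i - j|, and annihilation of p bounds i above and j below. -/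
theorem hasFiniteSupport_quad (a : CInf) (p : Pol) :
    Function.HasFiniteSupport fun q : ℤ × ℤ => a.quadCoeff q • normalPsi (q.1 - 1) (-q.2) p := by
  obtain ⟨N, hN, h⟩ := exists_psi_eq_zero p
  obtain ⟨B, hB, hb⟩ := a.exists_band
  refine finite_of_band B N fun q hq => ?_
  rw [Function.mem_support] at hq
  refine ⟨?_, ?_⟩
  · by_contra hlt
    exact hq (by rw [CInf.quadCoeff, hb _ _ (not_le.mp hlt)]; simp)
  · by_contra hlt
    exact hq (by rw [normalPsi_eq_zero hN h (by omega), smul_zero])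

/-- The transpose of `π̂(a)`. -/
def piPol (a : CInf) : Pol →ₗ[ℂ] Pol where
  toFun p := (∑ᶠ q : ℤ × ℤ, a.quadCoeff q • normalPsi (q.1 - 1) (-q.2) p)
    + (a.central * (-1 / 2 : ℂ)) • p
  map_add' p p' := by
    simp only [map_add, smul_add]
    rw [finsum_add_distrib (hasFiniteSupport_quad a p) (hasFiniteSupport_quad a p')]
    abel
  map_smul' c p := by
    simp only [map_smul, RingHom.id_apply, smul_add, smul_finsum]
    congr 1
    · exact finsum_congr fun q => smul_comm _ _ _
    · exact smul_comm _ _ _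

theorem piPol_apply (a : CInf) (p : Pol) :
    piPol a p = (∑ᶠ q : ℤ × ℤ, a.quadCoeff q • normalPsi (q.1 - 1) (-q.2) p)
      + (a.central * (-1 / 2 : ℂ)) • p := rfl

theorem pair_piPol (a : CInf) (p : Pol) (f : Fock) : pair (piPol a p) f = pair p (piHat a f) := by
  suffices h : pair.flip f ∘ₗ piPol a = pair.flip (piHat a f) from LinearMap.congr_fun h p
  refine pol_linearMap_ext fun m => ?_
  simp only [LinearMap.comp_apply, LinearMap.flip_apply]
  rw [piPol_apply, map_add, LinearMap.add_apply, ← LinearMap.flip_apply pair,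
    map_finsum _ (hasFiniteSupport_quad a _), map_smul, LinearMap.smul_apply, pair_monomial,
    pair_monomial]
  rw [show MvPowerSeries.coeff m (piHat a f) = (∑ᶠ q : ℤ × ℤ, a.quadCoeff q *
      MvPowerSeries.coeff m (normalProd (q.1 - 1) (-q.2) f))
      + a.central * (-1 / 2 : ℂ) * MvPowerSeries.coeff m f from rfl, mul_add]
  congr 1
  · rw [← smul_eq_mul (_ : ℂ) (∑ᶠ _, _), smul_finsum]
    refine finsum_congr fun q => ?_
    rw [map_smul, LinearMap.flip_apply, pair_normalPsi, pair_monomial]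
    simp only [smul_eq_mul]
    ring
  · simp only [smul_eq_mul]
    ring

theorem finsum_ite_fst {M : Type*} [AddCommMonoid M] (c : ℤ) (F : ℤ → M)
    (hF : Function.HasFiniteSupport F) :
    ∑ᶠ q : ℤ × ℤ, (if q.1 = c then F q.2 else 0) = ∑ᶠ j, F j := by
  rw [finsum_curry]
  · rw [finsum_eq_single _ c]
    · simp
    · intro x hx
      simp [hx]
  · refine ((Set.finite_singleton c).prod hF).subset fun q hq => ?_
    rw [Function.mem_support] at hq
    by_cases h : q.1 = c
    · rw [if_pos h] at hq
      exact ⟨h, hq⟩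
    · exact absurd (if_neg h) hq

theorem finsum_ite_snd {M : Type*} [AddCommMonoid M] (c : ℤ) (F : ℤ → M)
    (hF : Function.HasFiniteSupport F) :
    ∑ᶠ q : ℤ × ℤ, (if q.2 = c then F q.1 else 0) = ∑ᶠ j, F j := by
  rw [← finsum_ite_fst c F hF, ← finsum_comp_equiv (Equiv.prodComm ℤ ℤ)]
  rfl

theorem CInf.hasFiniteSupport_row (a : CInf) {M : Type*} [AddCommGroup M] [Module ℂ M]
    (F : ℤ → M) (c : ℤ) : Function.HasFiniteSupport fun i => a.mat i c • F i := by
  obtain ⟨B, hB, hb⟩ := a.exists_band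
  refine (Set.finite_Icc (c - B) (c + B)).subset fun i hi => ?_
  rw [Function.mem_support] at hi
  have : |i - c| ≤ B := by
    by_contra h
    exact hi (by rw [hb _ _ (not_le.mp h), zero_smul])
  rw [abs_le] at this
  simp only [Set.mem_Icc]
  omega

/-- The subtracted contraction is a scalar, so only the two boson commutators remain. -/
theorem normalPsi_psi (k l m : ℤ) (p : Pol) :
    normalPsi k l (psi m p) = psi m (normalPsi k l p) +
      ((if m + k = -1 then ((-1 : ℂ) ^ k) • psi l p else 0) +
        if m + l = -1 then ((-1 : ℂ) ^ l) • psi k p else 0) := by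
  have h1 := congrArg (psi l) (psi_comm m k p)
  have h2 := psi_comm m l (psi k p)
  rw [map_sub, apply_ite (psi l), map_smul, map_zero] at h1
  rw [← h1, ← h2, normalPsi_apply, normalPsi_apply, map_sub, map_smul]
  abel

/-- The commutator with a quadratic expression is linear in the bosons: c_∞ acts on V through its
matrices. -/
theorem piPol_psi (a : CInf) (k : ℤ) (p : Pol) :
    piPol a (psi k p) = psi k (piPol a p) - ∑ᶠ i : ℤ, a.mat i (k + 1) • psi (i - 1) p := by
  have hrow := a.hasFiniteSupport_row (fun i => psi (i - 1) p) (k + 1)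
  have hrow' : Function.HasFiniteSupport fun j : ℤ => a.mat (-j + 1) (k + 1) • psi (-j) p := by
    refine (hrow.image fun i => 1 - i).subset fun j hj => ⟨1 - j, ?_, by ring⟩
    rw [Function.mem_support] at hj ⊢
    convert hj using 3 <;> ring_nf
  have e1 : ∀ q : ℤ × ℤ, a.quadCoeff q • normalPsi (q.1 - 1) (-q.2) (psi k p) =
      psi k (a.quadCoeff q • normalPsi (q.1 - 1) (-q.2) p) +
        ((if q.1 = -k then (-(1 / 2 : ℂ)) • a.mat (-q.2 + 1) (k + 1) • psi (-q.2) p else 0) +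
        (if q.2 = k + 1 then (-(1 / 2 : ℂ)) • a.mat q.1 (k + 1) • psi (q.1 - 1) p else 0)) := by
    rintro ⟨i, j⟩
    dsimp only
    rw [normalPsi_psi, smul_add, smul_add, map_smul]
    congr 2
    · by_cases h : i = -k
      · subst h
        rw [if_pos (by ring), if_pos rfl, smul_smul, smul_smul, CInf.quadCoeff, a.symm]
        congr 1
        have : (-1 : ℂ) ^ (-k + j + 1) * (-1) ^ (j - 1) * (-1) ^ (-k - 1) = -1 := by
          rw [← zpow_add₀ (by norm_num), ← zpow_add₀ (by norm_num),
            show -k + j + 1 + (j - 1) + (-k - 1) = 2 * (j - k - 1) + 1 by ring,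
            zpow_add₀ (by norm_num), zpow_mul]
          norm_num
        rw [neg_neg]
        linear_combination (1 / 2 * a.mat (-j + 1) (k + 1)) * this
      · rw [if_neg (by omega), if_neg h, smul_zero]
    · by_cases h : j = k + 1
      · subst h
        rw [if_pos (by ring), if_pos rfl, smul_smul, smul_smul, CInf.quadCoeff]
        congr 1
        have : (-1 : ℂ) ^ (k + 1 - 1) * (-1) ^ (-(k + 1)) = -1 := by
          rw [← zpow_add₀ (by norm_num), show k + 1 - 1 + -(k + 1) = -1 by ring]
          norm_num
        linear_combination (1 / 2 * a.mat i (k + 1)) * this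
      · rw [if_neg (by omega), if_neg h, smul_zero]
  have f1 : Function.HasFiniteSupport fun q : ℤ × ℤ =>
      psi k (a.quadCoeff q • normalPsi (q.1 - 1) (-q.2) p) :=
    (hasFiniteSupport_quad a p).subset fun q hq => by
      rw [Function.mem_support] at hq ⊢
      exact fun h => hq (by rw [h, map_zero])
  have g1 : Function.HasFiniteSupport fun j : ℤ =>
      (-(1 / 2 : ℂ)) • a.mat (-j + 1) (k + 1) • psi (-j) p :=
    hrow'.subset fun q hq => by
      rw [Function.mem_support] at hq ⊢
      exact fun h => hq (by rw [h, smul_zero])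
  have g2 : Function.HasFiniteSupport fun i : ℤ =>
      (-(1 / 2 : ℂ)) • a.mat i (k + 1) • psi (i - 1) p :=
    hrow.subset fun q hq => by
      rw [Function.mem_support] at hq ⊢
      exact fun h => hq (by rw [h, smul_zero])
  have f2 : Function.HasFiniteSupport fun q : ℤ × ℤ =>
      if q.1 = -k then (-(1 / 2 : ℂ)) • a.mat (-q.2 + 1) (k + 1) • psi (-q.2) p else 0 := by
    refine ((Set.finite_singleton (-k)).prod g1).subset fun q hq => ?_
    rw [Function.mem_support, ite_ne_right_iff] at hq
    exact hq
  have f3 : Function.HasFiniteSupport fun q : ℤ × ℤ =>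
      if q.2 = k + 1 then (-(1 / 2 : ℂ)) • a.mat q.1 (k + 1) • psi (q.1 - 1) p else 0 := by
    refine (g2.prod (Set.finite_singleton (k + 1))).subset fun q hq => ?_
    rw [Function.mem_support, ite_ne_right_iff] at hq
    exact ⟨hq.2, hq.1⟩
  have f23 : Function.HasFiniteSupport fun q : ℤ × ℤ =>
      (if q.1 = -k then (-(1 / 2 : ℂ)) • a.mat (-q.2 + 1) (k + 1) • psi (-q.2) p else 0) +
      (if q.2 = k + 1 then (-(1 / 2 : ℂ)) • a.mat q.1 (k + 1) • psi (q.1 - 1) p else 0) :=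
    (f2.union f3).subset (Function.support_add _ _)
  rw [piPol_apply, piPol_apply, finsum_congr e1, finsum_add_distrib f1 f23,
    finsum_add_distrib f2 f3,
    finsum_ite_fst (-k) (fun j => (-(1 / 2 : ℂ)) • a.mat (-j + 1) (k + 1) • psi (-j) p) g1,
    finsum_ite_snd (k + 1) (fun i => (-(1 / 2 : ℂ)) • a.mat i (k + 1) • psi (i - 1) p) g2,
    map_add, map_finsum _ (hasFiniteSupport_quad a p), map_smul]
  -- Either boson of the quadratic term can be contracted; the symmetry of a, already used on the
  -- first contribution, makes the two halves equal.
  have hre : ∑ᶠ j : ℤ, (-(1 / 2 : ℂ)) • a.mat (-j + 1) (k + 1) • psi (-j) p =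
      ∑ᶠ i : ℤ, (-(1 / 2 : ℂ)) • a.mat i (k + 1) • psi (i - 1) p := by
    rw [← finsum_comp_equiv (Equiv.subLeft (1 : ℤ))]
    refine finsum_congr fun i => ?_
    simp only [Equiv.subLeft_apply]
    ring_nf
  rw [hre, ← smul_finsum]
  module

/-! ### The bilinear identity -/

section Bil

variable {R : Type*} [CommRing R] [Algebra ℂ R]

/-- The operator `∑_k (-1)^k φ_{k+1/2} ⊗ φ_{-k-1/2}`, evaluated on two functionals and paired with
two elements of the restricted dual. -/
def bil (u v : Pol →ₗ[ℂ] R) (p p' : Pol) : R :=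
  ∑ᶠ k : ℤ, ((-1 : ℂ) ^ k) • (u (psi k p) * v (psi (-1 - k) p'))

theorem finite_psi_ne_zero (p p' : Pol) :
    {k : ℤ | psi k p ≠ 0 ∧ psi (-1 - k) p' ≠ 0}.Finite := by
  obtain ⟨N, _, h⟩ := exists_psi_eq_zero p
  obtain ⟨N', _, h'⟩ := exists_psi_eq_zero p'
  refine (Set.finite_Icc (-1 - N') N).subset fun k hk => ?_
  have h1 : k < N := lt_of_not_ge fun hle => hk.1 (h k hle)
  have h2 : -1 - k < N' := lt_of_not_ge fun hle => hk.2 (h' _ hle)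
  simp only [Set.mem_Icc]
  omega

theorem bil_support_subset (u v : Pol →ₗ[ℂ] R) (p p' : Pol) :
    (Function.support fun k : ℤ => ((-1 : ℂ) ^ k) • (u (psi k p) * v (psi (-1 - k) p'))) ⊆
      {k : ℤ | psi k p ≠ 0 ∧ psi (-1 - k) p' ≠ 0} := by
  intro k hk
  rw [Function.mem_support] at hk
  refine ⟨fun h => hk ?_, fun h => hk ?_⟩ <;> simp [h]

theorem bil_hasFiniteSupport (u v : Pol →ₗ[ℂ] R) (p p' : Pol) :
    Function.HasFiniteSupport
      fun k : ℤ => ((-1 : ℂ) ^ k) • (u (psi k p) * v (psi (-1 - k) p')) :=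
  (finite_psi_ne_zero p p').subset (bil_support_subset u v p p')

theorem bil_eq_sum (u v : Pol →ₗ[ℂ] R) (p p' : Pol) :
    bil u v p p' = ∑ k ∈ (finite_psi_ne_zero p p').toFinset,
      ((-1 : ℂ) ^ k) • (u (psi k p) * v (psi (-1 - k) p')) :=
  finsum_eq_sum_of_support_subset _ (by
    rw [Set.Finite.coe_toFinset]
    exact bil_support_subset u v p p')

theorem bil_add_left (u u' v : Pol →ₗ[ℂ] R) (p p' : Pol) :
    bil (u + u') v p p' = bil u v p p' + bil u' v p p' := by
  simp only [bil_eq_sum, ← Finset.sum_add_distrib, LinearMap.add_apply, add_mul, smul_add]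

theorem bil_smul_left (c : ℂ) (u v : Pol →ₗ[ℂ] R) (p p' : Pol) :
    bil (c • u) v p p' = c • bil u v p p' := by
  simp only [bil_eq_sum, Finset.smul_sum, LinearMap.smul_apply, smul_mul_assoc]
  exact Finset.sum_congr rfl fun k _ => smul_comm _ _ _

theorem bil_smul_right (c : ℂ) (u v : Pol →ₗ[ℂ] R) (p p' : Pol) :
    bil u (c • v) p p' = c • bil u v p p' := by
  simp only [bil_eq_sum, Finset.smul_sum, LinearMap.smul_apply, mul_smul_comm]
  exact Finset.sum_congr rfl fun k _ => smul_comm _ _ _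

/-- The operator `∑_k (-1)^k φ_{k+1/2} ⊗ φ_{-k-1/2}` commutes with `π̂(a) ⊗ 1 + 1 ⊗ π̂(a)`. -/
theorem bil_piPol (a : CInf) (u v : Pol →ₗ[ℂ] R) (p p' : Pol) :
    bil (u ∘ₗ piPol a) v p p' + bil u (v ∘ₗ piPol a) p p' =
      bil u v (piPol a p) p' + bil u v p (piPol a p') := by
  set F : ℤ × ℤ → R := fun q => ((-1 : ℂ) ^ q.1 * a.mat q.2 (q.1 + 1)) •
    (u (psi (q.2 - 1) p) * v (psi (-1 - q.1) p')) with hF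
  set G : ℤ × ℤ → R := fun q => ((-1 : ℂ) ^ q.1 * a.mat q.2 (-1 - q.1 + 1)) •
    (u (psi q.1 p) * v (psi (q.2 - 1) p')) with hG
  have hu : ∀ k, u (piPol a (psi k p)) = u (psi k (piPol a p)) -
      ∑ᶠ i : ℤ, a.mat i (k + 1) • u (psi (i - 1) p) := by
    intro k
    rw [piPol_psi, map_sub, map_finsum _ (a.hasFiniteSupport_row _ _)]
    simp only [map_smul]
  have hv : ∀ k, v (piPol a (psi k p')) = v (psi k (piPol a p')) -
      ∑ᶠ i : ℤ, a.mat i (k + 1) • v (psi (i - 1) p') := by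
    intro k
    rw [piPol_psi, map_sub, map_finsum _ (a.hasFiniteSupport_row _ _)]
    simp only [map_smul]
  have h1 : bil (u ∘ₗ piPol a) v p p' - bil u v (piPol a p) p' = -∑ᶠ k, ∑ᶠ i, F (k, i) := by
    rw [bil, bil, ← finsum_sub_distrib (bil_hasFiniteSupport _ _ _ _)
      (bil_hasFiniteSupport _ _ _ _), ← finsum_neg_distrib]
    refine finsum_congr fun k => ?_
    rw [LinearMap.comp_apply, hu, sub_mul, smul_sub, sub_sub_cancel_left,
      finsum_mul' _ _ (a.hasFiniteSupport_row _ _), smul_finsum]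
    congr 1
    refine finsum_congr fun i => ?_
    rw [smul_mul_assoc, smul_smul]
  have h2 : bil u (v ∘ₗ piPol a) p p' - bil u v p (piPol a p') = -∑ᶠ k, ∑ᶠ i, G (k, i) := by
    rw [bil, bil, ← finsum_sub_distrib (bil_hasFiniteSupport _ _ _ _)
      (bil_hasFiniteSupport _ _ _ _), ← finsum_neg_distrib]
    refine finsum_congr fun k => ?_
    rw [LinearMap.comp_apply, hv, mul_sub, smul_sub, sub_sub_cancel_left,
      mul_finsum' _ _ (a.hasFiniteSupport_row _ _), smul_finsum]
    congr 1
    refine finsum_congr fun i => ?_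
    rw [mul_smul_comm, smul_smul]
  obtain ⟨N, hN, hp⟩ := exists_psi_eq_zero p
  obtain ⟨N', hN', hp'⟩ := exists_psi_eq_zero p'
  obtain ⟨B, hB, hb⟩ := a.exists_band
  have fF : Function.HasFiniteSupport F := by
    refine ((Set.finite_Icc (-1 - N' - B) (N + B)).prod
      (Set.finite_Icc (- N' - B) (N + 1))).subset fun q hq => ?_
    rw [Function.mem_support, hF] at hq
    have h1 : q.2 - 1 < N := lt_of_not_ge fun hle => hq (by simp [hp _ hle])
    have h2 : -1 - q.1 < N' := lt_of_not_ge fun hle => hq (by simp [hp' _ hle])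
    have h3 : |q.2 - (q.1 + 1)| ≤ B := le_of_not_gt fun hlt => hq (by simp [hb _ _ hlt])
    rw [abs_le] at h3
    simp only [Set.mem_prod, Set.mem_Icc]
    omega
  -- The commutator terms of the left and right tensor factors are exchanged by this involution-like
  -- relabelling; the symmetry of a makes them opposite, which is where membership in c̄_∞ enters.
  let e : ℤ × ℤ ≃ ℤ × ℤ :=
    { toFun := fun q => (q.2 - 1, -q.1)
      invFun := fun q => (-q.2, q.1 + 1)
      left_inv := fun q => by simp
      right_inv := fun q => by simp }
  have hFG : ∀ q, G (e q) = -F q := by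
    rintro ⟨k, i⟩
    simp only [hF, hG, e, Equiv.coe_fn_mk]
    rw [← neg_smul, a.symm (-k), show -(-1 - (i - 1) + 1) + 1 = i by ring,
      show - -k + 1 = k + 1 by ring, show -k - 1 = -1 - k by ring, ← mul_assoc]
    congr 1
    have : (-1 : ℂ) ^ (i - 1) * (-1) ^ (-k + (-1 - (i - 1) + 1) + 1) = -(-1) ^ k := by
      rw [← zpow_add₀ (by norm_num),
        show i - 1 + (-k + (-1 - (i - 1) + 1) + 1) = k + (2 * (-k) + 1) by ring,
        zpow_add₀ (by norm_num), zpow_add₀ (by norm_num), zpow_mul]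
      norm_num
    linear_combination a.mat i (k + 1) * this
  have fG : Function.HasFiniteSupport G := by
    refine (fF.image e).subset fun q hq => ⟨e.symm q, ?_, e.apply_symm_apply q⟩
    rw [Function.mem_support] at hq ⊢
    intro h0
    apply hq
    rw [← e.apply_symm_apply q, hFG, h0, neg_zero]
  have h3 : ∑ᶠ q, G q = -∑ᶠ q, F q := by
    rw [← finsum_comp_equiv e, ← finsum_neg_distrib]
    exact finsum_congr hFG
  rw [finsum_curry _ fF] at h3
  rw [finsum_curry _ fG] at h3
  linear_combination h1 + h2 - h3

end Bil

/-! ### Isotropic vectors -/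

/-- The functional on the restricted dual which is given by a vector of the Fock space. -/
def toFunctional (f : Fock) : Pol →ₗ[ℂ] ℂ := pair.flip f

theorem toFunctional_apply (f : Fock) (p : Pol) : toFunctional f p = pair p f := rfl

/-- The bilinear identity `∑_k (-1)^k φ_{k+1/2} τ ⊗ φ_{-k-1/2} τ = 0`. -/
def IsIsotropic (τ : Fock) : Prop :=
  ∀ p p', bil (toFunctional τ) (toFunctional τ) p p' = 0

/-- Of the indices k and -1-k exactly one is negative, and that factor annihilates the vacuum. -/
theorem isIsotropic_vac : IsIsotropic vac := by
  intro p p'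
  rw [bil, ← finsum_zero (α := ℤ) (M := ℂ)]
  refine finsum_congr fun k => ?_
  simp only [toFunctional_apply]
  by_cases hk : k < 0
  · rw [pair_one_vac_psi_neg hk]
    simp
  · rw [pair_one_vac_psi_neg (show -1 - k < 0 by omega)]
    simp

theorem toFunctional_piHat (a : CInf) (f : Fock) :
    toFunctional (piHat a f) = toFunctional f ∘ₗ piPol a :=
  LinearMap.ext fun p => (pair_piPol a p f).symm

/-- The coefficient of s^N in Ω(e^{sπ̂(a)}σ ⊗ e^{sπ̂(a)}σ). It is handled formally in s, before any
convergence question. -/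
theorem sum_antidiagonal_bil_eq_zero (a : CInf) {σ : Fock} (h : IsIsotropic σ) (N : ℕ) :
    ∀ p p', ∑ x ∈ Finset.HasAntidiagonal.antidiagonal N,
      bil (((x.1 ! : ℂ))⁻¹ • toFunctional ((piHat a)^[x.1] σ))
        (((x.2 ! : ℂ))⁻¹ • toFunctional ((piHat a)^[x.2] σ)) p p' = 0 := by
  induction N with
  | zero => intro p p'; simpa using h p p'
  | succ N ih =>
    intro p p'
    set U : ℕ → Pol →ₗ[ℂ] ℂ := fun n => ((n ! : ℂ))⁻¹ • toFunctional ((piHat a)^[n] σ) with hU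
    have hsucc : ∀ n : ℕ, ((n : ℂ) + 1) • U (n + 1) = U n ∘ₗ piPol a := by
      intro n
      simp only [hU]
      rw [Function.iterate_succ_apply', toFunctional_piHat, Nat.factorial_succ, smul_smul,
        LinearMap.smul_comp]
      congr 1
      have h1 : (n : ℂ) + 1 ≠ 0 := by exact_mod_cast Nat.succ_ne_zero n
      have h2 : (n ! : ℂ) ≠ 0 := Nat.cast_ne_zero.mpr (Nat.factorial_ne_zero n)
      push_cast
      field_simp
    -- Multiplying by N + 1 is differentiation in s: it produces π̂(a) ⊗ 1 + 1 ⊗ π̂(a), which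
    -- `bil_piPol` moves onto the test polynomials, leaving the case N.
    have key : ((N : ℂ) + 1) * ∑ x ∈ Finset.HasAntidiagonal.antidiagonal (N + 1),
        bil (U x.1) (U x.2) p p' = 0 := by
      have hterm : ∀ x ∈ Finset.HasAntidiagonal.antidiagonal (N + 1),
          ((N : ℂ) + 1) * bil (U x.1) (U x.2) p p' =
            (x.1 : ℂ) * bil (U x.1) (U x.2) p p' + (x.2 : ℂ) * bil (U x.1) (U x.2) p p' := by
        intro x hx
        rw [Finset.HasAntidiagonal.mem_antidiagonal] at hx
        rw [← add_mul]
        congr 1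
        exact_mod_cast hx.symm
      rw [Finset.mul_sum, Finset.sum_congr rfl hterm, Finset.sum_add_distrib,
        Finset.Nat.sum_antidiagonal_succ, Finset.Nat.sum_antidiagonal_succ']
      simp only [Nat.cast_zero, zero_mul, zero_add, Nat.cast_add, Nat.cast_one]
      rw [← Finset.sum_add_distrib]
      have hterm' : ∀ x ∈ Finset.HasAntidiagonal.antidiagonal N,
          ((x.1 : ℂ) + 1) * bil (U (x.1 + 1)) (U x.2) p p' +
            ((x.2 : ℂ) + 1) * bil (U x.1) (U (x.2 + 1)) p p' =
          bil (U x.1) (U x.2) (piPol a p) p' + bil (U x.1) (U x.2) p (piPol a p') := by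
        intro x _
        rw [← smul_eq_mul, ← smul_eq_mul, ← bil_smul_left, ← bil_smul_right, hsucc, hsucc,
          bil_piPol]
      rw [Finset.sum_congr rfl hterm', Finset.sum_add_distrib, ih, ih, add_zero]
    exact (mul_eq_zero.mp key).resolve_left (by exact_mod_cast Nat.succ_ne_zero N)

theorem hasSum_pair_expPi {a : CInf} {σ τ : Fock} (h : τ ∈ expPi a σ) (p : Pol) :
    HasSum (fun n : ℕ => ((n ! : ℂ))⁻¹ * pair p ((piHat a)^[n] σ)) (pair p τ) := by
  obtain ⟨hd, rfl⟩ := h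
  induction p using MvPolynomial.induction_on' with
  | monomial m c =>
    have h1 := ((hd m).hasSum).mul_left (c * m.prod fun _ e => (e ! : ℂ))
    rw [← mul_one c, ← smul_eq_mul, ← MvPolynomial.smul_monomial, map_smul]
    simp only [LinearMap.smul_apply, pair_monomial, smul_eq_mul]
    rw [← mul_assoc]
    simp only [mul_left_comm (_ : ℂ)⁻¹]
    simp only [← mul_assoc c] at h1 ⊢
    exact h1
  | add p q hp hq =>
    simp only [map_add, LinearMap.add_apply, mul_add]
    exact hp.add hq

/-- For fixed test polynomials Ω is a finite sum, and summability in ℂ is absolute, so products of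
the two exponential series may be regrouped by total degree. -/
theorem IsIsotropic.expPi {a : CInf} {σ τ : Fock} (hσ : IsIsotropic σ) (h : τ ∈ expPi a σ) :
    IsIsotropic τ := by
  intro p p'
  have hs : ∀ q q' : Pol, HasSum (fun N => ∑ x ∈ Finset.HasAntidiagonal.antidiagonal N,
      (((x.1 ! : ℂ))⁻¹ * pair q ((piHat a)^[x.1] σ)) *
        (((x.2 ! : ℂ))⁻¹ * pair q' ((piHat a)^[x.2] σ))) (pair q τ * pair q' τ) := by
    intro q q'
    have h1 := hasSum_pair_expPi h q
    have h2 := hasSum_pair_expPi h q'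
    rw [← h1.tsum_eq, ← h2.tsum_eq,
      tsum_mul_tsum_eq_tsum_sum_antidiagonal_of_summable_norm h1.summable.norm h2.summable.norm]
    exact (summable_norm_sum_mul_antidiagonal_of_summable_norm
      h1.summable.norm h2.summable.norm).of_norm.hasSum
  have h1 : HasSum (fun N => ∑ k ∈ (finite_psi_ne_zero p p').toFinset, ((-1 : ℂ) ^ k) •
      ∑ x ∈ Finset.HasAntidiagonal.antidiagonal N,
      (((x.1 ! : ℂ))⁻¹ * pair (psi k p) ((piHat a)^[x.1] σ)) *
        (((x.2 ! : ℂ))⁻¹ * pair (psi (-1 - k) p') ((piHat a)^[x.2] σ)))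
      (bil (toFunctional τ) (toFunctional τ) p p') := by
    rw [bil_eq_sum]
    exact hasSum_sum fun k _ => (hs _ _).const_smul _
  refine h1.unique ?_
  convert hasSum_zero with N
  rw [← sum_antidiagonal_bil_eq_zero a hσ N p p']
  simp only [bil_eq_sum, Finset.smul_sum]
  rw [Finset.sum_comm]
  rfl

theorem IsIsotropic.of_mem_spInf {g : Fock →. Fock} (hg : g ∈ SpInf) {τ : Fock}
    (hτ : τ ∈ g vac) : IsIsotropic τ := by
  obtain ⟨l, rfl⟩ := hg
  induction l generalizing τ with
  | nil =>
    have : τ = vac := Part.mem_some_iff.mp hτ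
    rw [this]
    exact isIsotropic_vac
  | cons a l ih =>
    obtain ⟨σ, hσ, h⟩ := Part.mem_bind_iff.mp hτ
    exact (ih hσ).expPi h

/-! ### Consequences of the bilinear identity -/

theorem finsum_int_eq_finsum_nat {M : Type*} [AddCommMonoid M] (f : ℤ → M)
    (hf : Function.HasFiniteSupport f) : ∑ᶠ k, f k = ∑ᶠ n : ℕ, (f n + f (-1 - n)) := by
  obtain ⟨N, hN⟩ : ∃ N : ℕ, ∀ k : ℤ, f k ≠ 0 → k < N ∧ -1 - k < N := by
    obtain ⟨a, ha⟩ := hf.bddAbove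
    obtain ⟨b, hb⟩ := hf.bddBelow
    refine ⟨(max (a + 1) (-b)).toNat, fun k hk => ?_⟩
    have h1 := ha (Function.mem_support.mpr hk)
    have h2 := hb (Function.mem_support.mpr hk)
    omega
  have key : ∀ N : ℕ, ∑ k ∈ Finset.Ico (-(N : ℤ)) N, f k =
      ∑ n ∈ Finset.range N, (f n + f (-1 - n)) := by
    intro N
    induction N with
    | zero => simp
    | succ N ih =>
      rw [Finset.sum_range_succ, ← ih]
      have : Finset.Ico (-((N + 1 : ℕ) : ℤ)) ((N + 1 : ℕ) : ℤ) =
          insert (N : ℤ) (insert (-1 - (N : ℤ)) (Finset.Ico (-(N : ℤ)) N)) := by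
        ext k
        simp only [Finset.mem_Ico, Finset.mem_insert]
        omega
      rw [this, Finset.sum_insert (by simp; omega), Finset.sum_insert (by simp)]
      abel
  rw [finsum_eq_sum_of_support_subset f (s := Finset.Ico (-(N : ℤ)) N), key,
    finsum_eq_sum_of_support_subset _ (s := Finset.range N)]
  · intro n hn
    simp only [Finset.coe_range, Set.mem_Iio]
    by_contra hlt
    refine hn ?_
    dsimp only
    have h1 : f n = 0 := not_not.mp fun h => hlt (by have := hN _ h; omega)
    have h2 : f (-1 - n) = 0 := not_not.mp fun h => hlt (by have := hN _ h; omega)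
    rw [h1, h2, add_zero]
  · intro k hk
    have := hN k hk
    simp only [Finset.coe_Ico, Set.mem_Ico]
    omega

section Wick

variable {R : Type*} [CommRing R] [Algebra ℂ R]

/-- Grouping k = n with k = -1-n turns Ω into ∑_n (∂_n ⊗ X_n - X_n ⊗ ∂_n) on the dual. -/
theorem bil_eq_finsum_nat (u v : Pol →ₗ[ℂ] R) (p p' : Pol) :
    bil u v p p' = ∑ᶠ n : ℕ, (u (MvPolynomial.pderiv n p) * v (MvPolynomial.X n * p') -
      u (MvPolynomial.X n * p) * v (MvPolynomial.pderiv n p')) := by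
  rw [bil, finsum_int_eq_finsum_nat _ (bil_hasFiniteSupport u v p p')]
  refine finsum_congr fun n => ?_
  rw [psi_natCast, psi_neg, show -1 - (-1 - (n : ℤ)) = n by ring, psi_neg, psi_natCast, map_smul,
    map_smul, mul_smul_comm, smul_mul_assoc, smul_smul, smul_smul, zpow_natCast,
    ← mul_pow, show (-1 : ℂ) ^ (-1 - n : ℤ) * (-1) ^ n = -1 by
      rw [← zpow_natCast, ← zpow_add₀ (by norm_num), sub_add_cancel]; norm_num]
  norm_num
  rw [sub_eq_add_neg]

theorem hasFiniteSupport_pderiv_mul (u : Pol →ₗ[ℂ] R) (p : Pol) (c : ℕ → R) :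
    Function.HasFiniteSupport fun n : ℕ => u (MvPolynomial.pderiv n p) * c n := by
  refine p.vars.finite_toSet.subset fun n hn => ?_
  by_contra h
  exact hn (by dsimp only; rw [MvPolynomial.pderiv_eq_zero_of_notMem_vars h, map_zero, zero_mul])

/-- Against a linear polynomial only n = i survives in the second half of Ω. Setting this to zero is
the recursion behind Wick's formula. -/
theorem bil_X (u v : Pol →ₗ[ℂ] R) (p : Pol) (i : ℕ) :
    bil u v p (MvPolynomial.X i) =
      (∑ᶠ n : ℕ, u (MvPolynomial.pderiv n p) * v (MvPolynomial.X n * MvPolynomial.X i)) -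
        u (MvPolynomial.X i * p) * v 1 := by
  have h : (∑ᶠ n : ℕ, u (MvPolynomial.X n * p) * v (MvPolynomial.pderiv n (MvPolynomial.X i))) =
      u (MvPolynomial.X i * p) * v 1 := by
    rw [finsum_eq_single _ i, MvPolynomial.pderiv_X_self]
    intro n hn
    rw [MvPolynomial.pderiv_X_of_ne (Ne.symm hn), map_zero, mul_zero]
  rw [bil_eq_finsum_nat, finsum_sub_distrib (hasFiniteSupport_pderiv_mul u p _), h]
  refine (Set.finite_singleton i).subset fun n hn => ?_
  by_contra hne
  exact hn (by
    dsimp only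
    rw [MvPolynomial.pderiv_X_of_ne (Ne.symm hne), map_zero, mul_zero])

theorem finsum_pderiv_mul (u : Pol →ₗ[ℂ] R) (c : ℕ → R) (i : ℕ) (p : Pol) :
    ∑ᶠ n : ℕ, u (MvPolynomial.pderiv n (MvPolynomial.X i * p)) * c n =
      u p * c i + ∑ᶠ n : ℕ, u (MvPolynomial.X i * MvPolynomial.pderiv n p) * c n := by
  have h : ∀ n, u (MvPolynomial.pderiv n (MvPolynomial.X i * p)) * c n =
      (if n = i then u p * c i else 0) + u (MvPolynomial.X i * MvPolynomial.pderiv n p) * c n := by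
    intro n
    rw [Derivation.leibniz, smul_eq_mul, smul_eq_mul, map_add, add_mul, add_comm]
    congr 1
    by_cases hn : n = i
    · subst hn
      rw [if_pos rfl, MvPolynomial.pderiv_X_self, mul_one]
    · rw [if_neg hn, MvPolynomial.pderiv_X_of_ne (Ne.symm hn), mul_zero, map_zero, zero_mul]
  rw [finsum_congr h, finsum_add_distrib]
  · congr 1
    rw [finsum_eq_single _ i fun n hn => if_neg hn, if_pos rfl]
  · exact (Set.finite_singleton i).subset fun n hn => by
      by_contra hne
      exact hn (if_neg hne)
  · exact hasFiniteSupport_pderiv_mul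
      (u ∘ₗ LinearMap.mulLeft ℂ (MvPolynomial.X i)) p c

/-- Wick's formula for a two-point function. -/
theorem finsum_pderiv_X_mul_X (u : Pol →ₗ[ℂ] R) (c : ℕ → R) (i j : ℕ) :
    ∑ᶠ n : ℕ, u (MvPolynomial.pderiv n (MvPolynomial.X i * MvPolynomial.X j)) * c n =
      u (MvPolynomial.X j) * c i + u (MvPolynomial.X i) * c j := by
  rw [finsum_pderiv_mul]
  congr 1
  rw [finsum_eq_single _ j, MvPolynomial.pderiv_X_self, mul_one]
  intro n hn
  rw [MvPolynomial.pderiv_X_of_ne (Ne.symm hn), mul_zero, map_zero, zero_mul]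

/-- Wick's formula for a three-point function. -/
theorem finsum_pderiv_X_mul_X_mul_X (u : Pol →ₗ[ℂ] R) (c : ℕ → R) (i j k : ℕ) :
    ∑ᶠ n : ℕ, u (MvPolynomial.pderiv n
        (MvPolynomial.X i * (MvPolynomial.X j * MvPolynomial.X k))) * c n =
      u (MvPolynomial.X j * MvPolynomial.X k) * c i +
        (u (MvPolynomial.X i * MvPolynomial.X k) * c j +
          u (MvPolynomial.X i * MvPolynomial.X j) * c k) := by
  rw [finsum_pderiv_mul]
  congr 1
  have := finsum_pderiv_X_mul_X (u ∘ₗ LinearMap.mulLeft ℂ (MvPolynomial.X i)) c j k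
  simpa using this

end Wick

/-! ### Non-vanishing of the vacuum coefficient -/

/-- A non-zero constant vector field ∑ c_n ∂_n is surjective on polynomials: X_i^j m is integrated
in the direction X_i, the derivatives of the monomial m having lower degree. Hence the induction on
deg m for all j at once. -/
theorem eq_zero_of_finsum_pderiv_eq_zero (u : Pol →ₗ[ℂ] ℂ) (c : ℕ → ℂ)
    (h : ∀ p, ∑ᶠ n : ℕ, u (MvPolynomial.pderiv n p) * c n = 0) {i : ℕ} (hi : c i ≠ 0) :
    u = 0 := by
  have key : ∀ d : ℕ, ∀ m : ℕ →₀ ℕ, m.degree = d → ∀ j : ℕ,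
      u (MvPolynomial.X i ^ j * MvPolynomial.monomial m 1) = 0 := by
    intro d
    induction d with
    | zero =>
      intro m hm j
      rw [Finsupp.degree_eq_zero_iff] at hm
      subst hm
      have h1 := h (MvPolynomial.X i ^ (j + 1))
      rw [finsum_eq_single _ i] at h1
      · rw [Derivation.leibniz_pow, MvPolynomial.pderiv_X_self] at h1
        simp only [add_tsub_cancel_right, smul_eq_mul, mul_one, map_nsmul] at h1
        simpa [hi, Nat.cast_add_one_ne_zero] using h1
      · intro n hn
        rw [Derivation.leibniz_pow, MvPolynomial.pderiv_X_of_ne (Ne.symm hn)]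
        simp
    | succ d ih =>
      intro m hm j
      have hlow : ∀ n, u (MvPolynomial.X i ^ (j + 1) *
          MvPolynomial.pderiv n (MvPolynomial.monomial m 1)) = 0 := by
        intro n
        rw [MvPolynomial.pderiv_monomial, one_mul]
        by_cases hn : m n = 0
        · simp [hn]
        · obtain ⟨m', rfl⟩ := exists_add_of_le
            (Finsupp.single_le_iff.mpr (Nat.one_le_iff_ne_zero.mpr hn))
          rw [map_add, Finsupp.degree_single] at hm
          rw [add_tsub_cancel_left, ← mul_one (((Finsupp.single n 1 + m' : ℕ →₀ ℕ) n : ℕ) : ℂ),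
            ← smul_eq_mul (_ : ℂ) 1, ← MvPolynomial.smul_monomial, mul_smul_comm, map_smul,
            ih m' (by omega), smul_zero]
      have h1 := h (MvPolynomial.X i ^ (j + 1) * MvPolynomial.monomial m 1)
      rw [finsum_eq_single _ i] at h1
      · rw [Derivation.leibniz, Derivation.leibniz_pow, MvPolynomial.pderiv_X_self, smul_eq_mul,
          map_add, hlow, zero_add, add_tsub_cancel_right, smul_eq_mul, smul_eq_mul, mul_one,
          mul_smul_comm, map_nsmul, mul_comm (MvPolynomial.monomial m 1)] at h1
        simpa [hi, Nat.cast_add_one_ne_zero] using h1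
      · intro n hn
        rw [Derivation.leibniz, Derivation.leibniz_pow,
          MvPolynomial.pderiv_X_of_ne (Ne.symm hn), smul_eq_mul, map_add, hlow]
        simp
  refine pol_linearMap_ext fun m => ?_
  simpa using key _ m rfl 0

/-- If the vacuum coefficient vanishes, so do all others, by induction on the degree: a non-zero
coefficient at X_i m', with all lower ones zero, would make Ω(τ ⊗ τ) = 0 a constant-coefficient
equation that forces τ = 0. -/
theorem IsIsotropic.pair_one_ne_zero {τ : Fock} (h : IsIsotropic τ) (hτ : τ ≠ 0) :
    pair 1 τ ≠ 0 := by
  intro h1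
  have hne : toFunctional τ ≠ 0 := by
    intro h0
    refine hτ (eq_of_pair_eq fun p => ?_)
    rw [map_zero]
    exact LinearMap.congr_fun h0 p
  have key : ∀ d : ℕ, ∀ m : ℕ →₀ ℕ, m.degree = d →
      toFunctional τ (MvPolynomial.monomial m 1) = 0 := by
    intro d
    induction d using Nat.strong_induction_on with
    | _ d ih =>
      intro m hm
      by_cases hm0 : m = 0
      · subst hm0
        exact h1
      obtain ⟨i, hi⟩ := Finsupp.support_nonempty_iff.mpr hm0
      obtain ⟨m', rfl⟩ := exists_add_of_le
        (Finsupp.single_le_iff.mpr (Nat.one_le_iff_ne_zero.mpr (Finsupp.mem_support_iff.mp hi)))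
      rw [map_add, Finsupp.degree_single] at hm
      have hlow : ∀ n, toFunctional τ
          (MvPolynomial.pderiv n (MvPolynomial.monomial m' 1)) = 0 := by
        intro n
        rw [MvPolynomial.pderiv_monomial, one_mul]
        by_cases hn : m' n = 0
        · simp [hn]
        · have hdeg : (m' - Finsupp.single n 1).degree < d := by
            obtain ⟨m'', rfl⟩ := exists_add_of_le
              (Finsupp.single_le_iff.mpr (Nat.one_le_iff_ne_zero.mpr hn))
            rw [map_add, Finsupp.degree_single] at hm
            rw [add_tsub_cancel_left]
            omega
          rw [← mul_one ((m' n : ℕ) : ℂ), ← smul_eq_mul (_ : ℂ) 1, ← MvPolynomial.smul_monomial,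
            map_smul, ih _ hdeg _ rfl, smul_zero]
      -- The half of Ω that lowers the monomial m' drops out by the induction hypothesis.
      have h2 : ∀ p, ∑ᶠ n : ℕ, toFunctional τ (MvPolynomial.pderiv n p) *
          toFunctional τ (MvPolynomial.X n * MvPolynomial.monomial m' 1) = 0 := by
        intro p
        rw [← h p (MvPolynomial.monomial m' 1), bil_eq_finsum_nat]
        refine finsum_congr fun n => ?_
        rw [hlow, mul_zero, sub_zero]
      by_contra hc
      refine hne (eq_zero_of_finsum_pderiv_eq_zero _ _ h2 (i := i) ?_)
      rwa [MvPolynomial.X, MvPolynomial.monomial_mul, one_mul]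
  exact hne (pol_linearMap_ext fun m => key _ m rfl)

/-! ### The Heisenberg operators -/

/-- The matrix of `H_{2n+1}`. -/
def heisMat (n : ℕ) : CInf where
  mat i j := if j = i + (2 * n + 1) then 1 else 0
  symm i j := by
    by_cases h : j = i + (2 * n + 1)
    · rw [if_pos h, if_pos (by omega), h, mul_one,
        show i + (i + (2 * n + 1)) + 1 = 2 * (i + n + 1) by ring, zpow_mul]
      norm_num
    · rw [if_neg h, if_neg (by omega), mul_zero]
  band := ⟨2 * n + 1, fun i j h => if_neg fun h' => by
    rw [h', sub_add_cancel_left, abs_neg, abs_of_nonneg (by omega)] at h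
    omega⟩
  central := 0

theorem finsum_graph {M : Type*} [AddCommMonoid M] (c : ℤ) (F : ℤ × ℤ → M) :
    ∑ᶠ q : ℤ × ℤ, (if q.2 = q.1 + c then F q else 0) = ∑ᶠ k : ℤ, F (k + 1, k + 1 + c) := by
  have hinj : Function.Injective fun k : ℤ => (k + 1, k + 1 + c) := by
    intro k l h
    simpa using h
  rw [← finsum_mem_range hinj, finsum_mem_def]
  refine finsum_congr ?_
  rintro ⟨i, j⟩
  by_cases h : j = i + c
  · rw [if_pos h, Set.indicator_of_mem]
    exact ⟨i - 1, by simp [h]⟩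
  · rw [if_neg h, Set.indicator_of_notMem]
    rintro ⟨k, hk⟩
    simp only [Prod.mk.injEq] at hk
    omega

/-- Places H_{2n+1} inside π̂(c_∞), so that the commutators with the bosons and with Ω are already
known. -/
theorem heis_eq_piHat (n : ℕ) (f : Fock) : heis (2 * n + 1) f = piHat (heisMat n) f := by
  funext m
  have h1 : piHat (heisMat n) f m = (∑ᶠ q : ℤ × ℤ, (heisMat n).quadCoeff q *
      MvPowerSeries.coeff m (normalProd (q.1 - 1) (-q.2) f))
      + (0 : ℂ) * (-1 / 2 : ℂ) * MvPowerSeries.coeff m f := rfl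
  have h2 : ∀ q : ℤ × ℤ, (heisMat n).quadCoeff q *
      MvPowerSeries.coeff m (normalProd (q.1 - 1) (-q.2) f) =
      if q.2 = q.1 + (2 * n + 1) then (1 / 2 : ℂ) * (-1) ^ (q.2 - 1) *
        MvPowerSeries.coeff m (normalProd (q.1 - 1) (-q.2) f) else 0 := by
    intro q
    simp only [CInf.quadCoeff, heisMat]
    split_ifs <;> ring
  rw [h1, finsum_congr h2, finsum_graph, zero_mul, zero_mul, add_zero, heis, mul_finsum]
  refine finsum_congr fun k => ?_
  rw [show k + 1 + (2 * (n : ℤ) + 1) - 1 = k + (2 * n + 1) by ring, add_sub_cancel_right,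
    show -(k + 1 + (2 * (n : ℤ) + 1)) = -(2 * n + 1) - 1 - k by ring,
    zpow_add₀ (by norm_num), show (-1 : ℂ) ^ (2 * (n : ℤ) + 1) = -1 by
      rw [zpow_add₀ (by norm_num), zpow_mul]; norm_num]
  ring

/-- The transpose of `H_{2n+1}`. -/
def heisPol (n : ℕ) : Pol →ₗ[ℂ] Pol := piPol (heisMat n)

theorem pair_heisPol (n : ℕ) (p : Pol) (f : Fock) :
    pair (heisPol n p) f = pair p (heis (2 * n + 1) f) := by
  rw [heisPol, pair_piPol, heis_eq_piHat]

/-- The linear map `H_{2n+1}`. -/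
def heisLin (n : ℕ) : Fock →ₗ[ℂ] Fock where
  toFun f := heis (2 * n + 1) f
  map_add' f g := eq_of_pair_eq fun p => by
    rw [map_add, ← pair_heisPol, ← pair_heisPol, ← pair_heisPol, map_add]
  map_smul' c f := eq_of_pair_eq fun p => by
    rw [RingHom.id_apply, map_smul, ← pair_heisPol, ← pair_heisPol, map_smul]

theorem heisPol_psi (n : ℕ) (k : ℤ) (p : Pol) :
    heisPol n (psi k p) = psi k (heisPol n p) - psi (k - (2 * n + 1)) p := by
  rw [heisPol, piPol_psi, finsum_eq_single _ (k + 1 - (2 * n + 1))]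
  · rw [show k + 1 - (2 * (n : ℤ) + 1) - 1 = k - (2 * n + 1) by ring]
    simp only [heisMat]
    rw [if_pos (by ring), one_smul]
  · intro i hi
    have : ¬ k + 1 = i + (2 * n + 1) := by omega
    simp [heisMat, this]

theorem heisPol_X_mul (n i : ℕ) (p : Pol) :
    heisPol n (MvPolynomial.X i * p) =
      MvPolynomial.X i * heisPol n p + MvPolynomial.X (i + (2 * n + 1)) * p := by
  rw [X_mul_eq_psi, X_mul_eq_psi, X_mul_eq_psi, map_smul, heisPol_psi, smul_sub, sub_eq_add_neg]
  congr 1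
  rw [show -1 - (i : ℤ) - (2 * n + 1) = -1 - ((i + (2 * n + 1) : ℕ) : ℤ) by push_cast; ring,
    pow_add, pow_add, pow_mul]
  norm_num

/-- On the dual vacuum 1 the operators with non-negative index vanish; without a contraction (k + l
≠ -1) the order is irrelevant, so both indices must be negative. -/
theorem normalPsi_one (k l : ℤ) (h : k + l ≠ -1) :
    normalPsi k l 1 = if k < 0 ∧ l < 0 then
      ((-1 : ℂ) ^ (k + l)) • (MvPolynomial.X (-1 - k).toNat * MvPolynomial.X (-1 - l).toNat)
      else 0 := by
  have hc := psi_comm k l 1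
  rw [if_neg h, sub_eq_zero] at hc
  rw [normalPsi_apply, bra0_phi_phi_vac, if_neg (by omega), zero_smul, sub_zero]
  rcases int_cases k with ⟨a, rfl⟩ | ⟨a, rfl⟩
  · rw [psi_of_nonneg_one (by omega), map_zero, if_neg (by omega)]
  rcases int_cases l with ⟨b, rfl⟩ | ⟨b, rfl⟩
  · rw [hc, psi_of_nonneg_one (by omega), map_zero, if_neg (by omega)]
  rw [if_pos (by omega), hc, psi_neg, psi_neg, mul_one, mul_smul_comm, smul_smul]
  have h1 : (-1 : ℂ) ^ (-1 - (a : ℤ) + (-1 - b)) = (-1) ^ a * (-1) ^ b := by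
    rw [show -1 - (a : ℤ) + (-1 - b) = -((a + b : ℕ) + 2) by push_cast; ring, zpow_neg,
      zpow_add₀ (by norm_num), zpow_natCast, ← pow_add]
    rcases neg_one_pow_eq_or ℂ (a + b) with h | h <;> simp [h]
  rw [h1]
  simp

theorem heisPol_one (n : ℕ) : heisPol n 1 = (1 / 2 : ℂ) • ∑ a ∈ Finset.range (2 * n + 1),
    ((-1 : ℂ) ^ a) • (MvPolynomial.X a * MvPolynomial.X (2 * n - a)) := by
  have h2 : ∀ q : ℤ × ℤ, (heisMat n).quadCoeff q • normalPsi (q.1 - 1) (-q.2) 1 =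
      if q.2 = q.1 + (2 * n + 1) then ((1 / 2 : ℂ) * (-1) ^ (q.2 - 1)) •
        normalPsi (q.1 - 1) (-q.2) 1 else 0 := by
    intro q
    simp only [CInf.quadCoeff, heisMat]
    split_ifs <;> simp
  rw [heisPol, piPol_apply, finsum_congr h2, finsum_graph]
  simp only [heisMat, zero_mul, zero_smul, add_zero]
  have hinj : Set.InjOn (fun a : ℕ => -1 - (a : ℤ)) (Finset.range (2 * n + 1)) := by
    intro a _ b _ h
    simpa using h
  rw [finsum_eq_sum_of_support_subset _
    (s := (Finset.range (2 * n + 1)).image fun a : ℕ => -1 - (a : ℤ)), Finset.sum_image hinj,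
    Finset.smul_sum]
  · refine Finset.sum_congr rfl fun a ha => ?_
    rw [Finset.mem_range] at ha
    rw [normalPsi_one _ _ (by omega), if_pos (by omega), smul_smul, smul_smul]
    congr 1
    · rw [mul_assoc, ← zpow_add₀ (by norm_num), ← zpow_natCast,
        show -1 - (a : ℤ) + 1 + (2 * n + 1) - 1 + (-1 - (a : ℤ) + 1 - 1 +
          -(-1 - (a : ℤ) + 1 + (2 * n + 1))) = a + 2 * (-1 - a) by ring,
        zpow_add₀ (by norm_num), zpow_mul]
      norm_num
    · congr 2 <;> omega
  · intro k hk
    rw [Function.mem_support] at hk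
    simp only [Finset.coe_image, Finset.coe_range, Set.mem_image, Set.mem_Iio]
    by_contra hne
    refine hk ?_
    rw [normalPsi_one _ _ (by omega), if_neg, smul_zero]
    intro hlt
    exact hne ⟨(-1 - k).toNat, by omega, by omega⟩

/-! ### The Heisenberg operators commute -/

/-- The sum over the full range n + m is zero by reflection, and reflection carries the last m terms
to minus the first m. -/
theorem sum_range_antisymm {M : Type*} [AddCommGroup M] [Module ℂ M] (f : ℕ → M) (m n : ℕ)
    (h : ∀ a, a < n + m → f (n + m - 1 - a) = -f a) :
    ∑ a ∈ Finset.range n, f a = ∑ a ∈ Finset.range m, f a := by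
  have h0 : ∑ a ∈ Finset.range (n + m), f a = 0 := by
    have h1 := Finset.sum_range_reflect f (n + m)
    rw [Finset.sum_congr rfl fun a ha => h a (Finset.mem_range.mp ha),
      Finset.sum_neg_distrib] at h1
    have h2 : (2 : ℂ) • ∑ a ∈ Finset.range (n + m), f a = 0 := by
      rw [two_smul]
      nth_rewrite 1 [← h1]
      exact neg_add_cancel _
    exact (smul_eq_zero.mp h2).resolve_left two_ne_zero
  rw [Finset.sum_range_add] at h0
  rw [eq_neg_of_add_eq_zero_left h0, ← Finset.sum_neg_distrib, ← Finset.sum_range_reflect f m]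
  refine Finset.sum_congr rfl fun a ha => ?_
  rw [Finset.mem_range] at ha
  rw [← h (n + a) (by omega)]
  congr 1
  omega

theorem heisPol_X_mul_X (n i j : ℕ) :
    heisPol n (MvPolynomial.X i * MvPolynomial.X j) =
      MvPolynomial.X i * MvPolynomial.X j * heisPol n 1 +
        (MvPolynomial.X i * MvPolynomial.X (j + (2 * n + 1)) +
          MvPolynomial.X (i + (2 * n + 1)) * MvPolynomial.X j) := by
  rw [heisPol_X_mul, ← mul_one (MvPolynomial.X j), heisPol_X_mul]
  ring

theorem heisPol_heisPol_one (m n : ℕ) :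
    heisPol m (heisPol n 1) = heisPol n 1 * heisPol m 1 +
      ∑ a ∈ Finset.range (2 * n + 1), ((-1 : ℂ) ^ a) •
        (MvPolynomial.X a * MvPolynomial.X (2 * n + (2 * m + 1) - a)) := by
  have hr : ∑ a ∈ Finset.range (2 * n + 1), ((-1 : ℂ) ^ a) •
        (MvPolynomial.X (a + (2 * m + 1)) * MvPolynomial.X (2 * n - a)) =
      ∑ a ∈ Finset.range (2 * n + 1), ((-1 : ℂ) ^ a) •
        ((MvPolynomial.X a * MvPolynomial.X (2 * n + (2 * m + 1) - a) : Pol)) := by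
    rw [← Finset.sum_range_reflect]
    refine Finset.sum_congr rfl fun a ha => ?_
    rw [Finset.mem_range] at ha
    rw [mul_comm (MvPolynomial.X (_ : ℕ)), show 2 * n - (2 * n + 1 - 1 - a) = a by omega,
      show 2 * n + 1 - 1 - a + (2 * m + 1) = 2 * n + (2 * m + 1) - a by omega]
    refine congrArg (· • _) ?_
    have h : (-1 : ℂ) ^ (2 * n + 1 - 1 - a) * (-1) ^ a = 1 := by
      rw [← pow_add, show 2 * n + 1 - 1 - a + a = 2 * n by omega, pow_mul]
      norm_num
    rcases neg_one_pow_eq_or ℂ a with h' | h' <;> rw [h'] at h ⊢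
    · linear_combination h
    · linear_combination -h
  have hr' : ∑ a ∈ Finset.range (2 * n + 1), ((-1 : ℂ) ^ a) •
        (MvPolynomial.X a * MvPolynomial.X (2 * n - a + (2 * m + 1))) =
      ∑ a ∈ Finset.range (2 * n + 1), ((-1 : ℂ) ^ a) •
        ((MvPolynomial.X a * MvPolynomial.X (2 * n + (2 * m + 1) - a) : Pol)) := by
    refine Finset.sum_congr rfl fun a ha => ?_
    rw [Finset.mem_range] at ha
    rw [show 2 * n - a + (2 * m + 1) = 2 * n + (2 * m + 1) - a by omega]
  rw [heisPol_one n, map_smul, map_sum]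
  simp only [map_smul, heisPol_X_mul_X, smul_add, Finset.sum_add_distrib]
  rw [hr, hr', smul_mul_assoc, Finset.sum_mul]
  simp only [smul_mul_assoc]
  module

/-- Both operators obey the same kind of rule on X_i p, so the commutator commutes with
multiplication by X_i and only its value at 1 matters. There the cross terms agree because a ↦
2m+2n+1-a reverses the sign (-1)^a. -/
theorem heisPol_comm (m n : ℕ) (p : Pol) :
    heisPol m (heisPol n p) = heisPol n (heisPol m p) := by
  induction p using MvPolynomial.induction_on with
  | C c =>
    rw [← mul_one (MvPolynomial.C c), ← MvPolynomial.smul_eq_C_mul]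
    simp only [map_smul]
    refine congrArg (c • ·) ?_
    rw [heisPol_heisPol_one, heisPol_heisPol_one, mul_comm]
    refine congrArg (heisPol m 1 * heisPol n 1 + ·) ?_
    have h : ∀ k : ℕ, 2 * m + (2 * n + 1) - k = 2 * n + (2 * m + 1) - k := fun k => by omega
    simp only [h]
    refine sum_range_antisymm _ _ _ fun a ha => ?_
    rw [show 2 * n + (2 * m + 1) - (2 * n + 1 + (2 * m + 1) - 1 - a) = a by omega,
      mul_comm (MvPolynomial.X (_ : ℕ)),
      ← neg_smul, show 2 * n + 1 + (2 * m + 1) - 1 - a = 2 * n + (2 * m + 1) - a by omega]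
    refine congrArg (· • _) ?_
    have h1 : (-1 : ℂ) ^ (2 * n + (2 * m + 1) - a) * (-1) ^ a = -1 := by
      rw [← pow_add, show 2 * n + (2 * m + 1) - a + a = 2 * (n + m) + 1 by omega, pow_succ, pow_mul]
      norm_num
    rcases neg_one_pow_eq_or ℂ a with h' | h' <;> rw [h'] at h1 ⊢
    · linear_combination h1
    · linear_combination -h1
  | add p q hp hq => simp only [map_add, hp, hq]
  | mul_X p i hp =>
    rw [mul_comm]
    simp only [heisPol_X_mul, map_add, hp]
    rw [show i + (2 * n + 1) + (2 * m + 1) = i + (2 * m + 1) + (2 * n + 1) by ring]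
    abel

theorem heisLin_comm (m n : ℕ) (f : Fock) :
    heisLin m (heisLin n f) = heisLin n (heisLin m f) := by
  refine eq_of_pair_eq fun p => ?_
  change pair p (heis _ (heis _ f)) = pair p (heis _ (heis _ f))
  rw [← pair_heisPol, ← pair_heisPol, ← pair_heisPol, ← pair_heisPol, heisPol_comm]

/-! ### The time evolution -/

theorem coeff_matEl (v : Fock → ℂ) (u : Fock) (m : ℕ →₀ ℕ) :
    MvPowerSeries.coeff m (matEl v u) = v (timeExp (fun n => heisLin n) u m) := rfl

/-- The functional `p ↦ ⟨0|p(∂) e^{H(t)}|u⟩`. -/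
def evolve (u : Fock) : Pol →ₗ[ℂ] TimeSeries where
  toFun p := matEl (fun f => pair p f) u
  map_add' p q := by
    ext m
    rw [map_add (MvPowerSeries.coeff m)]
    change pair (p + q) _ = pair p _ + pair q _
    rw [map_add, LinearMap.add_apply]
  map_smul' c p := by
    ext m
    rw [RingHom.id_apply, MvPowerSeries.coeff_smul]
    change pair (c • p) _ = c * pair p _
    rw [map_smul, LinearMap.smul_apply, smul_eq_mul]

theorem coeff_evolve (u : Fock) (p : Pol) (m : ℕ →₀ ℕ) :
    MvPowerSeries.coeff m (evolve u p) = pair p (timeExp (fun n => heisLin n) u m) := rfl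

theorem coeff_zero_evolve (u : Fock) (p : Pol) :
    MvPowerSeries.coeff 0 (evolve u p) = pair p u := by
  rw [coeff_evolve, timeExp_zero]

/-- Commutativity of the H's allows H_{2n+1} to stand on the far left of e^{H(t)}, where it is
transposed onto p. -/
theorem pderiv_evolve (n : ℕ) (u : Fock) (p : Pol) :
    MvPowerSeries.pderiv ℂ n (evolve u p) = evolve u (heisPol n p) := by
  ext m
  rw [MvPowerSeries.coeff_pderiv, coeff_evolve, coeff_evolve, pair_heisPol]
  change _ = pair p (heisLin n _)
  rw [← timeExp_add_single heisLin heisLin_comm, map_smul, smul_eq_mul, mul_comm]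
  push_cast
  rfl

theorem evolve_add (u v : Fock) : evolve (u + v) = evolve u + evolve v := by
  refine LinearMap.ext fun p => ?_
  ext m
  rw [LinearMap.add_apply, map_add, coeff_evolve, coeff_evolve, coeff_evolve, timeExp_add, map_add]

theorem matEl_bra0 (u : Fock) : matEl bra0 u = evolve u 1 := by
  ext m
  rw [coeff_evolve, pair_one, coeff_matEl]
  rfl

/-! ### The functional `⟨1|` -/

theorem expCoeff_zero (A : ℕ → Fock → Fock) (u : Fock) : expCoeff A 0 u = u := by
  simp [expCoeff]

theorem bra0_phi_of_nonneg {k : ℤ} (hk : 0 ≤ k) (f : Fock) : bra0 (phi k f) = 0 := by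
  rw [bra0, ← pair_one, ← pair_psi, psi_of_nonneg_one hk]
  simp

theorem bra0_heis_neg {n : ℤ} (hn : n < 0) (f : Fock) : bra0 (heis n f) = 0 := by
  have h : bra0 (heis n f) = -(1 / 2 : ℂ) * ∑ᶠ k : ℤ, (-1 : ℂ) ^ k *
      MvPowerSeries.coeff 0 (normalProd k (-n - 1 - k) f) := rfl
  rw [h, finsum_eq_zero_of_forall_eq_zero, mul_zero]
  intro k
  by_cases h1 : k = 0 ∧ n = 0
  · omega
  rw [← pair_one, ← pair_normalPsi]
  by_cases h2 : k + (-n - 1 - k) = -1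
  · omega
  rw [normalPsi_one _ _ h2, if_neg (by omega)]
  simp

/-- Every term of positive degree in V_-⁻¹ has some H_{-k}, k > 0, on its left, and ⟨0|H_{-k} = 0.
-/
theorem bra0_vMinusInv {n : ℕ} (hn : n ≠ 0) (f : Fock) : bra0 (vMinusInv n f) = 0 := by
  have key : ∀ (N r : ℕ), r ≠ 0 ∨ N ≠ 0 → bra0 ((fun (f : ℕ → Fock) (r : ℕ) =>
      ∑ k ∈ Finset.Icc 1 r, if Odd k then (2 / (k : ℂ)) • heis (-(k : ℤ)) (f (r - k)) else 0)^[N]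
      (fun r => if r = 0 then f else 0) r) = 0 := by
    intro N r h
    cases N with
    | zero =>
      have hr : r ≠ 0 := by simpa using h
      simp [hr, bra0]
    | succ N =>
      rw [Function.iterate_succ_apply', bra0, map_sum]
      refine Finset.sum_eq_zero fun k hk => ?_
      rw [Finset.mem_Icc] at hk
      split_ifs
      · have h := bra0_heis_neg (n := -(k : ℤ)) (by omega)
        rw [MvPowerSeries.coeff_smul]
        exact mul_eq_zero_of_right _ (h _)
      · simp
  rw [vMinusInv, expCoeff, bra0, map_sum]
  refine Finset.sum_eq_zero fun N _ => ?_
  rw [MvPowerSeries.coeff_smul]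
  exact mul_eq_zero_of_right _ (key N n (Or.inl hn))

/-- After ⟨0| removes V_-⁻¹, the mode next to it is φ_{b-1/2}, where b is the degree taken from
V_+⁻¹. It is killed by ⟨0| unless b = 0, which leaves φ_{-1/2} = ∂/∂X_0. -/
theorem bra1_eq (f : Fock) : bra1 f = (1 / 2 : ℂ) * pair (MvPolynomial.X 0) f := by
  have h : bra1 f = (1 / 2 : ℂ) * ∑ᶠ p : ℕ × ℕ, bra0
    (vMinusInv p.1 (phi ((p.2 : ℤ) - p.1 - 0 - 1) (vPlusInv p.2 f))) := rfl
  rw [h, finsum_eq_single _ (0, 0)]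
  · rw [vMinusInv, vPlusInv, expCoeff_zero, expCoeff_zero, bra0, ← pair_one, ← pair_psi]
    have := psi_neg 0 1
    simp only [Nat.cast_zero, sub_zero, pow_zero, one_smul, mul_one] at this
    simp [this]
  · rintro ⟨a, b⟩ hab
    by_cases ha : a = 0
    · subst ha
      have hb : b ≠ 0 := by
        rintro rfl
        exact hab rfl
      rw [vMinusInv, expCoeff_zero, bra0_phi_of_nonneg]
      simp only [Nat.cast_zero]
      omega
    · exact bra0_vMinusInv ha _

theorem matEl_bra1 (u : Fock) :
    matEl bra1 u = (1 / 2 : ℂ) • evolve u (MvPolynomial.X 0) := by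
  ext m
  rw [coeff_matEl, bra1_eq, MvPowerSeries.coeff_smul, coeff_evolve]

/-! ### The differential field of functions of the times -/

instance : CharZero TimeField :=
  charZero_of_injective_algebraMap (algebraMap ℂ TimeField).injective

theorem exists_eq_div (f : TimeField) : ∃ a b : TimeSeries, b ≠ 0 ∧
    f = algebraMap TimeSeries TimeField a / algebraMap TimeSeries TimeField b := by
  obtain ⟨a, b, hb, rfl⟩ := IsFractionRing.div_surjective TimeSeries f
  exact ⟨a, b, nonZeroDivisors.ne_zero hb, rfl⟩

theorem algebraMap_timeField_ne_zero {b : TimeSeries} (hb : b ≠ 0) :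
    algebraMap TimeSeries TimeField b ≠ 0 := by
  simpa using hb

theorem dt_algebraMap (n : ℕ) (a : TimeSeries) :
    dt n (algebraMap TimeSeries TimeField a) =
      algebraMap TimeSeries TimeField (MvPowerSeries.pderiv ℂ n a) := by
  have h := dt_div n a 1 one_ne_zero
  simpa using h

theorem dt_add (n : ℕ) (f g : TimeField) : dt n (f + g) = dt n f + dt n g := by
  obtain ⟨a, b, hb, rfl⟩ := exists_eq_div f
  obtain ⟨c, d, hd, rfl⟩ := exists_eq_div g
  have hb' := algebraMap_timeField_ne_zero hb
  have hd' := algebraMap_timeField_ne_zero hd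
  rw [div_add_div _ _ hb' hd', ← map_mul, ← map_mul, ← map_mul, ← map_add,
    dt_div _ _ _ (mul_ne_zero hb hd), dt_div _ _ _ hb, dt_div _ _ _ hd]
  simp only [map_add, Derivation.leibniz, map_mul, smul_eq_mul]
  field_simp
  ring

theorem dt_mul (n : ℕ) (f g : TimeField) : dt n (f * g) = dt n f * g + f * dt n g := by
  obtain ⟨a, b, hb, rfl⟩ := exists_eq_div f
  obtain ⟨c, d, hd, rfl⟩ := exists_eq_div g
  have hb' := algebraMap_timeField_ne_zero hb
  have hd' := algebraMap_timeField_ne_zero hd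
  rw [div_mul_div_comm, ← map_mul, ← map_mul,
    dt_div _ _ _ (mul_ne_zero hb hd), dt_div _ _ _ hb, dt_div _ _ _ hd]
  simp only [map_add, Derivation.leibniz, map_mul, smul_eq_mul]
  field_simp
  ring

theorem dt_one (n : ℕ) : dt n 1 = 0 := by
  have h := dt_algebraMap n 1
  rwa [map_one, Derivation.map_one_eq_zero, map_zero] at h

theorem dt_algebraMap_complex (n : ℕ) (c : ℂ) : dt n (algebraMap ℂ TimeField c) = 0 := by
  rw [IsScalarTower.algebraMap_apply ℂ TimeSeries TimeField, dt_algebraMap,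
    Derivation.map_algebraMap, map_zero]

/-- The derivative `∂/∂t_{2n+1}` as a derivation. -/
def dtDer (n : ℕ) : Derivation ℂ TimeField TimeField :=
  Derivation.mk'
    { toFun := dt n
      map_add' := dt_add n
      map_smul' := fun c f => by
        rw [RingHom.id_apply, Algebra.smul_def, Algebra.smul_def, dt_mul, dt_algebraMap_complex,
          zero_mul, zero_add] }
    fun f g => by
      change dt n (f * g) = f * dt n g + g * dt n f
      rw [dt_mul]
      ring

theorem dtDer_apply (n : ℕ) (f : TimeField) : dtDer n f = dt n f := rfl

theorem dt_neg (n : ℕ) (f : TimeField) : dt n (-f) = -dt n f := (dtDer n).map_neg f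

theorem dt_sum {ι : Type*} (n : ℕ) (s : Finset ι) (f : ι → TimeField) :
    dt n (∑ i ∈ s, f i) = ∑ i ∈ s, dt n (f i) := map_sum (dtDer n) f s

theorem dt_finsum {ι : Type*} (n : ℕ) {f : ι → TimeField} (hf : Function.HasFiniteSupport f) :
    dt n (∑ᶠ i, f i) = ∑ᶠ i, dt n (f i) := map_finsum (dtDer n) hf

theorem dt_intCast (n : ℕ) (c : ℤ) : dt n (c : TimeField) = 0 := by
  rw [← dtDer_apply]
  exact (dtDer n).map_intCast c

theorem dt_intCast_mul (n : ℕ) (c : ℤ) (f : TimeField) : dt n (c * f) = c * dt n f := by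
  rw [dt_mul, dt_intCast, zero_mul, zero_add]

theorem dt_inv (n : ℕ) (f : TimeField) : dt n f⁻¹ = -dt n f / f ^ 2 := by
  have h := (dtDer n).leibniz_inv f
  rw [dtDer_apply, dtDer_apply, smul_eq_mul] at h
  rw [h]
  ring

theorem dt_div' (n : ℕ) (f g : TimeField) (hg : g ≠ 0) :
    dt n (f / g) = dt n f / g - f / g * (dt n g / g) := by
  rw [div_eq_mul_inv, dt_mul, dt_inv]
  field_simp
  ring

theorem pderiv_comm (m n : ℕ) (a : TimeSeries) :
    MvPowerSeries.pderiv ℂ m (MvPowerSeries.pderiv ℂ n a) =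
      MvPowerSeries.pderiv ℂ n (MvPowerSeries.pderiv ℂ m a) := by
  ext d
  simp only [MvPowerSeries.coeff_pderiv]
  by_cases h : m = n
  · rw [h]
  · rw [add_right_comm]
    simp only [Finsupp.coe_add, Pi.add_apply, Finsupp.single_apply, h, Ne.symm h, if_false,
      add_zero]
    ring

theorem dt_comm (m n : ℕ) (f : TimeField) : dt m (dt n f) = dt n (dt m f) := by
  obtain ⟨a, b, hb, rfl⟩ := exists_eq_div f
  have hb' := algebraMap_timeField_ne_zero hb
  simp only [div_eq_mul_inv, dt_mul, dt_inv, dt_algebraMap, dt_add, dt_neg, pow_two, mul_inv,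
    pderiv_comm m n]
  field_simp
  ring

/-! ### Time evolution and the bilinear identity -/

/-- Ω commutes with H_{2n+1} ⊗ 1 + 1 ⊗ H_{2n+1}, so the time derivative can be moved to the test
polynomials. -/
theorem pderiv_bil {u v : Pol →ₗ[ℂ] TimeSeries} (n : ℕ)
    (hu : ∀ p, MvPowerSeries.pderiv ℂ n (u p) = u (heisPol n p))
    (hv : ∀ p, MvPowerSeries.pderiv ℂ n (v p) = v (heisPol n p)) (p p' : Pol) :
    MvPowerSeries.pderiv ℂ n (bil u v p p') =
      bil u v (heisPol n p) p' + bil u v p (heisPol n p') := by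
  rw [heisPol, ← bil_piPol, bil_eq_sum, bil_eq_sum, bil_eq_sum, map_sum,
    ← Finset.sum_add_distrib]
  refine Finset.sum_congr rfl fun k _ => ?_
  rw [Derivation.map_smul, Derivation.leibniz, hu, hv, LinearMap.comp_apply, LinearMap.comp_apply,
    smul_eq_mul, smul_eq_mul, ← smul_add, heisPol]
  congr 1
  ring

theorem coeff_zero_bil_evolve (u v : Fock) (p p' : Pol) :
    MvPowerSeries.coeff 0 (bil (evolve u) (evolve v) p p') =
      bil (toFunctional u) (toFunctional v) p p' := by
  rw [bil_eq_sum, bil_eq_sum, map_sum]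
  refine Finset.sum_congr rfl fun k _ => ?_
  rw [MvPowerSeries.coeff_smul, toFunctional_apply, toFunctional_apply, ← coeff_zero_evolve,
    ← coeff_zero_evolve]
  simp only [MvPowerSeries.coeff_zero_eq_constantCoeff, map_mul, smul_eq_mul]

theorem bil_evolve_eq_zero {τ : Fock} (hτ : IsIsotropic τ) (p p' : Pol) :
    bil (evolve τ) (evolve τ) p p' = 0 := by
  refine eq_zero_of_pderiv_mem_closure
    (Set.range fun x : Pol × Pol => bil (evolve τ) (evolve τ) x.1 x.2) ?_ ?_ ⟨(p, p'), rfl⟩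
  · rintro _ ⟨⟨p, p'⟩, rfl⟩ n
    rw [pderiv_bil n (pderiv_evolve n τ) (pderiv_evolve n τ)]
    exact add_mem (AddSubgroup.subset_closure ⟨(heisPol n p, p'), rfl⟩)
      (AddSubgroup.subset_closure ⟨(p, heisPol n p'), rfl⟩)
  · rintro _ ⟨⟨p, p'⟩, rfl⟩
    rw [coeff_zero_bil_evolve]
    exact hτ p p'

/-- Commuting φ_{l+1/2} past the first factor of Ω leaves a single term, k = -1-l, whose second
factor is again φ_{l+1/2}. -/
theorem bil_phi (l : ℤ) {τ : Fock} (hτ : IsIsotropic τ) (p p' : Pol) :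
    bil (toFunctional (phi l τ)) (toFunctional τ) p p' = -(pair p τ * pair p' (phi l τ)) := by
  have h := hτ (psi l p) p'
  have h1 : bil (toFunctional (phi l τ)) (toFunctional τ) p p' -
      bil (toFunctional τ) (toFunctional τ) (psi l p) p' =
      ∑ᶠ k : ℤ, if k = -1 - l then -(pair p τ * pair p' (phi l τ)) else 0 := by
    rw [bil, bil, ← finsum_sub_distrib (bil_hasFiniteSupport _ _ _ _)
      (bil_hasFiniteSupport _ _ _ _)]
    refine finsum_congr fun k => ?_
    simp only [toFunctional_apply]
    rw [← pair_psi l, ← smul_sub, ← sub_mul, ← LinearMap.sub_apply, ← map_sub, psi_comm]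
    by_cases hk : k = -1 - l
    · rw [if_pos (by omega), if_pos hk, map_smul, LinearMap.smul_apply, hk,
        show -1 - (-1 - l) = l by ring, pair_psi l p']
      have : (-1 : ℂ) ^ (-1 - l) * (-1) ^ l = -1 := by
        rw [← zpow_add₀ (by norm_num), sub_add_cancel]
        norm_num
      simp only [smul_eq_mul]
      linear_combination (pair p τ * pair p' (phi l τ)) * this
    · rw [if_neg (by omega), if_neg hk]
      simp
  rw [h, sub_zero, finsum_eq_single _ (-1 - l) fun k hk => if_neg hk, if_pos rfl] at h1
  exact h1

theorem betaAct_add (b b' : ℤ →₀ ℂ) (τ : Fock) :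
    betaAct (b + b') τ = betaAct b τ + betaAct b' τ :=
  Finsupp.sum_add_index' (fun _ => zero_smul _ _) fun _ _ _ => add_smul _ _ _

theorem bil_betaAct (b : ℤ →₀ ℂ) {τ : Fock} (hτ : IsIsotropic τ) (p p' : Pol) :
    bil (toFunctional (betaAct b τ)) (toFunctional τ) p p' =
      -(pair p τ * pair p' (betaAct b τ)) := by
  induction b using Finsupp.induction_linear with
  | zero => simp [betaAct, toFunctional, bil_eq_sum]
  | add b b' h h' =>
    rw [betaAct_add, toFunctional, map_add, ← toFunctional, ← toFunctional, bil_add_left, h, h',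
      map_add]
    ring
  | single l c =>
    have h : betaAct (Finsupp.single l c) τ = c • phi l τ :=
      Finsupp.sum_single_index (zero_smul _ _)
    rw [h, toFunctional, map_smul, ← toFunctional, bil_smul_left, bil_phi l hτ, map_smul]
    simp only [smul_eq_mul]
    ring

theorem bil_evolve_betaAct (b : ℤ →₀ ℂ) {τ : Fock} (hτ : IsIsotropic τ) (p p' : Pol) :
    bil (evolve (betaAct b τ)) (evolve τ) p p' + evolve τ p * evolve (betaAct b τ) p' = 0 := by
  refine eq_zero_of_pderiv_mem_closure
    (Set.range fun x : Pol × Pol => bil (evolve (betaAct b τ)) (evolve τ) x.1 x.2 +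
      evolve τ x.1 * evolve (betaAct b τ) x.2) ?_ ?_ ⟨(p, p'), rfl⟩
  · rintro _ ⟨⟨p, p'⟩, rfl⟩ n
    have h : MvPowerSeries.pderiv ℂ n (bil (evolve (betaAct b τ)) (evolve τ) p p' +
        evolve τ p * evolve (betaAct b τ) p') =
        (bil (evolve (betaAct b τ)) (evolve τ) (heisPol n p) p' +
          evolve τ (heisPol n p) * evolve (betaAct b τ) p') +
        (bil (evolve (betaAct b τ)) (evolve τ) p (heisPol n p') +
          evolve τ p * evolve (betaAct b τ) (heisPol n p')) := by
      rw [map_add, pderiv_bil n (pderiv_evolve n _) (pderiv_evolve n τ), Derivation.leibniz,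
        pderiv_evolve, pderiv_evolve, smul_eq_mul, smul_eq_mul]
      ring
    dsimp only
    rw [h]
    exact add_mem (AddSubgroup.subset_closure ⟨(heisPol n p, p'), rfl⟩)
      (AddSubgroup.subset_closure ⟨(p, heisPol n p'), rfl⟩)
  · rintro _ ⟨⟨p, p'⟩, rfl⟩
    dsimp only
    rw [map_add, coeff_zero_bil_evolve, bil_betaAct b hτ]
    simp only [MvPowerSeries.coeff_zero_eq_constantCoeff, map_mul]
    simp only [← MvPowerSeries.coeff_zero_eq_constantCoeff_apply, coeff_zero_evolve]
    ring

/-- The vertex operator relation `e^{H(t)} φ(z) = e^{ξ(t,z)} φ(z) e^{H(t)}`. -/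
theorem mulExpXi_evolve_phi (τ : Fock) (j : ℤ) (p : Pol) :
    mulExpXi (-1) (fun k => evolve (phi k τ) p) j = evolve τ (psi j p) := by
  rw [← sub_eq_zero]
  refine eq_zero_of_pderiv_mem_closure
    (Set.range fun x : ℤ × Pol => mulExpXi (-1) (fun k => evolve (phi k τ) x.2) x.1 -
      evolve τ (psi x.1 x.2)) ?_ ?_ ⟨(j, p), rfl⟩
  · rintro _ ⟨⟨j, p⟩, rfl⟩ n
    have h : MvPowerSeries.pderiv ℂ n (mulExpXi (-1) (fun k => evolve (phi k τ) p) j -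
        evolve τ (psi j p)) =
        (mulExpXi (-1) (fun k => evolve (phi k τ) (heisPol n p)) j -
          evolve τ (psi j (heisPol n p))) -
        (mulExpXi (-1) (fun k => evolve (phi k τ) p) (j - (2 * n + 1)) -
          evolve τ (psi (j - (2 * n + 1)) p)) := by
      rw [map_sub, pderiv_mulExpXi, pderiv_evolve, heisPol_psi, map_sub]
      simp only [pderiv_evolve]
      push_cast
      module
    dsimp only
    rw [h]
    exact sub_mem (AddSubgroup.subset_closure ⟨(j, heisPol n p), rfl⟩)
      (AddSubgroup.subset_closure ⟨(j - (2 * n + 1), p), rfl⟩)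
  · rintro _ ⟨⟨j, p⟩, rfl⟩
    dsimp only
    rw [map_sub, coeff_zero_mulExpXi, coeff_zero_evolve, coeff_zero_evolve, pair_psi, sub_self]

/-! ### The Riccati system -/

/-- The reflection a ↦ 2n - a preserves parity. This equates the two connected Wick pairings below.
-/
theorem sum_reflect_even {R : Type*} [CommRing R] (n : ℕ) (f : ℕ → ℕ → R) :
    ∑ a ∈ Finset.range (2 * n + 1), (-1) ^ a * f (2 * n - a) a =
      ∑ a ∈ Finset.range (2 * n + 1), (-1) ^ a * f a (2 * n - a) := by
  rw [← Finset.sum_range_reflect]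
  refine Finset.sum_congr rfl fun a ha => ?_
  rw [Finset.mem_range] at ha
  rw [show 2 * n - (2 * n + 1 - 1 - a) = a by omega, show 2 * n + 1 - 1 - a = 2 * n - a by omega]
  congr 1
  have h : (-1 : R) ^ (2 * n - a) * (-1) ^ a = 1 := by
    rw [← pow_add, Nat.sub_add_cancel (by omega), pow_mul]
    norm_num
  rcases neg_one_pow_eq_or R a with h' | h' <;> rw [h'] at h ⊢
  · linear_combination h
  · linear_combination -h

theorem evolve_wick {τ : Fock} (hτ : IsIsotropic τ) (p : Pol) (i : ℕ) :
    evolve τ (MvPolynomial.X i * p) * evolve τ 1 = ∑ᶠ n : ℕ, evolve τ (MvPolynomial.pderiv n p) *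
      evolve τ (MvPolynomial.X n * MvPolynomial.X i) := by
  have h := bil_evolve_eq_zero hτ p (MvPolynomial.X i)
  rw [bil_X, sub_eq_zero] at h
  exact h.symm

theorem evolve_betaAct_wick (b : ℤ →₀ ℂ) {τ : Fock} (hτ : IsIsotropic τ) (p : Pol) (i : ℕ) :
    evolve (betaAct b τ) (MvPolynomial.X i * p) * evolve τ 1 =
      (∑ᶠ n : ℕ, evolve (betaAct b τ) (MvPolynomial.pderiv n p) *
        evolve τ (MvPolynomial.X n * MvPolynomial.X i)) +
        evolve τ p * evolve (betaAct b τ) (MvPolynomial.X i) := by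
  have h := bil_evolve_betaAct b hτ p (MvPolynomial.X i)
  rw [bil_X] at h
  linear_combination -h

/-- The affine coordinates `⟨0|∂_i ∂_j e^{H(t)}|τ⟩ / ⟨0|e^{H(t)}|τ⟩`. -/
def affineCoord (τ : Fock) (i j : ℕ) : TimeField :=
  algebraMap TimeSeries TimeField (evolve τ (MvPolynomial.X i * MvPolynomial.X j)) /
    algebraMap TimeSeries TimeField (evolve τ 1)

/-- The functions `⟨0|∂_i e^{H(t)} β|τ⟩ / ⟨0|e^{H(t)}|τ⟩`. -/
def betaCoord (b : ℤ →₀ ℂ) (τ : Fock) (i : ℕ) : TimeField :=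
  algebraMap TimeSeries TimeField (evolve (betaAct b τ) (MvPolynomial.X i)) /
    algebraMap TimeSeries TimeField (evolve τ 1)

theorem affineCoord_symm (τ : Fock) (i j : ℕ) : affineCoord τ i j = affineCoord τ j i := by
  rw [affineCoord, affineCoord, mul_comm]

theorem evolve_heisPol_one_mul (u : Fock) (n : ℕ) (p : Pol) :
    evolve u (p * heisPol n 1) = (1 / 2 : ℂ) • ∑ a ∈ Finset.range (2 * n + 1), ((-1 : ℂ) ^ a) •
      evolve u (p * (MvPolynomial.X a * MvPolynomial.X (2 * n - a))) := by
  rw [heisPol_one, mul_smul_comm, map_smul, Finset.mul_sum, map_sum]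
  simp only [mul_smul_comm, map_smul]

theorem algebraMap_complex_smul (c : ℂ) (g : TimeSeries) :
    algebraMap TimeSeries TimeField (c • g) =
      algebraMap ℂ TimeField c * algebraMap TimeSeries TimeField g := by
  rw [Algebra.smul_def, map_mul, ← IsScalarTower.algebraMap_apply]

theorem algebraMap_half_sum (n : ℕ) (f : ℕ → TimeSeries) :
    algebraMap TimeSeries TimeField ((1 / 2 : ℂ) • ∑ a ∈ Finset.range (2 * n + 1),
      ((-1 : ℂ) ^ a) • f a) =
      (1 / 2) * ∑ a ∈ Finset.range (2 * n + 1), (-1) ^ a * algebraMap TimeSeries TimeField (f a) := by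
  rw [algebraMap_complex_smul, map_sum]
  simp only [algebraMap_complex_smul, map_pow, map_neg, map_one, map_div₀, map_ofNat]

/-- The subtracted factor is the logarithmic derivative of ⟨0|e^{H(t)}τ⟩; it will cancel the
disconnected pairing in Wick's formula. -/
theorem dt_evolve_div {τ : Fock} (hτ : evolve τ 1 ≠ 0) (n : ℕ) (u : Fock) (p : Pol) :
    dt n (algebraMap TimeSeries TimeField (evolve u p) /
      algebraMap TimeSeries TimeField (evolve τ 1)) =
    algebraMap TimeSeries TimeField (evolve u (heisPol n p)) /
      algebraMap TimeSeries TimeField (evolve τ 1) -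
    algebraMap TimeSeries TimeField (evolve u p) /
      algebraMap TimeSeries TimeField (evolve τ 1) *
      ((1 / 2) * ∑ a ∈ Finset.range (2 * n + 1), (-1) ^ a * affineCoord τ a (2 * n - a)) := by
  rw [dt_div' _ _ _ (algebraMap_timeField_ne_zero hτ), dt_algebraMap, dt_algebraMap, pderiv_evolve,
    pderiv_evolve]
  congr 2
  rw [← one_mul (heisPol n 1), evolve_heisPol_one_mul, algebraMap_half_sum, mul_div_assoc,
    Finset.sum_div]
  simp only [one_mul, mul_div_assoc]
  rfl

/-- The shifts of i and j come from the linear part of H_{2n+1}, the quadratic term from its vacuum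
part through the connected pairings of a four-point function. -/
theorem dt_affineCoord {τ : Fock} (hτ : IsIsotropic τ) (h0 : evolve τ 1 ≠ 0) (n i j : ℕ) :
    dt n (affineCoord τ i j) = affineCoord τ (i + (2 * n + 1)) j +
      affineCoord τ i (j + (2 * n + 1)) + ∑ a ∈ Finset.range (2 * n + 1),
        (-1) ^ a * (affineCoord τ i a * affineCoord τ (2 * n - a) j) := by
  have h0' := algebraMap_timeField_ne_zero h0
  have h4 : ∀ a c, algebraMap TimeSeries TimeField (evolve τ (MvPolynomial.X i * MvPolynomial.X j *
      (MvPolynomial.X a * MvPolynomial.X c))) / algebraMap TimeSeries TimeField (evolve τ 1) =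
      affineCoord τ i j * affineCoord τ a c + (affineCoord τ i a * affineCoord τ c j +
        affineCoord τ i c * affineCoord τ a j) := by
    intro a c
    have h := congrArg (algebraMap TimeSeries TimeField)
      (evolve_wick hτ (MvPolynomial.X j * (MvPolynomial.X a * MvPolynomial.X c)) i)
    rw [finsum_pderiv_X_mul_X_mul_X, ← mul_assoc] at h
    simp only [map_add, map_mul] at h
    rw [affineCoord_symm τ i j, affineCoord_symm τ i a, affineCoord_symm τ i c,
      affineCoord_symm τ c j, affineCoord_symm τ a j]
    simp only [affineCoord]
    field_simp
    linear_combination h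
  rw [affineCoord, dt_evolve_div h0, heisPol_X_mul_X, map_add, map_add, map_add, map_add,
    evolve_heisPol_one_mul, algebraMap_half_sum, add_div, add_div, mul_div_assoc, Finset.sum_div]
  simp only [mul_div_assoc, h4]
  -- The two connected pairings have equal alternating sums, which cancels the factor 1/2 in the
  -- vacuum part of H_{2n+1}.
  have hr := sum_reflect_even n fun a c => affineCoord τ i a * affineCoord τ c j
  simp only [mul_add, Finset.sum_add_distrib]
  rw [hr]
  have hm : ∑ a ∈ Finset.range (2 * n + 1),
      (-1) ^ a * (affineCoord τ i j * affineCoord τ a (2 * n - a)) =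
      affineCoord τ i j * ∑ a ∈ Finset.range (2 * n + 1),
        (-1) ^ a * affineCoord τ a (2 * n - a) := by
    rw [Finset.mul_sum]
    exact Finset.sum_congr rfl fun a _ => by ring
  rw [hm]
  simp only [← affineCoord.eq_1]
  ring

theorem dt_betaCoord (b : ℤ →₀ ℂ) {τ : Fock} (hτ : IsIsotropic τ) (h0 : evolve τ 1 ≠ 0)
    (n i : ℕ) :
    dt n (betaCoord b τ i) = betaCoord b τ (i + (2 * n + 1)) +
      ∑ a ∈ Finset.range (2 * n + 1),
        (-1) ^ a * (affineCoord τ i a * betaCoord b τ (2 * n - a)) := by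
  have h0' := algebraMap_timeField_ne_zero h0
  -- Wick's formula with one insertion of β: one of the three variables is paired with β and the
  -- other two with each other.
  have h4 : ∀ a c, algebraMap TimeSeries TimeField (evolve (betaAct b τ) (MvPolynomial.X i *
      (MvPolynomial.X a * MvPolynomial.X c))) / algebraMap TimeSeries TimeField (evolve τ 1) =
      betaCoord b τ i * affineCoord τ a c + (affineCoord τ i a * betaCoord b τ c +
        affineCoord τ i c * betaCoord b τ a) := by
    intro a c
    have h := congrArg (algebraMap TimeSeries TimeField)
      (evolve_betaAct_wick b hτ (MvPolynomial.X a * MvPolynomial.X c) i)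
    rw [finsum_pderiv_X_mul_X] at h
    simp only [map_add, map_mul] at h
    rw [affineCoord_symm τ i a, affineCoord_symm τ i c]
    simp only [affineCoord, betaCoord]
    field_simp
    linear_combination h
  rw [betaCoord, dt_evolve_div h0, ← mul_one (MvPolynomial.X i), heisPol_X_mul, mul_one, mul_one,
    map_add, map_add, evolve_heisPol_one_mul, algebraMap_half_sum, add_div, mul_div_assoc,
    Finset.sum_div]
  simp only [mul_div_assoc, h4]
  have hr := sum_reflect_even n fun a c => affineCoord τ i a * betaCoord b τ c
  simp only [mul_add, Finset.sum_add_distrib]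
  rw [hr]
  have hm : ∑ a ∈ Finset.range (2 * n + 1),
      (-1) ^ a * (betaCoord b τ i * affineCoord τ a (2 * n - a)) =
      betaCoord b τ i * ∑ a ∈ Finset.range (2 * n + 1),
        (-1) ^ a * affineCoord τ a (2 * n - a) := by
    rw [Finset.mul_sum]
    exact Finset.sum_congr rfl fun a _ => by ring
  rw [hm]
  simp only [← betaCoord.eq_1]
  ring

/-! ### The wave function in affine coordinates -/

theorem algebraMap_half_smul (f : TimeSeries) :
    algebraMap TimeSeries TimeField ((1 / 2 : ℂ) • f) =
      (1 / 2) * algebraMap TimeSeries TimeField f := by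
  have h := algebraMap_half_sum 0 fun _ => f
  simpa using h

/-- The assumption on β forces τ ≠ 0, so the vacuum coefficient, which is the value at t = 0, is
non-zero. -/
theorem evolve_one_ne_zero {b : ℤ →₀ ℂ} {τ : Fock} (hτ : IsIsotropic τ)
    (hb : matEl bra1 (betaAct b τ) ≠ 0) : evolve τ 1 ≠ 0 := by
  have hτ0 : τ ≠ 0 := by
    rintro rfl
    refine hb ?_
    have h : betaAct b 0 = 0 := by
      refine Finset.sum_eq_zero fun k _ => ?_
      dsimp only
      rw [eq_of_pair_eq (f := phi k 0) (g := 0) fun p => by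
        rw [← pair_psi, map_zero, map_zero], smul_zero]
    have h1 : evolve 0 = 0 := by
      have := evolve_add 0 0
      simpa using this
    rw [h, matEl_bra1, h1, LinearMap.zero_apply, smul_zero]
  intro h
  apply hτ.pair_one_ne_zero hτ0
  rw [← coeff_zero_evolve, h, map_zero]

theorem eigenfun_eq (b : ℤ →₀ ℂ) (τ : Fock) : eigenfun b τ = betaCoord b τ 0 := by
  rw [eigenfun, betaCoord, matEl_bra1, matEl_bra0, algebraMap_half_smul, ← mul_assoc]
  norm_num

theorem betaCoord_ne_zero {b : ℤ →₀ ℂ} {τ : Fock} (hτ : IsIsotropic τ)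
    (hb : matEl bra1 (betaAct b τ) ≠ 0) : betaCoord b τ 0 ≠ 0 := by
  refine div_ne_zero (algebraMap_timeField_ne_zero fun h => hb ?_)
    (algebraMap_timeField_ne_zero (evolve_one_ne_zero hτ hb))
  rw [matEl_bra1, h, smul_zero]

/-- After the vertex operator relation, φ(z) acts on the polynomial X_0 of ⟨1|. Its positive modes
give ∂_j X_0 = 0, the zeroth gives 1, and the negative ones give two-point functions. -/
theorem wave_eq {b : ℤ →₀ ℂ} {τ : Fock} (hτ : IsIsotropic τ)
    (hb : matEl bra1 (betaAct b τ) ≠ 0) (j : ℤ) :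
    wave b τ j = (betaCoord b τ 0)⁻¹ * (algebraMap TimeSeries TimeField
      (evolve τ (psi j (MvPolynomial.X 0))) / algebraMap TimeSeries TimeField (evolve τ 1)) := by
  have h0 := algebraMap_timeField_ne_zero (evolve_one_ne_zero hτ hb)
  have h1 : mulExpXi (-1) (fun k => matEl bra1 (phi k τ)) j =
      (1 / 2 : ℂ) • evolve τ (psi j (MvPolynomial.X 0)) := by
    rw [← mulExpXi_evolve_phi]
    ext m
    rw [MvPowerSeries.coeff_smul, coeff_mulExpXi, coeff_mulExpXi, Finset.mul_sum]
    refine Finset.sum_congr rfl fun x _ => ?_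
    rw [matEl_bra1, MvPowerSeries.coeff_smul]
    ring
  rw [wave, h1, matEl_bra1, algebraMap_half_smul, algebraMap_half_smul, betaCoord,
    mul_div_mul_left _ _ (by norm_num), inv_div, div_mul_div_comm, mul_comm,
    mul_div_mul_right _ _ h0]

theorem wave_of_pos {b : ℤ →₀ ℂ} {τ : Fock} (hτ : IsIsotropic τ)
    (hb : matEl bra1 (betaAct b τ) ≠ 0) {j : ℤ} (hj : 0 < j) : wave b τ j = 0 := by
  obtain ⟨n, rfl⟩ := Int.eq_ofNat_of_zero_le hj.le
  rw [wave_eq hτ hb, psi_natCast, MvPolynomial.pderiv_X_of_ne (by omega)]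
  simp

theorem wave_zero {b : ℤ →₀ ℂ} {τ : Fock} (hτ : IsIsotropic τ)
    (hb : matEl bra1 (betaAct b τ) ≠ 0) : wave b τ 0 = (betaCoord b τ 0)⁻¹ := by
  have h0 := algebraMap_timeField_ne_zero (evolve_one_ne_zero hτ hb)
  have h := psi_natCast 0 (MvPolynomial.X 0)
  rw [Nat.cast_zero] at h
  rw [wave_eq hτ hb, h, MvPolynomial.pderiv_X_self, div_self h0, mul_one]

theorem wave_neg {b : ℤ →₀ ℂ} {τ : Fock} (hτ : IsIsotropic τ)
    (hb : matEl bra1 (betaAct b τ) ≠ 0) (n : ℕ) :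
    wave b τ (-1 - n) = (betaCoord b τ 0)⁻¹ * ((-1) ^ n * affineCoord τ 0 n) := by
  rw [wave_eq hτ hb, psi_neg, map_smul, algebraMap_complex_smul, affineCoord_symm, affineCoord,
    mul_div_assoc]
  simp

theorem dt_iterate_add (n k : ℕ) (f g : TimeField) :
    (dt n)^[k] (f + g) = (dt n)^[k] f + (dt n)^[k] g := by
  induction k generalizing f g with
  | zero => rfl
  | succ k ih => simp only [Function.iterate_succ_apply, dt_add, ih]

theorem dt_dt_iterate (m n k : ℕ) (f : TimeField) : dt m ((dt n)^[k] f) = (dt n)^[k] (dt m f) := by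
  induction k generalizing f with
  | zero => rfl
  | succ k ih => rw [Function.iterate_succ_apply, ih, dt_comm, Function.iterate_succ_apply]

theorem dt_iterate_of_dt_eq_zero {n k : ℕ} {f : TimeField} (hf : dt n f = 0) (hk : k ≠ 0) :
    (dt n)^[k] f = 0 := by
  obtain ⟨k, rfl⟩ := Nat.exists_eq_succ_of_ne_zero hk
  rw [Function.iterate_succ_apply, hf, dt_iterate_zero]

namespace PDO

/-! ### The additive group of pseudo-differential operators -/

/-- The order is at most `d`. -/
def DegLE (A : PDO) (d : ℤ) : Prop := ∀ i, d < i → A.coeff i = 0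

theorem DegLE.mono {A : PDO} {d d' : ℤ} (h : A.DegLE d) (hd : d ≤ d') : A.DegLE d' :=
  fun i hi => h i (by omega)

theorem exists_degLE (A : PDO) : ∃ d, A.DegLE d := A.bdd

instance : Zero PDO := ⟨⟨fun _ => 0, ⟨0, fun _ _ => rfl⟩⟩⟩

instance : Add PDO where
  add A B :=
    { coeff := fun i => A.coeff i + B.coeff i
      bdd := by
        obtain ⟨M, hM⟩ := A.bdd
        obtain ⟨N, hN⟩ := B.bdd
        exact ⟨max M N, fun i hi => by
          rw [hM i (lt_of_le_of_lt (le_max_left _ _) hi),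
            hN i (lt_of_le_of_lt (le_max_right _ _) hi), add_zero]⟩ }

@[simp] theorem coeff_zero (i : ℤ) : (0 : PDO).coeff i = 0 := rfl

@[simp] theorem coeff_add (A B : PDO) (i : ℤ) : (A + B).coeff i = A.coeff i + B.coeff i := rfl

@[simp] theorem coeff_neg (A : PDO) (i : ℤ) : (-A).coeff i = -A.coeff i := rfl

@[simp] theorem coeff_sub (A B : PDO) (i : ℤ) : (A - B).coeff i = A.coeff i - B.coeff i := rfl

instance : AddCommGroup PDO where
  add_assoc A B C := PDO.ext (funext fun i => add_assoc _ _ _)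
  zero_add A := PDO.ext (funext fun i => zero_add _)
  add_zero A := PDO.ext (funext fun i => add_zero _)
  nsmul := nsmulRec
  zsmul := zsmulRec
  sub_eq_add_neg A B := PDO.ext (funext fun i => sub_eq_add_neg _ _)
  neg_add_cancel A := PDO.ext (funext fun i => neg_add_cancel _)
  add_comm A B := PDO.ext (funext fun i => add_comm _ _)

/-- The coefficient of `∂^i` as an additive map. -/
def coeffHom (i : ℤ) : PDO →+ TimeField where
  toFun A := A.coeff i
  map_zero' := rfl
  map_add' _ _ := rfl

@[simp] theorem coeff_sum {ι : Type*} (s : Finset ι) (A : ι → PDO) (i : ℤ) :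
    (∑ k ∈ s, A k).coeff i = ∑ k ∈ s, (A k).coeff i := map_sum (coeffHom i) A s

@[simp] theorem coeff_zsmul (n : ℤ) (A : PDO) (i : ℤ) : (n • A).coeff i = n * A.coeff i := by
  rw [← zsmul_eq_mul]
  exact map_zsmul (coeffHom i) n A

@[simp] theorem coeff_ofFun (f : TimeField) (i : ℤ) :
    (ofFun f).coeff i = if i = 0 then f else 0 := rfl

@[simp] theorem coeff_dPow (n i : ℤ) : (dPow n).coeff i = if i = n then 1 else 0 := rfl

@[simp] theorem coeff_ge (A : PDO) (n i : ℤ) : (A.ge n).coeff i = if n ≤ i then A.coeff i else 0 :=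
  rfl

@[simp] theorem coeff_le (A : PDO) (n i : ℤ) : (A.le n).coeff i = if i ≤ n then A.coeff i else 0 :=
  rfl

@[simp] theorem coeff_timeDeriv (n : ℕ) (A : PDO) (i : ℤ) :
    (A.timeDeriv n).coeff i = dt n (A.coeff i) := rfl

theorem DegLE.add {A B : PDO} {d : ℤ} (hA : A.DegLE d) (hB : B.DegLE d) : (A + B).DegLE d :=
  fun i hi => by rw [coeff_add, hA i hi, hB i hi, add_zero]

theorem DegLE.neg {A : PDO} {d : ℤ} (hA : A.DegLE d) : (-A).DegLE d :=
  fun i hi => by rw [coeff_neg, hA i hi, neg_zero]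

theorem DegLE.sub {A B : PDO} {d : ℤ} (hA : A.DegLE d) (hB : B.DegLE d) : (A - B).DegLE d :=
  fun i hi => by rw [coeff_sub, hA i hi, hB i hi, sub_zero]

theorem degLE_ofFun (f : TimeField) : (ofFun f).DegLE 0 := fun i hi => if_neg (by omega)

theorem degLE_dPow (n : ℤ) : (dPow n).DegLE n := fun i hi => if_neg (by omega)

theorem DegLE.timeDeriv {A : PDO} {d : ℤ} (n : ℕ) (hA : A.DegLE d) : (A.timeDeriv n).DegLE d :=
  fun i hi => by rw [coeff_timeDeriv, hA i hi, dt_zero]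

/-- Downward induction on the coefficients. -/
theorem eq_zero_of_top {A : PDO}
    (h : ∀ m, (∀ j, m < j → A.coeff j = 0) → A.coeff m = 0) : A = 0 := by
  obtain ⟨d, hd⟩ := A.exists_degLE
  have key : ∀ n : ℕ, ∀ j, d - n < j → A.coeff j = 0 := by
    intro n
    induction n with
    | zero => intro j hj; exact hd j (by simpa using hj)
    | succ n ih =>
      intro j hj
      refine h j fun l hl => ih l ?_
      push_cast at hj
      omega
  refine PDO.ext (funext fun m => ?_)
  exact key (d - m + 1).toNat m (by omega)

/-! ### Composition -/

/-- The coefficients of `∂^i B`. -/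
def dl (i : ℤ) (B : PDO) (m : ℤ) : TimeField :=
  ∑ᶠ k : ℕ, ((Ring.choose i k : ℤ) : TimeField) * (dt 0)^[k] (B.coeff (m - i + k))

theorem dl_eq_sum {B : PDO} {d : ℤ} (hB : B.DegLE d) (i m : ℤ) {M : ℕ} (hM : d < m - i + M) :
    dl i B m = ∑ k ∈ Finset.range M,
      ((Ring.choose i k : ℤ) : TimeField) * (dt 0)^[k] (B.coeff (m - i + k)) := by
  refine finsum_eq_sum_of_support_subset _ fun k hk => ?_
  simp only [Finset.coe_range, Set.mem_Iio]
  by_contra hlt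
  exact hk (by dsimp only; rw [hB _ (by omega), dt_iterate_zero, mul_zero])

theorem dl_eq_zero {B : PDO} {d : ℤ} (hB : B.DegLE d) {i m : ℤ} (h : d + i < m) : dl i B m = 0 := by
  rw [dl_eq_sum hB i m (M := 0) (by push_cast; omega), Finset.sum_range_zero]

theorem dl_add (i : ℤ) (B C : PDO) (m : ℤ) : dl i (B + C) m = dl i B m + dl i C m := by
  obtain ⟨d, hd⟩ := B.exists_degLE
  obtain ⟨e, he⟩ := C.exists_degLE
  have hd' := hd.mono (le_max_left d e)
  have he' := he.mono (le_max_right d e)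
  obtain ⟨M, hM⟩ : ∃ M : ℕ, max d e < m - i + M := ⟨(max d e - m + i + 1).toNat, by omega⟩
  rw [dl_eq_sum hd' i m hM, dl_eq_sum he' i m hM, dl_eq_sum (hd'.add he') i m hM,
    ← Finset.sum_add_distrib]
  refine Finset.sum_congr rfl fun k _ => ?_
  rw [coeff_add, dt_iterate_add, mul_add]

theorem dl_zero (B : PDO) (m : ℤ) : dl 0 B m = B.coeff m := by
  rw [dl, finsum_eq_single _ 0]
  · simp
  · intro k hk
    rw [Ring.choose_zero_pos _ (Nat.pos_of_ne_zero hk)]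
    simp

/-- ∂^{i+1}B = ∂(∂^iB) is Pascal's rule for generalized binomial coefficients, valid also for
negative i. -/
theorem dl_succ (i : ℤ) (B : PDO) (m : ℤ) :
    dl (i + 1) B m = dt 0 (dl i B m) + dl i B (m - 1) := by
  obtain ⟨d, hd⟩ := B.exists_degLE
  obtain ⟨M, hM⟩ : ∃ M : ℕ, d < m - 1 - i + M := ⟨(d - m + 1 + i + 1).toNat, by omega⟩
  rw [dl_eq_sum hd (i + 1) m (M := M + 1) (by push_cast; omega),
    dl_eq_sum hd i m (M := M) (by omega),
    dl_eq_sum hd i (m - 1) (M := M + 1) (by push_cast; omega), Finset.sum_range_succ',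
    Finset.sum_range_succ', ← add_assoc, dt_sum, ← Finset.sum_add_distrib]
  congr 1
  · refine Finset.sum_congr rfl fun k _ => ?_
    rw [dt_intCast_mul, ← Function.iterate_succ_apply' (dt 0), Ring.choose_succ_succ,
      show m - (i + 1) + ((k + 1 : ℕ) : ℤ) = m - i + k by push_cast; ring,
      show m - 1 - i + ((k + 1 : ℕ) : ℤ) = m - i + k by push_cast; ring]
    push_cast
    ring
  · rw [Ring.choose_zero_right, Ring.choose_zero_right, show m - (i + 1) = m - 1 - i by ring]

theorem dt_dl (n : ℕ) (i : ℤ) (B : PDO) (m : ℤ) : dt n (dl i B m) = dl i (B.timeDeriv n) m := by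
  obtain ⟨d, hd⟩ := B.exists_degLE
  obtain ⟨M, hM⟩ : ∃ M : ℕ, d < m - i + M := ⟨(d - m + i + 1).toNat, by omega⟩
  rw [dl_eq_sum hd i m hM, dl_eq_sum (hd.timeDeriv n) i m hM, dt_sum]
  refine Finset.sum_congr rfl fun k _ => ?_
  rw [dt_intCast_mul, dt_dt_iterate, coeff_timeDeriv]

theorem mul_hasFiniteSupport {A B : PDO} {d e : ℤ} (hA : A.DegLE d) (hB : B.DegLE e) (m : ℤ) :
    Function.HasFiniteSupport fun i => A.coeff i * dl i B m := by
  refine (Set.finite_Icc (m - e) d).subset fun i hi => ?_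
  rw [Function.mem_support] at hi
  have h1 : i ≤ d := not_lt.mp fun h => hi (by rw [hA i h, zero_mul])
  have h2 : m ≤ e + i := not_lt.mp fun h => hi (by rw [dl_eq_zero hB h, mul_zero])
  simp only [Set.mem_Icc]
  omega

/-- The bounds on the orders of A and B make the double sum finite, so it may be summed row by row.
-/
theorem coeff_mul (A B : PDO) (m : ℤ) : (A * B).coeff m = ∑ᶠ i : ℤ, A.coeff i * dl i B m := by
  obtain ⟨d, hd⟩ := A.exists_degLE
  obtain ⟨e, he⟩ := B.exists_degLE
  have h : (A * B).coeff m = ∑ᶠ p : ℤ × ℕ, ((Ring.choose p.1 p.2 : ℤ) : TimeField) *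
      A.coeff p.1 * (dt 0)^[p.2] (B.coeff (m - p.1 + p.2)) := rfl
  rw [h, finsum_curry]
  · refine finsum_congr fun i => ?_
    rw [dl, mul_finsum]
    refine finsum_congr fun k => ?_
    ring
  · refine ((Set.finite_Icc (m - e) d).prod (Set.finite_Iic (e - m + d).toNat)).subset fun p hp => ?_
    rw [Function.mem_support] at hp
    have h1 : p.1 ≤ d := not_lt.mp fun h => hp (by rw [hd _ h]; simp)
    have h2 : m - p.1 + p.2 ≤ e := not_lt.mp fun h => hp (by rw [he _ h, dt_iterate_zero, mul_zero])
    simp only [Set.mem_prod, Set.mem_Icc, Set.mem_Iic]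
    omega

theorem DegLE.mul {A B : PDO} {d e : ℤ} (hA : A.DegLE d) (hB : B.DegLE e) :
    (A * B).DegLE (d + e) := by
  intro m hm
  rw [coeff_mul, ← finsum_zero (α := ℤ)]
  refine finsum_congr fun i => ?_
  by_cases h : d < i
  · rw [hA i h, zero_mul]
  · rw [dl_eq_zero hB (by omega), mul_zero]

theorem mul_add' (A B C : PDO) : A * (B + C) = A * B + A * C := by
  obtain ⟨d, hd⟩ := A.exists_degLE
  obtain ⟨e, he⟩ := B.exists_degLE
  obtain ⟨e', he'⟩ := C.exists_degLE
  refine PDO.ext (funext fun m => ?_)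
  rw [coeff_add, coeff_mul, coeff_mul, coeff_mul,
    ← finsum_add_distrib (mul_hasFiniteSupport hd he m) (mul_hasFiniteSupport hd he' m)]
  exact finsum_congr fun i => by rw [dl_add, mul_add]

theorem add_mul' (A B C : PDO) : (A + B) * C = A * C + B * C := by
  obtain ⟨d, hd⟩ := A.exists_degLE
  obtain ⟨e, he⟩ := B.exists_degLE
  obtain ⟨e', he'⟩ := C.exists_degLE
  refine PDO.ext (funext fun m => ?_)
  rw [coeff_add, coeff_mul, coeff_mul, coeff_mul,
    ← finsum_add_distrib (mul_hasFiniteSupport hd he' m) (mul_hasFiniteSupport he he' m)]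
  exact finsum_congr fun i => by rw [coeff_add, add_mul]

theorem coeff_ofFun_mul (f : TimeField) (B : PDO) (m : ℤ) :
    (ofFun f * B).coeff m = f * B.coeff m := by
  rw [coeff_mul, finsum_eq_single _ 0]
  · rw [coeff_ofFun, if_pos rfl, dl_zero]
  · intro i hi
    rw [coeff_ofFun, if_neg hi, zero_mul]

theorem coeff_dPow_mul (n : ℤ) (B : PDO) (m : ℤ) : (dPow n * B).coeff m = dl n B m := by
  rw [coeff_mul, finsum_eq_single _ n]
  · rw [coeff_dPow, if_pos rfl, one_mul]
  · intro i hi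
    rw [coeff_dPow, if_neg hi, zero_mul]

theorem coeff_dPow_one_mul (B : PDO) (m : ℤ) :
    (dPow 1 * B).coeff m = dt 0 (B.coeff m) + B.coeff (m - 1) := by
  have h := dl_succ 0 B m
  rw [zero_add, dl_zero, dl_zero] at h
  rw [coeff_dPow_mul, h]

theorem coeff_mul_ofFun_const {c : TimeField} (hc : dt 0 c = 0) (A : PDO) (m : ℤ) :
    (A * ofFun c).coeff m = A.coeff m * c := by
  have h : ∀ i, dl i (ofFun c) m = if i = m then c else 0 := by
    intro i
    rw [dl, finsum_eq_single _ 0]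
    · simp only [Ring.choose_zero_right, coeff_ofFun, Function.iterate_zero, id]
      by_cases hi : i = m
      · rw [if_pos hi, if_pos (by simp [hi])]
        simp
      · rw [if_neg hi, if_neg (by simp; omega), mul_zero]
    · intro k hk
      rw [coeff_ofFun]
      split_ifs
      · rw [dt_iterate_of_dt_eq_zero hc hk, mul_zero]
      · rw [dt_iterate_zero, mul_zero]
  rw [coeff_mul, finsum_eq_single _ m]
  · rw [h, if_pos rfl]
  · intro i hi
    rw [h, if_neg hi, mul_zero]

theorem coeff_mul_dPow (A : PDO) (n m : ℤ) : (A * dPow n).coeff m = A.coeff (m - n) := by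
  have h : ∀ i, dl i (dPow n) m = if i = m - n then 1 else 0 := by
    intro i
    rw [dl, finsum_eq_single _ 0]
    · simp only [Ring.choose_zero_right, coeff_dPow, Function.iterate_zero, id]
      by_cases hi : i = m - n
      · rw [if_pos hi, if_pos (by simp [hi])]
        simp
      · rw [if_neg hi, if_neg (by simp; omega), mul_zero]
    · intro k hk
      rw [coeff_dPow]
      split_ifs
      · rw [dt_iterate_of_dt_eq_zero (dt_one 0) hk, mul_zero]
      · rw [dt_iterate_zero, mul_zero]
  rw [coeff_mul, finsum_eq_single _ (m - n)]
  · rw [h, if_pos rfl, mul_one]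
  · intro i hi
    rw [h, if_neg hi, mul_zero]

/-- An additive functional which only depends on finitely many leading coefficients is determined by
its values at the operators `f ∂^i`. -/
theorem hom_eq_zero (F : PDO →+ TimeField) (c : ℤ) (hF : ∀ A : PDO, A.DegLE c → F A = 0)
    (h : ∀ f i, F (ofFun f * dPow i) = 0) (A : PDO) : F A = 0 := by
  obtain ⟨d, hd⟩ := A.exists_degLE
  have hA : A = A.le c + ∑ i ∈ Finset.Ioc c d, ofFun (A.coeff i) * dPow i := by
    refine PDO.ext (funext fun m => ?_)
    simp only [coeff_add, coeff_le, coeff_sum, coeff_ofFun_mul, coeff_dPow, mul_ite, mul_one,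
      mul_zero, Finset.sum_ite_eq, Finset.mem_Ioc]
    by_cases h1 : m ≤ c
    · rw [if_pos h1, if_neg (by omega), add_zero]
    · rw [if_neg h1, zero_add]
      by_cases h2 : m ≤ d
      · rw [if_pos (by omega)]
      · rw [if_neg (by omega), hd m (by omega)]
  rw [hA, map_add, hF _ fun i hi => if_neg (by omega), zero_add, map_sum]
  exact Finset.sum_eq_zero fun i _ => h _ _

/-- The operator version of `hom_eq_zero`. -/
theorem hom_eq_zero' (F : PDO →+ PDO) (c : ℤ) (hF : ∀ d, ∀ A : PDO, A.DegLE d → (F A).DegLE (d + c))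
    (h : ∀ f i, F (ofFun f * dPow i) = 0) (A : PDO) : F A = 0 := by
  refine PDO.ext (funext fun m => ?_)
  refine hom_eq_zero ((coeffHom m).comp F) (m - c - 1) (fun A hA => ?_) (fun f i => ?_) A
  · exact hF _ A hA m (by omega)
  · rw [AddMonoidHom.comp_apply, h]
    rfl

theorem ofFun_mul_assoc (f : TimeField) (B C : PDO) :
    (ofFun f * B) * C = ofFun f * (B * C) := by
  refine PDO.ext (funext fun m => ?_)
  rw [coeff_ofFun_mul, coeff_mul, coeff_mul, mul_finsum]
  refine finsum_congr fun i => ?_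
  rw [coeff_ofFun_mul, mul_assoc]

theorem dPow_one_mul_assoc (B C : PDO) : (dPow 1 * B) * C = dPow 1 * (B * C) := by
  obtain ⟨d, hd⟩ := B.exists_degLE
  obtain ⟨e, he⟩ := C.exists_degLE
  refine PDO.ext (funext fun m => ?_)
  have f1 := mul_hasFiniteSupport hd he m
  have f2 := mul_hasFiniteSupport hd he (m - 1)
  have f3 := mul_hasFiniteSupport (hd.timeDeriv 0) he m
  have f4 : Function.HasFiniteSupport fun i => B.coeff i * dl (i + 1) C m := by
    refine (Set.finite_Icc (m - e - 1) d).subset fun i hi => ?_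
    rw [Function.mem_support] at hi
    have h1 : i ≤ d := not_lt.mp fun h => hi (by rw [hd i h, zero_mul])
    have h2 : m ≤ e + (i + 1) := not_lt.mp fun h => hi (by rw [dl_eq_zero he h, mul_zero])
    simp only [Set.mem_Icc]
    omega
  have f5 : Function.HasFiniteSupport fun i => B.coeff (i - 1) * dl i C m := by
    refine (f4.image fun i => i + 1).subset fun i hi => ⟨i - 1, ?_, by ring⟩
    rw [Function.mem_support] at hi ⊢
    rwa [sub_add_cancel]
  have f6 : Function.HasFiniteSupport fun i => dt 0 (B.coeff i * dl i C m) := by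
    refine f1.subset fun i hi => ?_
    rw [Function.mem_support] at hi ⊢
    exact fun h => hi (by rw [h, dt_zero])
  rw [coeff_dPow_one_mul, coeff_mul, coeff_mul, coeff_mul, dt_finsum 0 f1,
    ← finsum_add_distrib f6 f2]
  have h1 : ∀ i, (dPow 1 * B).coeff i * dl i C m =
      (B.timeDeriv 0).coeff i * dl i C m + B.coeff (i - 1) * dl i C m := by
    intro i
    rw [coeff_dPow_one_mul, add_mul, coeff_timeDeriv]
  rw [finsum_congr h1, finsum_add_distrib f3 f5, ← finsum_comp_equiv (Equiv.addRight (1 : ℤ))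
    (f := fun i => B.coeff (i - 1) * dl i C m)]
  simp only [Equiv.coe_addRight, add_sub_cancel_right]
  rw [← finsum_add_distrib f3 f4]
  refine finsum_congr fun i => ?_
  rw [dl_succ, dt_mul, coeff_timeDeriv]
  ring

theorem dPow_succ_mul (i : ℤ) (B : PDO) : dPow (i + 1) * B = dPow 1 * (dPow i * B) := by
  refine PDO.ext (funext fun m => ?_)
  rw [coeff_dPow_one_mul, coeff_dPow_mul, coeff_dPow_mul, coeff_dPow_mul, dl_succ]

theorem dPow_one_mul_eq_zero {B : PDO} (h : dPow 1 * B = 0) : B = 0 := by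
  refine eq_zero_of_top fun m hm => ?_
  have h1 := congrArg (fun A : PDO => A.coeff (m + 1)) h
  simp only [coeff_dPow_one_mul, add_sub_cancel_right] at h1
  rwa [hm (m + 1) (by omega), dt_zero, zero_add] at h1

theorem dPow_one_mul_cancel {B C : PDO} (h : dPow 1 * B = dPow 1 * C) : B = C := by
  rw [← sub_eq_zero]
  refine dPow_one_mul_eq_zero ?_
  have h1 := mul_add' (dPow 1) (B - C) C
  rw [sub_add_cancel, h] at h1
  simpa using h1

/-- Non-negative powers follow from ∂ by iteration; negative ones by applying ∂, which is left
cancellable because it preserves leading coefficients. -/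
theorem dPow_mul_assoc (i : ℤ) (B C : PDO) : (dPow i * B) * C = dPow i * (B * C) := by
  have h0 : ∀ A : PDO, dPow 0 * A = A := fun A =>
    PDO.ext (funext fun m => by rw [coeff_dPow_mul, dl_zero])
  induction i using Int.induction_on with
  | zero => rw [h0, h0]
  | succ i ih => rw [dPow_succ_mul, dPow_one_mul_assoc, ih, ← dPow_succ_mul]
  | pred i ih =>
    refine dPow_one_mul_cancel ?_
    rw [← dPow_one_mul_assoc, ← dPow_succ_mul, ← dPow_succ_mul, sub_add_cancel, ih]

/-- The associator is additive in A and shifts orders by a bounded amount, so it suffices to take A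
= f∂^i. -/
theorem mul_assoc' (A B C : PDO) : (A * B) * C = A * (B * C) := by
  obtain ⟨d, hd⟩ := B.exists_degLE
  obtain ⟨e, he⟩ := C.exists_degLE
  let F : PDO →+ PDO :=
    { toFun := fun A => (A * B) * C - A * (B * C)
      map_zero' := by
        have h : ∀ X : PDO, (0 : PDO) * X = 0 := fun X => by
          have := add_mul' 0 0 X
          rw [add_zero] at this
          simpa using this
        rw [h, h, h, sub_zero]
      map_add' := fun A A' => by
        rw [add_mul', add_mul', add_mul']
        abel }
  have h := hom_eq_zero' F (d + e) (fun n A hA => ?_) (fun f i => ?_) A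
  · exact sub_eq_zero.mp h
  · refine DegLE.sub ?_ (hA.mul (hd.mul he))
    rw [← add_assoc]
    exact (hA.mul hd).mul he
  · change (ofFun f * dPow i * B) * C - (ofFun f * dPow i) * (B * C) = 0
    rw [ofFun_mul_assoc, ofFun_mul_assoc, dPow_mul_assoc, ofFun_mul_assoc, sub_self]

/-! ### The ring of pseudo-differential operators and its commutation rules -/

instance : Ring PDO where
  mul_assoc := mul_assoc'
  left_distrib := mul_add'
  right_distrib := add_mul'
  zero_mul A := by
    have := add_mul' 0 0 A
    rw [add_zero] at this
    simpa using this
  mul_zero A := by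
    have := mul_add' A 0 0
    rw [add_zero] at this
    simpa using this
  one_mul A := PDO.ext (funext fun m => by
    change (ofFun 1 * A).coeff m = _
    rw [coeff_ofFun_mul, one_mul])
  mul_one A := PDO.ext (funext fun m => by
    change (A * ofFun 1).coeff m = _
    rw [coeff_mul_ofFun_const (dt_one 0), mul_one])
  -- Agrees by definition with the powers introduced on `PDO` before.
  npow n A := npowRec n A
  neg_add_cancel := neg_add_cancel
  zsmul := zsmulRec
  sub_eq_add_neg := sub_eq_add_neg

theorem one_def : (1 : PDO) = ofFun 1 := rfl

@[simp] theorem coeff_one (i : ℤ) : (1 : PDO).coeff i = if i = 0 then 1 else 0 := rfl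

theorem ofFun_mul_ofFun (f g : TimeField) : ofFun f * ofFun g = ofFun (f * g) := by
  refine PDO.ext (funext fun m => ?_)
  rw [coeff_ofFun_mul, coeff_ofFun, coeff_ofFun, mul_ite, mul_zero]

theorem ofFun_mul_inv {f : TimeField} (hf : f ≠ 0) : ofFun f * ofFun f⁻¹ = 1 := by
  rw [ofFun_mul_ofFun, mul_inv_cancel₀ hf, one_def]

theorem ofFun_inv_mul {f : TimeField} (hf : f ≠ 0) : ofFun f⁻¹ * ofFun f = 1 := by
  rw [ofFun_mul_ofFun, inv_mul_cancel₀ hf, one_def]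

theorem dPow_zero : dPow 0 = 1 := by
  refine PDO.ext (funext fun m => ?_)
  rw [coeff_dPow, coeff_one]

theorem dPow_mul_dPow (i j : ℤ) : dPow i * dPow j = dPow (i + j) := by
  refine PDO.ext (funext fun m => ?_)
  rw [coeff_mul_dPow, coeff_dPow, coeff_dPow]
  congr 1
  rw [sub_eq_iff_eq_add]

theorem dPow_one_mul_ofFun (f : TimeField) :
    dPow 1 * ofFun f = ofFun (dt 0 f) + ofFun f * dPow 1 := by
  refine PDO.ext (funext fun m => ?_)
  rw [coeff_dPow_one_mul, coeff_add, coeff_ofFun_mul]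
  simp only [coeff_ofFun, coeff_dPow]
  by_cases h0 : m = 0
  · subst h0
    simp
  · by_cases h1 : m = 1
    · subst h1
      simp [dt_zero]
    · rw [if_neg h0, if_neg (by omega), if_neg h0, if_neg h1, dt_zero]
      simp

theorem mul_ofFun_const_comm {c : TimeField} (hc : dt 0 c = 0) (A : PDO) :
    A * ofFun c = ofFun c * A := by
  refine PDO.ext (funext fun m => ?_)
  rw [coeff_mul_ofFun_const hc, coeff_ofFun_mul, mul_comm]

theorem timeDeriv_mul (n : ℕ) (A B : PDO) :
    (A * B).timeDeriv n = A.timeDeriv n * B + A * B.timeDeriv n := by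
  obtain ⟨d, hd⟩ := A.exists_degLE
  obtain ⟨e, he⟩ := B.exists_degLE
  refine PDO.ext (funext fun m => ?_)
  rw [coeff_timeDeriv, coeff_add, coeff_mul, coeff_mul, coeff_mul,
    dt_finsum n (mul_hasFiniteSupport hd he m), ← finsum_add_distrib
      (mul_hasFiniteSupport (hd.timeDeriv n) he m) (mul_hasFiniteSupport hd (he.timeDeriv n) m)]
  refine finsum_congr fun i => ?_
  rw [dt_mul, dt_dl, coeff_timeDeriv]

theorem timeDeriv_ofFun (n : ℕ) (f : TimeField) : (ofFun f).timeDeriv n = ofFun (dt n f) := by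
  refine PDO.ext (funext fun m => ?_)
  simp only [coeff_timeDeriv, coeff_ofFun]
  split_ifs
  · rfl
  · exact dt_zero n

theorem timeDeriv_dPow (n : ℕ) (i : ℤ) : (dPow i).timeDeriv n = 0 := by
  refine PDO.ext (funext fun m => ?_)
  simp only [coeff_timeDeriv, coeff_dPow, coeff_zero]
  split_ifs
  · exact dt_one n
  · exact dt_zero n

/-! ### The formal adjoint -/

theorem adjoint_hasFiniteSupport {A : PDO} {d : ℤ} (hA : A.DegLE d) (m : ℤ) :
    Function.HasFiniteSupport fun k : ℕ => (-1 : TimeField) ^ (m + k) *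
      ((Ring.choose (m + k) k : ℤ) : TimeField) * (dt 0)^[k] (A.coeff (m + k)) := by
  refine (Set.finite_Iic (d - m).toNat).subset fun k hk => ?_
  rw [Function.mem_support] at hk
  have h : m + k ≤ d := not_lt.mp fun h => hk (by rw [hA _ h, dt_iterate_zero, mul_zero])
  simp only [Set.mem_Iic]
  omega

theorem coeff_adjoint (A : PDO) (m : ℤ) : A.adjoint.coeff m = ∑ᶠ k : ℕ, (-1 : TimeField) ^ (m + k) *
    ((Ring.choose (m + k) k : ℤ) : TimeField) * (dt 0)^[k] (A.coeff (m + k)) := rfl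

theorem adjoint_add (A B : PDO) : (A + B).adjoint = A.adjoint + B.adjoint := by
  obtain ⟨d, hd⟩ := A.exists_degLE
  obtain ⟨e, he⟩ := B.exists_degLE
  refine PDO.ext (funext fun m => ?_)
  rw [coeff_add, coeff_adjoint, coeff_adjoint, coeff_adjoint, ← finsum_add_distrib
    (adjoint_hasFiniteSupport hd m) (adjoint_hasFiniteSupport he m)]
  refine finsum_congr fun k => ?_
  rw [coeff_add, dt_iterate_add, mul_add]

theorem adjoint_zero : (0 : PDO).adjoint = 0 := by
  have := adjoint_add 0 0
  rw [add_zero] at this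
  simpa using this

/-- The formal adjoint as an additive map. -/
def adjointHom : PDO →+ PDO where
  toFun := adjoint
  map_zero' := adjoint_zero
  map_add' := adjoint_add

theorem DegLE.adjoint {A : PDO} {d : ℤ} (hA : A.DegLE d) : A.adjoint.DegLE d := by
  intro m hm
  rw [coeff_adjoint, ← finsum_zero (M := TimeField) (α := ℕ)]
  refine finsum_congr fun k => ?_
  rw [hA _ (by omega), dt_iterate_zero, mul_zero]

theorem adjoint_ofFun_mul_dPow (f : TimeField) (i : ℤ) :
    (ofFun f * dPow i).adjoint = (i.negOnePow : ℤ) • (dPow i * ofFun f) := by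
  refine PDO.ext (funext fun m => ?_)
  rw [coeff_zsmul, coeff_dPow_mul, dl, coeff_adjoint, mul_finsum]
  refine finsum_congr fun k => ?_
  rw [coeff_ofFun_mul, coeff_dPow, coeff_ofFun]
  by_cases h : m + k = i
  · rw [if_pos h, if_pos (by omega), h, mul_one, Int.cast_negOnePow]
    ring
  · rw [if_neg h, if_neg (by omega), mul_zero, dt_iterate_zero, mul_zero, mul_zero, mul_zero]

theorem adjoint_ofFun (f : TimeField) : (ofFun f).adjoint = ofFun f := by
  have h := adjoint_ofFun_mul_dPow f 0
  simpa [dPow_zero] using h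

theorem adjoint_dPow (i : ℤ) : (dPow i).adjoint = (i.negOnePow : ℤ) • dPow i := by
  have h := adjoint_ofFun_mul_dPow 1 i
  rwa [← one_def, one_mul, mul_one] at h

theorem adjoint_ofFun_mul (f : TimeField) (B : PDO) :
    (ofFun f * B).adjoint = B.adjoint * ofFun f := by
  rw [← sub_eq_zero]
  refine hom_eq_zero' (adjointHom.comp (AddMonoidHom.mulLeft (ofFun f)) -
    (AddMonoidHom.mulRight (ofFun f)).comp adjointHom) 0 (fun d A hA => ?_) (fun g j => ?_) B
  · refine DegLE.sub ?_ ?_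
    · have := ((degLE_ofFun f).mul hA).adjoint
      rwa [add_comm] at this
    · exact hA.adjoint.mul (degLE_ofFun f)
  · change (ofFun f * (ofFun g * dPow j)).adjoint - (ofFun g * dPow j).adjoint * ofFun f = 0
    rw [← mul_assoc, ofFun_mul_ofFun, adjoint_ofFun_mul_dPow, adjoint_ofFun_mul_dPow,
      smul_mul_assoc, mul_assoc, ofFun_mul_ofFun, mul_comm g, sub_self]

theorem adjoint_dPow_one_mul (B : PDO) : (dPow 1 * B).adjoint = -(B.adjoint * dPow 1) := by
  rw [← sub_eq_zero]
  refine hom_eq_zero' (adjointHom.comp (AddMonoidHom.mulLeft (dPow 1)) -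
    -(AddMonoidHom.mulRight (dPow 1)).comp adjointHom) 1 (fun d A hA => ?_) (fun g j => ?_) B
  · refine DegLE.sub ?_ (DegLE.neg ?_)
    · have := ((degLE_dPow 1).mul hA).adjoint
      rwa [add_comm] at this
    · exact hA.adjoint.mul (degLE_dPow 1)
  · change (dPow 1 * (ofFun g * dPow j)).adjoint - -((ofFun g * dPow j).adjoint * dPow 1) = 0
    rw [← mul_assoc, dPow_one_mul_ofFun, add_mul, mul_assoc, dPow_mul_dPow, adjoint_add,
      adjoint_ofFun_mul_dPow, adjoint_ofFun_mul_dPow, adjoint_ofFun_mul_dPow, add_comm 1 j,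
      ← dPow_mul_dPow j 1, mul_assoc, dPow_one_mul_ofFun, Int.negOnePow_succ, smul_mul_assoc,
      mul_assoc (dPow j)]
    simp only [mul_add, smul_add, Units.val_neg, neg_smul]
    abel

theorem adjoint_dPow_mul (i : ℤ) (B : PDO) :
    (dPow i * B).adjoint = (i.negOnePow : ℤ) • (B.adjoint * dPow i) := by
  induction i using Int.induction_on with
  | zero => simp [dPow_zero]
  | succ i ih =>
    rw [dPow_succ_mul, adjoint_dPow_one_mul, ih, Int.negOnePow_succ, smul_mul_assoc, mul_assoc,
      dPow_mul_dPow, Units.val_neg, neg_smul]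
  | pred i ih =>
    have h : -((dPow (-i - 1) * B).adjoint * dPow 1) =
        ((-i : ℤ).negOnePow : ℤ) • (B.adjoint * dPow (-i)) := by
      rw [← adjoint_dPow_one_mul, ← dPow_succ_mul, sub_add_cancel, ih]
    have h1 := congrArg (· * dPow (-1)) h
    simp only [neg_mul, mul_assoc, dPow_mul_dPow, smul_mul_assoc] at h1
    rw [show (1 : ℤ) + -1 = 0 by ring, dPow_zero, mul_one] at h1
    rw [← neg_eq_iff_eq_neg.mpr h1.symm, Int.negOnePow_sub]
    simp [sub_eq_add_neg]

/-- Both sides are additive in A with bounded order shift, so A = f∂^i suffices, and there left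
multiplication by f and by ∂^i are treated separately. -/
theorem adjoint_mul (A B : PDO) : (A * B).adjoint = B.adjoint * A.adjoint := by
  obtain ⟨e, he⟩ := B.exists_degLE
  rw [← sub_eq_zero]
  refine hom_eq_zero' (adjointHom.comp (AddMonoidHom.mulRight B) -
    (AddMonoidHom.mulLeft B.adjoint).comp adjointHom) e (fun d A hA => ?_) (fun g j => ?_) A
  · refine DegLE.sub (hA.mul he).adjoint ?_
    rw [add_comm]
    exact he.adjoint.mul hA.adjoint
  · change (ofFun g * dPow j * B).adjoint - B.adjoint * (ofFun g * dPow j).adjoint = 0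
    rw [mul_assoc, adjoint_ofFun_mul, adjoint_dPow_mul, adjoint_ofFun_mul_dPow, smul_mul_assoc,
      mul_smul_comm, mul_assoc, sub_self]

theorem coeff_dPow_mul_ofFun (n : ℤ) (g : TimeField) :
    (dPow n * ofFun g).coeff (-1) = if n = -1 then g else 0 := by
  rw [coeff_dPow_mul, dl]
  by_cases hn : n = -1
  · subst hn
    rw [if_pos rfl, finsum_eq_single _ 0]
    · simp
    · intro k hk
      rw [coeff_ofFun, if_neg (by omega), dt_iterate_zero, mul_zero]
  · rw [if_neg hn, ← finsum_zero (M := TimeField) (α := ℕ)]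
    refine finsum_congr fun k => ?_
    by_cases hk : -1 - n + k = 0
    -- Only k = n + 1 could contribute, with binomial coefficient C(n, n+1) = 0 as n ≥ 0: a
    -- differential operator has no residue.
    · have hn' : n = ((k - 1 : ℕ) : ℤ) := by omega
      rw [hn', Ring.choose_natCast, Nat.choose_eq_zero_of_lt (by omega)]
      simp
    · rw [coeff_ofFun, if_neg hk, dt_iterate_zero, mul_zero]

theorem coeff_dPow_mul_adjoint (i : ℤ) (B : PDO) :
    (dPow i * B.adjoint).coeff (-1) = (-1) ^ (-1 - i) * B.coeff (-1 - i) := by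
  rw [← sub_eq_zero]
  refine hom_eq_zero (((coeffHom (-1)).comp ((AddMonoidHom.mulLeft (dPow i)).comp adjointHom)) -
    (AddMonoidHom.mulLeft ((-1 : TimeField) ^ (-1 - i))).comp (coeffHom (-1 - i))) (-2 - i)
    (fun A hA => ?_) (fun g j => ?_) B
  · change (dPow i * A.adjoint).coeff (-1) - (-1) ^ (-1 - i) * A.coeff (-1 - i) = 0
    rw [hA _ (by omega), ((degLE_dPow i).mul hA.adjoint) _ (by omega), mul_zero, sub_zero]
  · change (dPow i * (ofFun g * dPow j).adjoint).coeff (-1) -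
      (-1) ^ (-1 - i) * (ofFun g * dPow j).coeff (-1 - i) = 0
    rw [adjoint_ofFun_mul_dPow, mul_smul_comm, ← mul_assoc, dPow_mul_dPow, coeff_zsmul,
      coeff_dPow_mul_ofFun, coeff_ofFun_mul, coeff_dPow, Int.cast_negOnePow]
    by_cases h : i + j = -1
    · rw [if_pos h, if_pos (by omega), show -1 - i = j by omega, mul_one, sub_self]
    · rw [if_neg h, if_neg (by omega)]
      simp

/-- `Res_z A(e^{xz}) B(e^{-xz}) = Res_∂ A B^*`. -/
theorem coeff_mul_adjoint (A B : PDO) :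
    (A * B.adjoint).coeff (-1) = ∑ᶠ i : ℤ, A.coeff i * ((-1) ^ (-1 - i) * B.coeff (-1 - i)) := by
  rw [coeff_mul]
  refine finsum_congr fun i => ?_
  rw [← coeff_dPow_mul_adjoint, coeff_dPow_mul]

/-! ### Top coefficients and differential operators -/

theorem dl_top {B : PDO} {e : ℤ} (hB : B.DegLE e) (d : ℤ) : dl d B (d + e) = B.coeff e := by
  rw [dl, finsum_eq_single _ 0]
  · simp
  · intro k hk
    rw [hB _ (by omega), dt_iterate_zero, mul_zero]

theorem coeff_mul_top {A B : PDO} {d e : ℤ} (hA : A.DegLE d) (hB : B.DegLE e) :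
    (A * B).coeff (d + e) = A.coeff d * B.coeff e := by
  rw [coeff_mul, finsum_eq_single _ d, dl_top hB]
  intro i hi
  rcases lt_or_gt_of_ne hi with h | h
  · rw [dl_eq_zero hB (by omega), mul_zero]
  · rw [hA i h, zero_mul]

theorem coeff_zero_adjoint {A : PDO} (hA : A.DegLE 0) : A.adjoint.coeff 0 = A.coeff 0 := by
  rw [coeff_adjoint, finsum_eq_single _ 0]
  · simp
  · intro k hk
    rw [hA _ (by omega), dt_iterate_zero, mul_zero]

theorem eq_zero_of_mul_eq_zero {A B : PDO} (hA : A.DegLE 0) (h0 : A.coeff 0 ≠ 0) (h : A * B = 0) :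
    B = 0 := by
  refine eq_zero_of_top fun m hm => ?_
  have h1 := coeff_mul_top hA (show B.DegLE m from hm)
  rw [h, coeff_zero] at h1
  exact (mul_eq_zero.mp h1.symm).resolve_left h0

/-- A(BA - 1) = 0, and A is left cancellable by its non-zero leading coefficient. -/
theorem mul_eq_one_symm {A B : PDO} (hA : A.DegLE 0) (h0 : A.coeff 0 ≠ 0) (h : A * B = 1) :
    B * A = 1 := by
  rw [← sub_eq_zero]
  refine eq_zero_of_mul_eq_zero hA h0 ?_
  rw [mul_sub, ← mul_assoc, h, one_mul, mul_one, sub_self]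

theorem timeDeriv_one (n : ℕ) : (1 : PDO).timeDeriv n = 0 := by
  rw [one_def, timeDeriv_ofFun, dt_one]
  exact PDO.ext (funext fun i => ite_self _)

theorem dPow_one_mul_eq (A : PDO) : dPow 1 * A = A.timeDeriv 0 + A * dPow 1 := by
  refine PDO.ext (funext fun m => ?_)
  rw [coeff_dPow_one_mul, coeff_add, coeff_timeDeriv, coeff_mul_dPow]

/-! ### Lower bounds on orders, and residues -/

/-- Only terms `a_i ∂^i` with `i ≥ d` occur. -/
def OrdGE (A : PDO) (d : ℤ) : Prop := ∀ i, i < d → A.coeff i = 0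

theorem OrdGE.mono {A : PDO} {d e : ℤ} (hA : A.OrdGE d) (h : e ≤ d) : A.OrdGE e :=
  fun i hi => hA i (by omega)

theorem OrdGE.add {A B : PDO} {d : ℤ} (hA : A.OrdGE d) (hB : B.OrdGE d) : (A + B).OrdGE d :=
  fun i hi => by rw [coeff_add, hA i hi, hB i hi, add_zero]

theorem OrdGE.sub {A B : PDO} {d : ℤ} (hA : A.OrdGE d) (hB : B.OrdGE d) : (A - B).OrdGE d :=
  fun i hi => by rw [coeff_sub, hA i hi, hB i hi, sub_zero]

theorem OrdGE.sum {ι : Type*} (s : Finset ι) {A : ι → PDO} {d : ℤ} (hA : ∀ k, (A k).OrdGE d) :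
    (∑ k ∈ s, A k).OrdGE d :=
  fun i hi => by rw [coeff_sum, Finset.sum_eq_zero fun k _ => hA k i hi]

theorem OrdGE.timeDeriv {A : PDO} {d : ℤ} (n : ℕ) (hA : A.OrdGE d) : (A.timeDeriv n).OrdGE d :=
  fun i hi => by rw [coeff_timeDeriv, hA i hi, dt_zero]

theorem ordGE_ofFun (f : TimeField) : (ofFun f).OrdGE 0 := fun i hi => if_neg (by omega)

theorem ordGE_dPow (n : ℤ) : (dPow n).OrdGE n := fun i hi => if_neg (by omega)

/-- A differential operator on the left never lowers the order of a term: in ∂^i f∂^j with i ≥ 0 at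
most i derivatives fall on f. -/
theorem OrdGE.mul {A B : PDO} {d : ℤ} (hA : A.OrdGE 0) (hB : B.OrdGE d) : (A * B).OrdGE d := by
  intro m hm
  rw [coeff_mul, ← finsum_zero (M := TimeField) (α := ℤ)]
  refine finsum_congr fun i => ?_
  by_cases hi : i < 0
  · rw [hA i hi, zero_mul]
  · obtain ⟨i, rfl⟩ := Int.eq_ofNat_of_zero_le (not_lt.mp hi)
    refine mul_eq_zero_of_right _ ?_
    rw [dl, ← finsum_zero (M := TimeField) (α := ℕ)]
    refine finsum_congr fun k => ?_
    by_cases hk : i < k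
    · rw [Ring.choose_natCast, Nat.choose_eq_zero_of_lt hk]
      simp
    · rw [hB _ (by omega), dt_iterate_zero, mul_zero]

/-- Res ∂^iX is the coefficient of ∂^{-1-i} plus derivatives of the coefficients between it and ∂^0,
so the system is triangular. -/
theorem eq_one_of_residues {X : PDO} (hX : X.DegLE 0) (h0 : X.coeff 0 = 1)
    (h : ∀ i : ℕ, (dPow i * X).coeff (-1) = 0) : X = 1 := by
  have key : ∀ i : ℕ, X.coeff (-1 - i) = 0 := by
    intro i
    induction i using Nat.strong_induction_on with
    | _ i ih =>
      have h1 := h i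
      rw [coeff_dPow_mul, dl, finsum_eq_single _ 0] at h1
      · simpa using h1
      · intro k hk
        by_cases hki : i < k
        · rw [Ring.choose_natCast, Nat.choose_eq_zero_of_lt hki]
          simp
        · have h2 := ih (i - k) (by omega)
          rw [show (-1 - i + k : ℤ) = -1 - ((i - k : ℕ) : ℤ) by omega, h2, dt_iterate_zero,
            mul_zero]
  refine PDO.ext (funext fun m => ?_)
  rw [one_def, coeff_ofFun]
  split_ifs with hm
  · rw [hm, h0]
  · rcases lt_or_gt_of_ne hm with h' | h'
    · have h2 := key (-1 - m).toNat
      rwa [show (-1 - ((-1 - m).toNat : ℤ)) = m by omega] at h2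
    · exact hX m h'

end PDO

open PDO

/-! ### The operators of a solution of the Riccati system -/

/-- Symmetric solutions of the Riccati system satisfied by the affine coordinates. -/
structure IsRiccati (G : ℕ → ℕ → TimeField) : Prop where
  symm : ∀ i j, G i j = G j i
  dt_eq : ∀ n i j, dt n (G i j) = G (i + (2 * n + 1)) j + G i (j + (2 * n + 1)) +
    ∑ a ∈ Finset.range (2 * n + 1), (-1) ^ a * (G i a * G (2 * n - a) j)

/-- `∂^i + ∑_n (-1)^n G_{in} ∂^{-1-n}`. -/
def waveOp (G : ℕ → ℕ → TimeField) (i : ℕ) : PDO where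
  coeff j := if 0 ≤ j then if j = i then 1 else 0 else (-1) ^ (-1 - j).toNat * G i (-1 - j).toNat
  bdd := ⟨i, fun j hj => by rw [if_pos (by omega), if_neg (by omega)]⟩

theorem coeff_waveOp_natCast (G : ℕ → ℕ → TimeField) (i j : ℕ) :
    (waveOp G i).coeff j = if j = i then 1 else 0 := by
  simp [waveOp]

theorem coeff_waveOp_neg (G : ℕ → ℕ → TimeField) (i n : ℕ) :
    (waveOp G i).coeff (-1 - n) = (-1) ^ n * G i n := by
  have h : ¬ (0 : ℤ) ≤ -1 - n := by omega
  simp only [waveOp, if_neg h]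
  rw [show (-1 - (-1 - (n : ℤ))).toNat = n by omega]

theorem degLE_waveOp (G : ℕ → ℕ → TimeField) (i : ℕ) : (waveOp G i).DegLE i := fun j hj => by
  obtain ⟨j, rfl⟩ := Int.eq_ofNat_of_zero_le (show 0 ≤ j by omega)
  rw [coeff_waveOp_natCast, if_neg (by omega)]

/-- The Riccati system is the negative-order part of this identity; the non-negative part holds by
construction. Thus the span of the W_i over the functions is stable under A ↦ A_{t_{2n+1}} +
A∂^{2n+1}. -/
theorem IsRiccati.timeDeriv_waveOp {G : ℕ → ℕ → TimeField} (hG : IsRiccati G) (n i : ℕ) :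
    (waveOp G i).timeDeriv n + waveOp G i * dPow (2 * n + 1) = waveOp G (i + (2 * n + 1)) +
      ∑ a ∈ Finset.range (2 * n + 1), ofFun ((-1) ^ a * G i a) * waveOp G (2 * n - a) := by
  refine PDO.ext (funext fun m => ?_)
  simp only [coeff_add, coeff_timeDeriv, coeff_mul_dPow, coeff_sum, coeff_ofFun_mul]
  rcases le_or_gt 0 m with hm | hm
  · obtain ⟨k, rfl⟩ := Int.eq_ofNat_of_zero_le hm
    simp only [coeff_waveOp_natCast]
    have h0 : dt n (if k = i then (1 : TimeField) else 0) = 0 := by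
      split_ifs
      · exact dt_one n
      · exact dt_zero n
    rw [h0, zero_add]
    rcases le_or_gt (2 * n + 1) k with hk | hk
    · rw [show ((k : ℤ) - (2 * n + 1)) = ((k - (2 * n + 1) : ℕ) : ℤ) by omega,
        coeff_waveOp_natCast, Finset.sum_eq_zero, add_zero]
      · exact if_congr (by omega) rfl rfl
      · intro a ha
        rw [if_neg (by omega), mul_zero]
    -- The first 2n+1 tail coefficients of W_i are pushed to non-negative order by ∂^{2n+1}; the one
    -- landing on ∂^k is the summand a = 2n - k.
    · rw [show ((k : ℤ) - (2 * n + 1)) = -1 - ((2 * n - k : ℕ) : ℤ) by omega,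
        coeff_waveOp_neg, if_neg (by omega), zero_add, Finset.sum_eq_single (2 * n - k)]
      · rw [if_pos (by omega), mul_one]
      · intro a ha hak
        rw [Finset.mem_range] at ha
        rw [if_neg (by omega), mul_zero]
      · intro h
        exact absurd (Finset.mem_range.mpr (by omega)) h
  · obtain ⟨k, rfl⟩ : ∃ k : ℕ, m = -1 - k := ⟨(-1 - m).toNat, by omega⟩
    rw [show (-1 - (k : ℤ) - (2 * n + 1)) = -1 - ((k + (2 * n + 1) : ℕ) : ℤ) by push_cast; ring]
    simp only [coeff_waveOp_neg]
    have h1 : dt n ((-1) ^ k * G i k) = (-1) ^ k * dt n (G i k) := by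
      have h := dt_intCast_mul n ((-1) ^ k) (G i k)
      push_cast at h
      exact h
    have h2 : (-1 : TimeField) ^ (k + (2 * n + 1)) = -(-1) ^ k := by
      rw [pow_add, pow_succ, pow_mul]
      norm_num
    rw [h1, hG.dt_eq, h2, mul_add, mul_add, Finset.mul_sum]
    have h3 : ∑ a ∈ Finset.range (2 * n + 1), (-1) ^ k * ((-1) ^ a * (G i a * G (2 * n - a) k)) =
        ∑ a ∈ Finset.range (2 * n + 1), (-1) ^ a * G i a * ((-1) ^ k * G (2 * n - a) k) :=
      Finset.sum_congr rfl fun a _ => by ring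
    rw [h3]
    ring

theorem IsRiccati.dPow_one_mul_waveOp {G : ℕ → ℕ → TimeField} (hG : IsRiccati G) (i : ℕ) :
    dPow 1 * waveOp G i = waveOp G (i + 1) + ofFun (G i 0) * waveOp G 0 := by
  have h := hG.timeDeriv_waveOp 0 i
  simpa [← dPow_one_mul_eq] using h

/-- The differential operators `P_i` with `P_i ∘ waveOp G 0 = waveOp G i`. -/
def diffOp (G : ℕ → ℕ → TimeField) : ℕ → PDO
  | 0 => 1
  | i + 1 => dPow 1 * diffOp G i - ofFun (G i 0)

theorem ordGE_diffOp (G : ℕ → ℕ → TimeField) (i : ℕ) : (diffOp G i).OrdGE 0 := by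
  induction i with
  | zero => exact ordGE_ofFun 1
  | succ i ih => exact (((ordGE_dPow 1).mono zero_le_one).mul ih).sub (ordGE_ofFun _)

theorem IsRiccati.diffOp_mul_waveOp {G : ℕ → ℕ → TimeField} (hG : IsRiccati G) (i : ℕ) :
    diffOp G i * waveOp G 0 = waveOp G i := by
  induction i with
  | zero => rw [diffOp, one_mul]
  | succ i ih => rw [diffOp, sub_mul, mul_assoc, ih, hG.dPow_one_mul_waveOp, add_sub_cancel_right]

/-- The differential operators `B_n` with `W_{t_{2n+1}} + W ∂^{2n+1} = B_n W` for
`W = waveOp G 0`. -/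
def flowOp (G : ℕ → ℕ → TimeField) (n : ℕ) : PDO :=
  diffOp G (2 * n + 1) +
    ∑ a ∈ Finset.range (2 * n + 1), ofFun ((-1) ^ a * G 0 a) * diffOp G (2 * n - a)

theorem ordGE_flowOp (G : ℕ → ℕ → TimeField) (n : ℕ) : (flowOp G n).OrdGE 0 :=
  (ordGE_diffOp G _).add (OrdGE.sum _ fun _ => (ordGE_ofFun _).mul (ordGE_diffOp G _))

theorem IsRiccati.timeDeriv_waveOp_zero {G : ℕ → ℕ → TimeField} (hG : IsRiccati G) (n : ℕ) :
    (waveOp G 0).timeDeriv n + waveOp G 0 * dPow (2 * n + 1) = flowOp G n * waveOp G 0 := by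
  rw [hG.timeDeriv_waveOp, flowOp, add_mul, Finset.sum_mul, hG.diffOp_mul_waveOp, zero_add]
  simp only [mul_assoc, hG.diffOp_mul_waveOp]

/-- The order-zero coefficient of P ∘ f, for a differential operator P, is P(f). The q_i satisfy the
recursion that defines the P_i. -/
theorem coeff_diffOp_mul_ofFun {G : ℕ → ℕ → TimeField} {q : ℕ → TimeField}
    (hq : ∀ i, dt 0 (q i) = q (i + 1) + G i 0 * q 0) (i : ℕ) :
    (diffOp G i * ofFun (q 0)).coeff 0 = q i := by
  induction i with
  | zero => rw [diffOp, one_mul, coeff_ofFun, if_pos rfl]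
  | succ i ih =>
    rw [diffOp, sub_mul, mul_assoc, coeff_sub, coeff_dPow_one_mul, ih,
      (ordGE_diffOp G i).mul (ordGE_ofFun _) _ (by omega), hq, ofFun_mul_ofFun, coeff_ofFun,
      if_pos rfl]
    ring

/-- The eigenfunction property B_n(q_0) = ∂q_0/∂t_{2n+1}; it will remove the order-zero term of the
conjugated flow. -/
theorem coeff_flowOp_mul_ofFun {G : ℕ → ℕ → TimeField} {q : ℕ → TimeField}
    (hq : ∀ n i, dt n (q i) = q (i + (2 * n + 1)) +
      ∑ a ∈ Finset.range (2 * n + 1), (-1) ^ a * (G i a * q (2 * n - a))) (n : ℕ) :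
    (flowOp G n * ofFun (q 0)).coeff 0 = dt n (q 0) := by
  have hq0 : ∀ i, dt 0 (q i) = q (i + 1) + G i 0 * q 0 := fun i => by simpa using hq 0 i
  rw [flowOp, add_mul, Finset.sum_mul, coeff_add, coeff_sum, coeff_diffOp_mul_ofFun hq0, hq,
    zero_add]
  simp only [mul_assoc, coeff_ofFun_mul, coeff_diffOp_mul_ofFun hq0]

/-- In the residue pairing only j = i and j = -1 survive, with contributions -G_{0i} and G_{i0}.
This is where symmetry of G enters. -/
theorem coeff_waveOp_mul_adjoint {G : ℕ → ℕ → TimeField} (hG : IsRiccati G) (i : ℕ) :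
    (waveOp G i * (waveOp G 0).adjoint).coeff (-1) = 0 := by
  rw [coeff_mul_adjoint, finsum_eq_sum_of_support_subset (s := {(i : ℤ), -1})]
  · rw [Finset.sum_pair (by omega), coeff_waveOp_natCast, if_pos rfl, coeff_waveOp_neg]
    have h1 := coeff_waveOp_neg G i 0
    have h2 := coeff_waveOp_natCast G 0 0
    rw [Nat.cast_zero, sub_zero] at h1
    rw [Nat.cast_zero] at h2
    have h3 : (-1 : TimeField) ^ (-1 - (i : ℤ)) * (-1) ^ i = -1 := by
      rw [← zpow_natCast, ← zpow_add₀ (by norm_num)]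
      norm_num
    rw [h1, sub_self, h2, if_pos rfl, hG.symm i 0, pow_zero, zpow_zero]
    linear_combination G 0 i * h3
  · intro j hj
    rw [Function.mem_support] at hj
    by_contra hj'
    refine hj ?_
    simp only [Finset.coe_insert, Finset.coe_singleton, Set.mem_insert_iff,
      Set.mem_singleton_iff, not_or] at hj'
    rcases le_or_gt 0 j with h | h
    · obtain ⟨j, rfl⟩ := Int.eq_ofNat_of_zero_le h
      rw [coeff_waveOp_natCast, if_neg (by omega), zero_mul]
    · obtain ⟨k, hk⟩ : ∃ k : ℕ, -1 - j = k := ⟨(-1 - j).toNat, by omega⟩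
      rw [hk, coeff_waveOp_natCast, if_neg (by omega), mul_zero, mul_zero]

theorem IsRiccati.dPow_mul_waveOp_mem {G : ℕ → ℕ → TimeField} (hG : IsRiccati G) (k : ℕ) :
    dPow k * waveOp G 0 ∈ AddSubgroup.closure
      (Set.range fun x : TimeField × ℕ => ofFun x.1 * waveOp G x.2) := by
  induction k with
  | zero => exact AddSubgroup.subset_closure ⟨(1, 0), by rw [Nat.cast_zero, dPow_zero]; rfl⟩
  | succ k ih =>
    rw [Nat.cast_succ, add_comm, ← dPow_mul_dPow, mul_assoc]
    generalize dPow k * waveOp G 0 = A at ih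
    induction ih using AddSubgroup.closure_induction with
    | mem A hA =>
      obtain ⟨⟨f, i⟩, rfl⟩ := hA
      have h : dPow 1 * (ofFun f * waveOp G i) = ofFun (dt 0 f) * waveOp G i +
          (ofFun f * waveOp G (i + 1) + ofFun (f * G i 0) * waveOp G 0) := by
        rw [← mul_assoc, dPow_one_mul_ofFun, add_mul, mul_assoc, hG.dPow_one_mul_waveOp, mul_add,
          ← mul_assoc (ofFun f) (ofFun _), ofFun_mul_ofFun]
      simp only [h]
      exact add_mem (AddSubgroup.subset_closure ⟨(dt 0 f, i), rfl⟩)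
        (add_mem (AddSubgroup.subset_closure ⟨(f, i + 1), rfl⟩)
          (AddSubgroup.subset_closure ⟨(f * G i 0, 0), rfl⟩))
    | zero => rw [mul_zero]; exact zero_mem _
    | add A B _ _ hA hB => rw [mul_add]; exact add_mem hA hB
    | neg A _ hA => rw [mul_neg]; exact neg_mem hA

/-- Every ∂^kW is a combination of the W_i with function coefficients, so all Res ∂^kWW^* vanish,
and WW^* has leading term 1. -/
theorem IsRiccati.waveOp_mul_adjoint {G : ℕ → ℕ → TimeField} (hG : IsRiccati G) :
    waveOp G 0 * (waveOp G 0).adjoint = 1 := by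
  have hd := degLE_waveOp G 0
  have h1 := coeff_waveOp_natCast G 0 0
  rw [Nat.cast_zero] at hd h1
  refine eq_one_of_residues (hd.mul hd.adjoint) ?_ fun k => ?_
  · have h := coeff_mul_top hd hd.adjoint
    rw [add_zero] at h
    rw [h, coeff_zero_adjoint hd, h1, if_pos rfl, one_mul]
  · rw [← mul_assoc]
    have h := hG.dPow_mul_waveOp_mem k
    generalize dPow k * waveOp G 0 = A at h
    induction h using AddSubgroup.closure_induction with
    | mem A hA =>
      obtain ⟨⟨f, i⟩, rfl⟩ := hA
      simp only [mul_assoc, coeff_ofFun_mul, coeff_waveOp_mul_adjoint hG, mul_zero]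
    | zero => rw [zero_mul, coeff_zero]
    | add A B _ _ hA hB => rw [add_mul, coeff_add, hA, hB, add_zero]
    | neg A _ hA => rw [neg_mul, coeff_neg, hA, neg_zero]

/-! ### Consequences of the dressing equations -/

/-- An invertible dressing operator `Z` with inverse `Y` and the differential operators `C_n` of its
flows. -/
structure IsDressingPair (Z Y : PDO) (C : ℕ → PDO) : Prop where
  deg : Z.DegLE 0
  deg_inv : Y.DegLE 0
  ne_zero : Z.coeff 0 ≠ 0
  mul_inv : Z * Y = 1
  inv_mul : Y * Z = 1
  adjoint_eq : Z.adjoint = Y * ofFun (Z.coeff 0 ^ 2)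
  flow : ∀ n, Z.timeDeriv n + Z * dPow (2 * n + 1) = C n * Z
  ord : ∀ n, (C n).OrdGE 1

theorem IsRiccati.exists_isDressingPair {G : ℕ → ℕ → TimeField} (hG : IsRiccati G)
    {q : ℕ → TimeField} (h0 : q 0 ≠ 0) (hq : ∀ n i, dt n (q i) = q (i + (2 * n + 1)) +
      ∑ a ∈ Finset.range (2 * n + 1), (-1) ^ a * (G i a * q (2 * n - a))) :
    ∃ Y C, IsDressingPair (ofFun (q 0)⁻¹ * waveOp G 0) Y C := by
  have hd := degLE_waveOp G 0
  have hW0 := coeff_waveOp_natCast G 0 0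
  rw [Nat.cast_zero] at hd hW0
  rw [if_pos rfl] at hW0
  have hW1 := hG.waveOp_mul_adjoint
  have hW2 := mul_eq_one_symm hd (by rw [hW0]; exact one_ne_zero) hW1
  have hZ0 : (ofFun (q 0)⁻¹ * waveOp G 0).coeff 0 = (q 0)⁻¹ := by
    rw [coeff_ofFun_mul, hW0, mul_one]
  -- Y = W⁻¹q with W⁻¹ = W^*, and C_n = q⁻¹(B_n q - q_{t_{2n+1}}) is the flow B_n gauge transformed
  -- by q.
  refine ⟨(waveOp G 0).adjoint * ofFun (q 0), fun n => ofFun (q 0)⁻¹ *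
    (flowOp G n * ofFun (q 0) - ofFun (dt n (q 0))), ?_, ?_, ?_, ?_, ?_, ?_, ?_, ?_⟩
  · exact (degLE_ofFun _).mul hd
  · exact hd.adjoint.mul (degLE_ofFun _)
  · rw [hZ0]
    exact inv_ne_zero h0
  · rw [mul_assoc, ← mul_assoc (waveOp G 0), hW1, one_mul, ofFun_inv_mul h0]
  · rw [mul_assoc, ← mul_assoc (ofFun (q 0)), ofFun_mul_inv h0, one_mul, hW2]
  · rw [hZ0, adjoint_mul, adjoint_ofFun, mul_assoc, ofFun_mul_ofFun]
    congr 2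
    field_simp
  · intro n
    rw [timeDeriv_mul, timeDeriv_ofFun, mul_assoc, add_assoc, ← mul_add,
      hG.timeDeriv_waveOp_zero, mul_assoc, sub_mul, mul_assoc (flowOp G n),
      ← mul_assoc (ofFun (q 0)), ofFun_mul_inv h0, one_mul, mul_sub, ← mul_assoc (ofFun (dt n _)),
      ← mul_assoc (ofFun _) (ofFun _ * ofFun _), ofFun_mul_ofFun, ofFun_mul_ofFun,
      show dt n (q 0)⁻¹ = -((q 0)⁻¹ * (dt n (q 0) * (q 0)⁻¹)) by rw [dt_inv]; field_simp]
    have h : ofFun (-((q 0)⁻¹ * (dt n (q 0) * (q 0)⁻¹))) * waveOp G 0 =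
        -(ofFun ((q 0)⁻¹ * (dt n (q 0) * (q 0)⁻¹)) * waveOp G 0) :=
      PDO.ext (funext fun m => by
        rw [coeff_neg, coeff_ofFun_mul, coeff_ofFun_mul, neg_mul])
    rw [h]
    abel
  -- C_n is differential, and its order-zero coefficient is q⁻¹(B_n(q) - q_{t_{2n+1}}) = 0.
  · intro n i hi
    rw [coeff_ofFun_mul, coeff_sub, coeff_ofFun]
    rcases (show i ≤ 0 by omega).lt_or_eq with h | rfl
    · rw [(ordGE_flowOp G n).mul (ordGE_ofFun _) i h, if_neg h.ne, sub_zero, mul_zero]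
    · rw [coeff_flowOp_mul_ofFun hq, if_pos rfl, sub_self, mul_zero]

namespace IsDressingPair

variable {Z Y : PDO} {C : ℕ → PDO}

theorem mul_dPow_mul_inv (h : IsDressingPair Z Y C) (n : ℕ) :
    Z * dPow (2 * n + 1) * Y = C n - Z.timeDeriv n * Y := by
  rw [eq_sub_iff_add_eq, ← add_mul, add_comm, h.flow, mul_assoc, h.mul_inv, mul_one]

theorem degLE_timeDeriv_mul_inv (h : IsDressingPair Z Y C) (n : ℕ) :
    (Z.timeDeriv n * Y).DegLE 0 := (h.deg.timeDeriv n).mul h.deg_inv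

/-- In Z∂^{2n+1}Y = C_n - Z_{t_{2n+1}}Y the first term has orders ≥ 1 and the second orders ≤ 0, so
this is the splitting into the two parts. -/
theorem le_zero (h : IsDressingPair Z Y C) (n : ℕ) :
    (Z * dPow (2 * n + 1) * Y).le 0 = -(Z.timeDeriv n * Y) := by
  refine PDO.ext (funext fun i => ?_)
  rw [coeff_le, h.mul_dPow_mul_inv, coeff_sub, coeff_neg]
  split_ifs with hi
  · rw [h.ord n i (by omega), zero_sub]
  · rw [h.degLE_timeDeriv_mul_inv n i (by omega), neg_zero]

theorem ge_one (h : IsDressingPair Z Y C) (n : ℕ) : (Z * dPow (2 * n + 1) * Y).ge 1 = C n := by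
  refine PDO.ext (funext fun i => ?_)
  rw [coeff_ge, h.mul_dPow_mul_inv, coeff_sub]
  split_ifs with hi
  · rw [h.degLE_timeDeriv_mul_inv n i (by omega), sub_zero]
  · exact (h.ord n i (by omega)).symm

theorem timeDeriv_eq (h : IsDressingPair Z Y C) (n : ℕ) :
    Z.timeDeriv n = -((Z * dPow (2 * n + 1) * Y).le 0 * Z) := by
  rw [h.le_zero, neg_mul, neg_neg, mul_assoc, h.inv_mul, mul_one]

theorem timeDeriv_inv (h : IsDressingPair Z Y C) (n : ℕ) :
    Y.timeDeriv n = dPow (2 * n + 1) * Y - Y * C n := by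
  have h1 := timeDeriv_mul n Z Y
  rw [h.mul_inv, timeDeriv_one] at h1
  have h2 : Y * (Z.timeDeriv n * Y + Z * Y.timeDeriv n) = 0 := by rw [← h1, mul_zero]
  rw [mul_add, ← mul_assoc Y Z, h.inv_mul, one_mul, eq_sub_of_add_eq (h.flow n), sub_mul,
    mul_assoc (C n), h.mul_inv, mul_one, mul_sub, mul_assoc Z, ← mul_assoc Y Z, h.inv_mul,
    one_mul] at h2
  rw [eq_sub_iff_add_eq, ← sub_eq_zero, ← h2]
  abel

theorem flow_zero (h : IsDressingPair Z Y C) : C 0 = dPow 1 := by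
  have h1 := h.flow 0
  rw [Nat.cast_zero, mul_zero, zero_add, ← dPow_one_mul_eq] at h1
  have h2 := congrArg (· * Y) h1
  simp only [mul_assoc, h.mul_inv, mul_one] at h2
  exact h2.symm

theorem lax_eq (h : IsDressingPair Z Y C) :
    Z * dPow 1 * Y = dPow 1 - Z.timeDeriv 0 * Y := by
  have h1 := h.mul_dPow_mul_inv 0
  rwa [Nat.cast_zero, mul_zero, zero_add, h.flow_zero] at h1

theorem coeff_lax_one (h : IsDressingPair Z Y C) : (Z * dPow 1 * Y).coeff 1 = 1 := by
  rw [h.lax_eq, coeff_sub, h.degLE_timeDeriv_mul_inv 0 1 (by omega), coeff_dPow, if_pos rfl,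
    sub_zero]

theorem coeff_lax_of_one_lt (h : IsDressingPair Z Y C) {i : ℤ} (hi : 1 < i) :
    (Z * dPow 1 * Y).coeff i = 0 := by
  rw [h.lax_eq, coeff_sub, h.degLE_timeDeriv_mul_inv 0 i (by omega), coeff_dPow,
    if_neg (by omega), sub_zero]

theorem coeff_inv (h : IsDressingPair Z Y C) : Y.coeff 0 = (Z.coeff 0)⁻¹ := by
  have h1 := coeff_mul_top h.deg h.deg_inv
  rw [h.mul_inv, add_zero] at h1
  exact eq_inv_of_mul_eq_one_right h1.symm

theorem coeff_lax_zero (h : IsDressingPair Z Y C) :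
    (Z * dPow 1 * Y).coeff 0 = -(dt 0 (Z.coeff 0) / Z.coeff 0) := by
  have h1 := coeff_mul_top (h.deg.timeDeriv 0) h.deg_inv
  rw [add_zero] at h1
  rw [h.lax_eq, coeff_sub, h1, coeff_dPow, if_neg (by omega), h.coeff_inv, coeff_timeDeriv,
    zero_sub, div_eq_mul_inv]

/-- Since v_0 = -z_{0,x}/z_0, the function z_0⁻² is a solution of E_x = 2v_0E. -/
theorem dt_inv_sq (h : IsDressingPair Z Y C) :
    dt 0 ((Z.coeff 0)⁻¹ ^ 2) = 2 * (Z * dPow 1 * Y).coeff 0 * (Z.coeff 0)⁻¹ ^ 2 := by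
  have h0 := h.ne_zero
  rw [h.coeff_lax_zero, pow_two, dt_mul, dt_inv]
  field_simp
  ring

theorem adjoint_inv (h : IsDressingPair Z Y C) : Y.adjoint = ofFun ((Z.coeff 0)⁻¹ ^ 2) * Z := by
  have h1 := congrArg PDO.adjoint h.mul_inv
  have h2 : ofFun (Z.coeff 0 ^ 2) * ofFun ((Z.coeff 0)⁻¹ ^ 2) = 1 := by
    rw [inv_pow]
    exact ofFun_mul_inv (pow_ne_zero 2 h.ne_zero)
  rw [adjoint_mul, h.adjoint_eq, one_def, adjoint_ofFun, ← one_def] at h1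
  have h3 := congrArg (· * (ofFun ((Z.coeff 0)⁻¹ ^ 2) * Z)) h1
  simp only [mul_assoc, one_mul] at h3
  rwa [← mul_assoc (ofFun _) (ofFun _), h2, one_mul, h.inv_mul, mul_one] at h3

theorem adjoint_dPow_one : (dPow 1).adjoint = -dPow 1 := by
  rw [adjoint_dPow]
  simp

theorem adjoint_dPow_neg_one : (dPow (-1)).adjoint = -dPow (-1) := by
  rw [adjoint_dPow]
  simp

theorem adjoint_lax (h : IsDressingPair Z Y C) :
    (Z * dPow 1 * Y).adjoint =
      -(ofFun ((Z.coeff 0)⁻¹ ^ 2) * (Z * dPow 1 * Y) * ofFun (Z.coeff 0 ^ 2)) := by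
  rw [adjoint_mul, adjoint_mul, h.adjoint_inv, h.adjoint_eq, adjoint_dPow_one]
  noncomm_ring

theorem adjoint_lax_of_dt_eq (h : IsDressingPair Z Y C) {E : TimeField} (hE : E ≠ 0)
    (hdt : dt 0 E = 2 * (Z * dPow 1 * Y).coeff 0 * E) :
    (Z * dPow 1 * Y).adjoint = -(ofFun E * (Z * dPow 1 * Y) * ofFun E⁻¹) := by
  have h0 := h.ne_zero
  set L := Z * dPow 1 * Y with hL
  -- E and z_0⁻² solve the same first-order equation, so their ratio c is constant in x, commutes
  -- with all operators, and cancels in the conjugation.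
  set c := E * Z.coeff 0 ^ 2 with hc
  have hc0 : c ≠ 0 := mul_ne_zero hE (pow_ne_zero 2 h0)
  have hdc : dt 0 c = 0 := by
    rw [hc, dt_mul, hdt, pow_two, dt_mul, h.coeff_lax_zero]
    field_simp
    ring
  have h1 : E = (Z.coeff 0)⁻¹ ^ 2 * c := by
    rw [hc]
    field_simp
  have h2 : E⁻¹ = c⁻¹ * Z.coeff 0 ^ 2 := by
    rw [hc]
    field_simp
  have h3 : ofFun E = ofFun ((Z.coeff 0)⁻¹ ^ 2) * ofFun c := by rw [ofFun_mul_ofFun, ← h1]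
  rw [h.adjoint_lax, ← hL, h2, ← ofFun_mul_ofFun, h3, mul_assoc (ofFun _) (ofFun c),
    ← mul_ofFun_const_comm hdc, mul_assoc _ (L * ofFun c), mul_assoc L,
    ← mul_assoc (ofFun c) (ofFun c⁻¹), ofFun_mul_inv hc0, one_mul, mul_assoc]

theorem lax_pow (h : IsDressingPair Z Y C) (k : ℕ) :
    (Z * dPow 1 * Y) ^ k = Z * dPow k * Y := by
  induction k with
  | zero => rw [pow_zero, Nat.cast_zero, dPow_zero, mul_one, h.mul_inv]
  | succ k ih =>
    rw [pow_succ, ih, mul_assoc (Z * dPow k), ← mul_assoc Y, ← mul_assoc Y, h.inv_mul, one_mul,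
      mul_assoc Z, ← mul_assoc (dPow k), dPow_mul_dPow, ← mul_assoc, Nat.cast_succ]

theorem timeDeriv_lax (h : IsDressingPair Z Y C) (n : ℕ) :
    (Z * dPow 1 * Y).timeDeriv n = C n * (Z * dPow 1 * Y) - (Z * dPow 1 * Y) * C n := by
  have h1 : Z * (dPow 1 * (dPow (2 * n + 1) * Y)) = Z * (dPow (2 * n + 1) * (dPow 1 * Y)) := by
    rw [← mul_assoc (dPow 1), ← mul_assoc (dPow (2 * n + 1)), dPow_mul_dPow, dPow_mul_dPow,
      add_comm]
  rw [timeDeriv_mul, timeDeriv_mul, timeDeriv_dPow, mul_zero, add_zero,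
    eq_sub_of_add_eq (h.flow n), h.timeDeriv_inv]
  simp only [mul_assoc, sub_mul, mul_sub, h1]
  abel

end IsDressingPair

/-! ### The bilinear residue -/

theorem mulExpXi_add {R : Type*} [Field R] (ε : ℤ) (F F' : ℤ → MvPowerSeries ℕ R) (j : ℤ) :
    mulExpXi ε (fun k => F k + F' k) j = mulExpXi ε F j + mulExpXi ε F' j := by
  ext m
  simp only [map_add, coeff_mulExpXi, mul_add, Finset.sum_add_distrib]

theorem mulExpXi_shift {R : Type*} [Field R] (ε : ℤ) (F : ℤ → MvPowerSeries ℕ R) (j l : ℤ) :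
    mulExpXi ε F (j - l) = mulExpXi ε (fun k => F (k - l)) j := by
  ext m
  simp only [coeff_mulExpXi]
  exact Finset.sum_congr rfl fun p _ => by rw [sub_right_comm]

theorem timeExp_dt_add (f g : TimeField) (m : ℕ →₀ ℕ) :
    timeExp dt (f + g) m = timeExp dt f m + timeExp dt g m :=
  timeExp_add (fun n => (dtDer n).toLinearMap) f g m

theorem timeExp_dt_zero (m : ℕ →₀ ℕ) : timeExp dt 0 m = 0 := by
  have h := timeExp_dt_add 0 0 m
  rw [add_zero] at h
  simpa using h

theorem timeExp_dt_add_single (f : TimeField) (n : ℕ) (m : ℕ →₀ ℕ) :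
    timeExp dt f (m + Finsupp.single n 1) * (m n + 1) = timeExp dt (dt n f) m := by
  have h1 := timeExp_add_single (fun n => (dtDer n).toLinearMap) (fun k l x => dt_comm k l x) f n m
  have h2 := timeExp_map (dtDer n).toLinearMap (fun n => (dtDer n).toLinearMap)
    (fun n => (dtDer n).toLinearMap) (fun k x => dt_comm n k x) f m
  have h3 := h1.trans h2
  rw [Nat.cast_smul_eq_nsmul, nsmul_eq_mul, mul_comm] at h3
  push_cast at h3
  exact h3

/-- The coefficients of the powers of `z` in `f(t' + y, z) h(t', z)`. -/
def bilinearCoeff (f h : ℤ → TimeField) (j : ℤ) : MvPowerSeries ℕ TimeField :=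
  fun m => ∑ᶠ i : ℤ, timeExp dt (f i) m * h (j - i)

theorem coeff_bilinearCoeff (f h : ℤ → TimeField) (j : ℤ) (m : ℕ →₀ ℕ) :
    MvPowerSeries.coeff m (bilinearCoeff f h j) = ∑ᶠ i : ℤ, timeExp dt (f i) m * h (j - i) := rfl

theorem bilinearRes_eq (f h : ℤ → TimeField) :
    bilinearRes f h = mulExpXi 1 (bilinearCoeff f h) (-1) := rfl

theorem pderiv_bilinearCoeff (f h : ℤ → TimeField) (n : ℕ) (j : ℤ) :
    MvPowerSeries.pderiv TimeField n (bilinearCoeff f h j) =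
      bilinearCoeff (fun i => dt n (f i)) h j := by
  ext m
  rw [MvPowerSeries.coeff_pderiv, coeff_bilinearCoeff, coeff_bilinearCoeff, finsum_mul]
  refine finsum_congr fun i => ?_
  rw [mul_right_comm, timeExp_dt_add_single]

theorem bilinearCoeff_shift (f h : ℤ → TimeField) (j l : ℤ) :
    bilinearCoeff f h (j - l) = bilinearCoeff (fun i => f (i - l)) h j := by
  ext m
  rw [coeff_bilinearCoeff, coeff_bilinearCoeff, ← finsum_comp_equiv (Equiv.subRight l)]
  refine finsum_congr fun i => ?_
  rw [Equiv.subRight_apply, sub_sub_sub_cancel_right]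

/-- The upper bounds on both series make each coefficient of z^j a finite sum; additivity of
`finsum` needs this. -/
theorem bilinearCoeff_add (A B : PDO) {h : ℤ → TimeField} {e : ℤ} (he : ∀ i, e < i → h i = 0)
    (j : ℤ) : bilinearCoeff (A + B).coeff h j =
      bilinearCoeff A.coeff h j + bilinearCoeff B.coeff h j := by
  have hfin : ∀ (A : PDO) (m : ℕ →₀ ℕ),
      Function.HasFiniteSupport fun i : ℤ => timeExp dt (A.coeff i) m * h (j - i) := by
    intro A m
    obtain ⟨d, hd⟩ := A.exists_degLE
    refine (Set.finite_Icc (j - e) d).subset fun i hi => ?_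
    by_contra hi'
    rw [Function.mem_support] at hi
    refine hi ?_
    rw [Set.mem_Icc, not_and_or, not_le, not_le] at hi'
    rcases hi' with hi' | hi'
    · rw [he _ (by omega), mul_zero]
    · rw [hd i hi', timeExp_dt_zero, zero_mul]
  ext m
  rw [map_add, coeff_bilinearCoeff, coeff_bilinearCoeff, coeff_bilinearCoeff,
    ← finsum_add_distrib (hfin A m) (hfin B m)]
  refine finsum_congr fun i => ?_
  rw [coeff_add, timeExp_dt_add, add_mul]

/-- ∂/∂y_n acts on the coefficients of A and on e^{ξ(y,z)}, where it gives z^{2n+1}, that is, right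
multiplication by ∂^{2n+1}. -/
theorem pderiv_bilinearRes (A : PDO) {h : ℤ → TimeField} {e : ℤ} (he : ∀ i, e < i → h i = 0)
    (n : ℕ) : MvPowerSeries.pderiv TimeField n (bilinearRes A.coeff h) =
      bilinearRes (A.timeDeriv n + A * dPow (2 * n + 1)).coeff h := by
  have h1 : (fun i => A.coeff (i - (2 * n + 1))) = (A * dPow (2 * n + 1)).coeff :=
    funext fun i => (coeff_mul_dPow A _ i).symm
  have h2 : (fun i => dt n (A.coeff i)) = (A.timeDeriv n).coeff := rfl
  simp only [bilinearRes_eq, pderiv_mulExpXi, mulExpXi_shift, pderiv_bilinearCoeff,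
    bilinearCoeff_shift, h1, h2, Int.cast_one, one_smul]
  rw [← mulExpXi_add]
  exact congrArg (fun F => mulExpXi 1 F (-1)) (funext fun k => (bilinearCoeff_add _ _ he k).symm)

theorem actExp_eq_zero {B : PDO} {e : ℤ} (hB : B.DegLE e) (ε i : ℤ) (hi : e < i) :
    B.actExp ε i = 0 := by
  rw [actExp, hB i hi, mul_zero]

theorem coeff_zero_bilinearRes (A B : PDO) :
    MvPowerSeries.coeff 0 (bilinearRes A.coeff (B.actExp (-1))) = (A * B.adjoint).coeff (-1) := by
  rw [bilinearRes_eq, coeff_zero_mulExpXi, coeff_bilinearCoeff, coeff_mul_adjoint]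
  refine finsum_congr fun i => ?_
  rw [timeExp_zero, actExp, Int.cast_neg, Int.cast_one]

namespace IsDressingPair

variable {Z Y : PDO} {C : ℕ → PDO}

/-- At y = 0 the residue is Res PZ(∂⁻¹z_0⁻²Z)^*, and ZZ^*z_0⁻² = 1 reduces it to -Res P∂⁻¹. -/
theorem coeff_zero_bilinearRes_mul (h : IsDressingPair Z Y C) (P : PDO) :
    MvPowerSeries.coeff 0 (bilinearRes (P * Z).coeff
      ((dPow (-1) * (ofFun ((Z.coeff 0)⁻¹ ^ 2) * Z)).actExp (-1))) = -P.coeff 0 := by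
  have h1 : ofFun (Z.coeff 0 ^ 2) * ofFun ((Z.coeff 0)⁻¹ ^ 2) = 1 := by
    rw [inv_pow]
    exact ofFun_mul_inv (pow_ne_zero 2 h.ne_zero)
  rw [coeff_zero_bilinearRes, adjoint_mul, adjoint_mul, adjoint_ofFun, h.adjoint_eq,
    adjoint_dPow_neg_one, mul_assoc Y, h1, mul_one, mul_assoc, ← mul_assoc Z, h.mul_inv, one_mul,
    mul_neg, coeff_neg, coeff_mul_dPow, sub_self]

theorem bilinearRes_eq_neg_one (h : IsDressingPair Z Y C) :
    bilinearRes Z.coeff ((dPow (-1) * (ofFun ((Z.coeff 0)⁻¹ ^ 2) * Z)).actExp (-1)) = -1 := by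
  have hc := h.coeff_zero_bilinearRes_mul
  obtain ⟨e, he⟩ := (dPow (-1) * (ofFun ((Z.coeff 0)⁻¹ ^ 2) * Z)).exists_degLE
  have hp := fun A => pderiv_bilinearRes A (actExp_eq_zero he (-1))
  generalize (dPow (-1) * (ofFun ((Z.coeff 0)⁻¹ ^ 2) * Z)).actExp (-1) = u at hc hp ⊢
  -- Derivatives replace PZ by (P_t + PC_n)Z, which keeps P of order ≥ 1 from below; such members
  -- vanish at y = 0, and the extra 1 cancels the value -1 at P = 1.
  refine eq_neg_of_add_eq_zero_left (eq_zero_of_pderiv_mem_closure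
    (insert (bilinearRes Z.coeff u + 1)
      {F | ∃ P : PDO, P.OrdGE 1 ∧ F = bilinearRes (P * Z).coeff u}) ?_ ?_ (Set.mem_insert _ _))
  · rintro _ (rfl | ⟨P, hP, rfl⟩) n
    · rw [map_add, hp, h.flow, Derivation.map_one_eq_zero, add_zero]
      exact AddSubgroup.subset_closure (Or.inr ⟨C n, h.ord n, rfl⟩)
    · refine AddSubgroup.subset_closure (Or.inr ⟨P.timeDeriv n + P * C n,
        (hP.timeDeriv n).add ((hP.mono zero_le_one).mul (h.ord n)), ?_⟩)
      rw [hp, timeDeriv_mul, mul_assoc P, add_assoc, ← mul_add, h.flow, add_mul, mul_assoc P]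
  · rintro _ (rfl | ⟨P, hP, rfl⟩)
    · have h1 := hc 1
      rw [one_mul, one_def, coeff_ofFun, if_pos rfl] at h1
      rw [map_add, h1, MvPowerSeries.coeff_zero_one, neg_add_cancel]
    · rw [hc, hP 0 one_pos, neg_zero]

end IsDressingPair

/-! ### The dressing operator of the wave function -/

theorem isRiccati_affineCoord {τ : Fock} (hτ : IsIsotropic τ) (h0 : evolve τ 1 ≠ 0) :
    IsRiccati (affineCoord τ) :=
  ⟨affineCoord_symm τ, dt_affineCoord hτ h0⟩

theorem actExp_one (Z : PDO) : Z.actExp 1 = Z.coeff :=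
  funext fun j => by rw [actExp, Int.cast_one, one_zpow, one_mul]

theorem isDressing_iff {b : ℤ →₀ ℂ} {τ : Fock} (hτ : IsIsotropic τ)
    (hb : matEl bra1 (betaAct b τ) ≠ 0) (Z : PDO) :
    IsDressing b τ Z ↔ Z = ofFun (betaCoord b τ 0)⁻¹ * waveOp (affineCoord τ) 0 := by
  have hw : (ofFun (betaCoord b τ 0)⁻¹ * waveOp (affineCoord τ) 0).coeff = wave b τ := by
    refine funext fun j => ?_
    rw [coeff_ofFun_mul]
    rcases lt_trichotomy 0 j with hj | rfl | hj
    · rw [degLE_waveOp (affineCoord τ) 0 j (by simpa using hj), wave_of_pos hτ hb hj, mul_zero]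
    · have h := coeff_waveOp_natCast (affineCoord τ) 0 0
      rw [Nat.cast_zero, if_pos rfl] at h
      rw [h, mul_one, wave_zero hτ hb]
    · obtain ⟨k, rfl⟩ : ∃ k : ℕ, j = -1 - k := ⟨(-1 - j).toNat, by omega⟩
      rw [coeff_waveOp_neg, wave_neg hτ hb]
  rw [IsDressing, actExp_one, ← hw]
  refine ⟨fun h => PDO.ext h.2, ?_⟩
  rintro rfl
  exact ⟨fun i hi => by rw [hw, wave_of_pos hτ hb hi], rfl⟩

end CKP

end

/-! ### The theorem -/

theorem mainTheorem1
    (g : CKP.Fock →. CKP.Fock) (hg : g ∈ CKP.SpInf)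
    (τ : CKP.Fock) (hτ : τ ∈ g CKP.vac)
    (b : ℤ →₀ ℂ) (hb : CKP.matEl CKP.bra1 (CKP.betaAct b τ) ≠ 0) :
    (∃! Z : CKP.PDO, CKP.IsDressing b τ Z) ∧
    ∀ Z : CKP.PDO, CKP.IsDressing b τ Z →
      Z.coeff 0 ≠ 0 ∧ Z.coeff 0 = (CKP.eigenfun b τ)⁻¹ ∧
      CKP.bilinearRes (CKP.wave b τ)
        ((CKP.PDO.dPow (-1) * (CKP.PDO.ofFun ((Z.coeff 0)⁻¹ ^ 2) * Z)).actExp (-1)) = -1 ∧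
      ∃ Zinv : CKP.PDO, Z * Zinv = 1 ∧ Zinv * Z = 1 ∧
        Z.adjoint = Zinv * CKP.PDO.ofFun (Z.coeff 0 ^ 2) ∧
        (∀ k : ℕ, Z.timeDeriv k
          = -((Z * CKP.PDO.dPow (2 * k + 1) * Zinv).le 0 * Z)) ∧
        ∃ L : CKP.PDO, L = Z * CKP.PDO.dPow 1 * Zinv ∧
          L.coeff 1 = 1 ∧ (∀ i, 1 < i → L.coeff i = 0) ∧
          (∃ E : CKP.TimeField, E ≠ 0 ∧ CKP.dt 0 E = 2 * L.coeff 0 * E) ∧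
          (∀ E : CKP.TimeField, E ≠ 0 → CKP.dt 0 E = 2 * L.coeff 0 * E →
            L.adjoint = -(CKP.PDO.ofFun E * L * CKP.PDO.ofFun E⁻¹)) ∧
          ∀ k : ℕ, L.timeDeriv k
            = (L ^ (2 * k + 1)).ge 1 * L - L * (L ^ (2 * k + 1)).ge 1 := by
  have hiso := CKP.IsIsotropic.of_mem_spInf hg hτ
  have hE := CKP.evolve_one_ne_zero hiso hb
  have hq := CKP.betaCoord_ne_zero hiso hb
  have hdr := CKP.isDressing_iff hiso hb
  refine ⟨⟨_, (hdr _).mpr rfl, fun Z hZ => (hdr Z).mp hZ⟩, fun Z hZ => ?_⟩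
  obtain ⟨Y, C, h⟩ := (CKP.isRiccati_affineCoord hiso hE).exists_isDressingPair hq
    (CKP.dt_betaCoord b hiso hE)
  rw [← (hdr Z).mp hZ] at h
  have hw : CKP.wave b τ = Z.coeff := by rw [← hZ.2, CKP.actExp_one]
  have hz : Z.coeff 0 = (CKP.eigenfun b τ)⁻¹ := by
    rw [← hw, CKP.wave_zero hiso hb, CKP.eigenfun_eq]
  have hpow : ∀ k : ℕ, (Z * CKP.PDO.dPow 1 * Y) ^ (2 * k + 1) =
      Z * CKP.PDO.dPow (2 * k + 1) * Y := fun k => by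
    have h1 := h.lax_pow (2 * k + 1)
    push_cast at h1
    exact h1
  refine ⟨h.ne_zero, hz, by rw [hw]; exact h.bilinearRes_eq_neg_one, Y, h.mul_inv, h.inv_mul,
    h.adjoint_eq, h.timeDeriv_eq, _, rfl, h.coeff_lax_one, fun i => h.coeff_lax_of_one_lt,
    -- The solution exhibited is E = z_0⁻² = q².
    ⟨_, pow_ne_zero 2 (inv_ne_zero h.ne_zero), h.dt_inv_sq⟩,
    fun E => h.adjoint_lax_of_dt_eq, fun k => ?_⟩
  rw [hpow, h.ge_one, h.timeDeriv_lax]
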